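/- Let $G=(V,E)$ be a finite graph. On $M=(\mathbb S^2)^{V}$, whose points are families $e=(e_i)_{i\in V}$ of unit vectors of $\mathbb R^3$, consider the antiferromagnetic Heisenberg symbol $h(e)=\sum_{\{i,j\}\in E} e_i\cdot e_j$. Its minimal set is the set of the points of $M$ where $h$ is minimal. The loop of $n$ triangles is the graph with $2n$ vertices $a_i,b_i$ ($i\in\mathbb Z/n$) in which, for each $i$, the vertices $a_i,a_{i+1},b_i$ are pairwise adjacent (and there is no other edge). If $e$ is in the minimal set, the Melin value $\mu(e)$ is defined as follows. Give $\mathbb S^2=\mathbb{CP}^1$ the Kähler structure of a round sphere of radius $1/2$ (the one quantized by homogeneous polynomials of degree $N$), identify $T_eM$ unitarily with $\mathbb C^{V}$, and let $\rho$ be the corresponding normal coordinates (the Riemannian exponential map at $e$). Then $h\circ\rho(z)-\min h=Q(z)+O(|z|^3)$ with $Q$ a positive semi-definite real quadratic form on $\mathbb C^V$, and $\mu(e)=\inf \operatorname{Sp}(T_1(Q))$, where $T_1(Q)u=\Pi_1(Qu)$ is the (essentially self-adjoint) Toeplitz operator with symbol $Q$ on the Bargmann space of the functions $e^{-|z|^2/2}f(z)$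 in $L^2(\mathbb C^V)$ with $f$ entire, and $\Pi_1$ is the orthogonal projection onto this space. (1) For the loop of 6 triangles, the minimal set is not a smooth submanifold. (2) For the loop of 4 triangles, the minimal set is the direct product of $SO(3)$ and a union of three circles, any two of which intersect at exactly one point, transversally. Precisely: there are smooth embedded circles $C_1,C_2,C_3$ in $M$ such that $(R,x)\mapsto Rx$ is a homeomorphism from $SO(3)\times(C_1\cup C_2\cup C_3)$ onto the minimal set (where $R$ acts simultaneously on all the vectors); the map $(R,x)\mapsto Rx$ on each $SO(3)\times C_i$ is an immersion; and for $i\neq j$ the circles $C_i$ and $C_j$ have exactly one common point, at which their tangent lines are linearly independent, also modulo the tangent space of the $SO(3)$-orbit. (3) For the loop of 4 triangles, every planar configuration $e$ of the minimal set (all vectors $e_i$ in a common plane through $0$) is a local minimum of $\mu$ on the minimal set. -/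

import Mathlib

open scoped ContDiff Matrix

noncomputable section

/-! ## Spin configurations and the Heisenberg symbol -/

/-- Euclidean three-space. -/
abbrev R3 : Type := EuclideanSpace ℝ (Fin 3)

/-- A vector of `ℝ³` at each site; the spin configurations are those in `spinSpace`. -/
abbrev Config (V : Type*) : Type _ := V → R3

/-- The classical phase space `(S²)^V`: a unit vector at each site. -/
def spinSpace (V : Type*) : Set (Config V) := {e | ∀ v, ‖e v‖ = 1}

/-- The antiferromagnetic Heisenberg symbol: the sum over the (unoriented) edges `{i, j}` of
the scalar product of `e i` and `e j`. -/
def heisenberg {V : Type*} [Fintype V] [DecidableEq V] (G : SimpleGraph V)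
    [DecidableRel G.Adj] (e : Config V) : ℝ :=
  ∑ b ∈ G.edgeFinset,
    Sym2.lift ⟨fun i j => inner ℝ (e i) (e j), fun i j => real_inner_comm (e j) (e i)⟩ b

/-- The classical minimal set of a symbol `h` on `(S²)^V`. -/
def minimalSet {V : Type*} (h : Config V → ℝ) : Set (Config V) :=
  {e | e ∈ spinSpace V ∧ ∀ f ∈ spinSpace V, h e ≤ h f}

/-- Sites of the loop of `n` triangles: `inl i` is the inner site shared by the triangles
`i - 1` and `i`, and `inr i` is the outer site of the triangle `i`. -/
abbrev LoopSite (n : ℕ) : Type := ZMod n ⊕ ZMod n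

/-- The three sites of the triangle number `i`. -/
def loopTriangle (n : ℕ) (i : ZMod n) : Finset (LoopSite n) :=
  {Sum.inl i, Sum.inl (i + 1), Sum.inr i}

/-- The loop of `n` triangles: two distinct sites are linked when they are in a common
triangle. -/
def triangleLoop (n : ℕ) : SimpleGraph (LoopSite n) where
  Adj u v := u ≠ v ∧ ∃ i, u ∈ loopTriangle n i ∧ v ∈ loopTriangle n i
  symm := ⟨fun _ _ h => ⟨h.1.symm, h.2.imp fun _ hi => ⟨hi.2, hi.1⟩⟩⟩
  loopless := ⟨fun _ h => h.1 rfl⟩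

instance (n : ℕ) [NeZero n] : DecidableRel (triangleLoop n).Adj := fun u v =>
  inferInstanceAs (Decidable (u ≠ v ∧ ∃ i, u ∈ loopTriangle n i ∧ v ∈ loopTriangle n i))

/-- All the vectors of the configuration lie in a common plane through the origin. -/
def IsPlanar {V : Type*} (e : Config V) : Prop := ∃ m : R3, m ≠ 0 ∧ ∀ v, inner ℝ m (e v) = 0

/-! ## Submanifolds, circles, rotations -/

/-- `Z` is a smooth embedded submanifold of `E` (`E` finite-dimensional): near each of its
points a smooth diffeomorphism between open sets of `E` straightens `Z` to a linear subspace.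
The dimension may depend on the point. -/
def IsSmoothSubmanifold {E : Type*} [NormedAddCommGroup E] [NormedSpace ℝ E] (Z : Set E) :
    Prop :=
  ∀ x ∈ Z, ∃ (φ : OpenPartialHomeomorph E E) (S : Submodule ℝ E), x ∈ φ.source ∧
    ContDiffOn ℝ ∞ φ φ.source ∧ ContDiffOn ℝ ∞ φ.symm φ.target ∧
    φ '' (φ.source ∩ Z) = φ.target ∩ S

/-- `γ` is a smooth regular parametrisation, with period `2π`, of a smooth embedded circle. -/
structure IsEmbeddedCircle {E : Type*} [NormedAddCommGroup E] [NormedSpace ℝ E] (γ : ℝ → E) :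
    Prop where
  smooth : ContDiff ℝ ∞ γ
  regular : ∀ t, deriv γ t ≠ 0
  inj : ∀ s t, γ s = γ t ↔ ∃ k : ℤ, s = t + k * (2 * Real.pi)

/-- The rotation group `SO(3)`. -/
abbrev SO3 : Type := Matrix.specialOrthogonalGroup (Fin 3) ℝ

/-- The simultaneous action of a rotation on all the vectors of a configuration. -/
def rotate {V : Type*} (R : SO3) (e : Config V) : Config V :=
  fun v => WithLp.toLp 2 ((R : Matrix (Fin 3) (Fin 3) ℝ) *ᵥ (e v).ofLp)

/-- The cross product on `ℝ³`. -/
def cross (u v : R3) : R3 := WithLp.toLp 2 (crossProduct u.ofLp v.ofLp)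

/-- The set `{(r × e v)_v : r ∈ ℝ³}`, the tangent space at `e` to the orbit of `e` under
rotations. -/
def orbitTangent {V : Type*} (e : Config V) : Set (Config V) :=
  Set.range fun (r : R3) (v : V) => cross r (e v)

/-! ## Toeplitz operators on `ℂⁿ` and the Melin value of a quadratic form -/

/-- The Hilbert space `L²(ℂ^V)`. -/
abbrev L2C (V : Type*) [Fintype V] : Type _ :=
  MeasureTheory.Lp ℂ 2 (MeasureTheory.volume : MeasureTheory.Measure (V → ℂ))

/-- The Bargmann space `B₁`: the functions `z ↦ exp (-|z|²/2) f z` of `L²(ℂ^V)`, `f` entire. -/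
def bargmann (V : Type*) [Fintype V] : Submodule ℂ (L2C V) where
  carrier := {u | ∃ f : (V → ℂ) → ℂ, Differentiable ℂ f ∧
    u =ᵐ[MeasureTheory.volume] fun z => (Real.exp (-(∑ v, ‖z v‖ ^ 2) / 2) : ℂ) * f z}
  zero_mem' := ⟨0, differentiable_const 0, by
    filter_upwards [MeasureTheory.Lp.coeFn_zero ℂ 2
      (MeasureTheory.volume : MeasureTheory.Measure (V → ℂ))] with z hz
    simp⟩
  add_mem' := by
    rintro u w ⟨f, hf, hu⟩ ⟨g, hg, hw⟩
    refine ⟨f + g, hf.add hg, ?_⟩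
    filter_upwards [MeasureTheory.Lp.coeFn_add u w, hu, hw] with z h1 h2 h3
    rw [h1, Pi.add_apply, h2, h3, Pi.add_apply, mul_add]
  smul_mem' := by
    rintro c u ⟨f, hf, hu⟩
    refine ⟨c • f, hf.const_smul c, ?_⟩
    filter_upwards [MeasureTheory.Lp.coeFn_smul c u, hu] with z h1 h2
    rw [h1, Pi.smul_apply, h2, Pi.smul_apply, smul_eq_mul, smul_eq_mul, mul_left_comm]

/-- The graph of the Toeplitz operator `T₁(Q) u = Π₁ (Q u)`, with domain the `u` in the Bargmann
space such that `Q u` is in `L²`. Here `Π₁` is the orthogonal projection on the Bargmann space,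
so that `w = Π₁ g` means that `w` is in the Bargmann space and `g - w` is orthogonal to it. -/
def toeplitzGraph {V : Type*} [Fintype V] (Q : (V → ℂ) → ℝ) : Set (bargmann V × bargmann V) :=
  {p | ∃ g : L2C V,
    g =ᵐ[MeasureTheory.volume] (fun z => (Q z : ℂ) * (p.1 : L2C V) z) ∧
    g - (p.2 : L2C V) ∈ (bargmann V)ᗮ}

/-- The spectrum of the (possibly unbounded) closed operator with graph `Γ`. The number `z` is in
the resolvent set when the operator minus `z` has an everywhere defined bounded inverse `R`;
that `R` is this inverse means that `(u, w)` is in `Γ` if and only if `R (w - z u) = u`. -/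
def graphSpectrum {H : Type*} [NormedAddCommGroup H] [NormedSpace ℂ H] (Γ : Set (H × H)) :
    Set ℂ :=
  {z | ¬ ∃ R : H →L[ℂ] H, ∀ u w : H, (u, w) ∈ Γ ↔ R (w - z • u) = u}

/-- The Melin value of a semi-definite positive quadratic form `Q` on `ℂ^V`: the infimum of the
spectrum of the essentially self-adjoint operator `T₁(Q)`, that is, of the spectrum of its
closure (whose graph is the closure of the graph). -/
def melinValueForm {V : Type*} [Fintype V] (Q : (V → ℂ) → ℝ) : ℝ :=
  sInf {x : ℝ | (x : ℂ) ∈ graphSpectrum (closure (toeplitzGraph Q))}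

/-! ## Normal coordinates and the Melin value at a point -/

theorem exists_unit_perp (e : R3) : ∃ a : R3, ‖a‖ = 1 ∧ inner ℝ e a = 0 := by
  have hlt : Module.finrank ℝ (Submodule.span ℝ {e}) < Module.finrank ℝ R3 := by
    refine lt_of_le_of_lt (finrank_span_le_card ({e} : Set R3)) ?_
    simp
  have hne : (Submodule.span ℝ {e})ᗮ ≠ ⊥ := by
    intro h
    have h2 := Submodule.finrank_add_finrank_orthogonal (Submodule.span ℝ {e})
    rw [h, finrank_bot] at h2
    omega
  obtain ⟨a, ha, ha0⟩ := Submodule.exists_mem_ne_zero_of_ne_bot hne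
  refine ⟨‖a‖⁻¹ • a, ?_, ?_⟩
  · rw [norm_smul, norm_inv, norm_norm, inv_mul_cancel₀ (norm_ne_zero_iff.mpr ha0)]
  · rw [inner_smul_right,
      (Submodule.mem_orthogonal _ _).mp ha e (Submodule.mem_span_singleton_self e), mul_zero]

/-- A unit vector orthogonal to `e`. -/
def unitPerp (e : R3) : R3 := (exists_unit_perp e).choose

/-- The identification of `ℂ` with the tangent plane of the sphere at a unit vector `e` given by
the frame `(a, e × a)`, where `a` is a unit tangent vector; multiplication by `i` becomes the
complex structure `ξ ↦ e × ξ` of the sphere. The factor `2` comes from the Kähler structure of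
`S² = ℂP¹`: for the quantization by homogeneous polynomials (with Bargmann weight `exp (-|z|²)`
in the limit) it is a round sphere of radius `1/2`. -/
def tangentFrame (e : R3) (z : ℂ) : R3 :=
  (2 : ℝ) • (z.re • unitPerp e + z.im • cross e (unitPerp e))

/-- The exponential map of the unit sphere at `e`. -/
def sphereExp (e ξ : R3) : R3 := Real.cos ‖ξ‖ • e + Real.sinc ‖ξ‖ • ξ

/-- Normal coordinates on `(S²)^V` at `e`. -/
def normalMap {V : Type*} (e : Config V) (z : V → ℂ) : Config V :=
  fun v => sphereExp (e v) (tangentFrame (e v) (z v))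

/-- The quadratic form `Q` with `h (ρ z) = h e + Q z + O(|z|³)` at a critical point `e` of `h`,
where `ρ` are normal coordinates at `e`: half of the Hessian of `h ∘ ρ` at `0`. -/
def halfHessian {V : Type*} (h : Config V → ℝ) (e : Config V) (z : V → ℂ) : ℝ :=
  iteratedDeriv 2 (fun t : ℝ => h (normalMap e (t • z))) 0 / 2

/-- The Melin value `μ(e)`, at a point `e` where `h` is minimal, of the symbol `h - min h`. It does
not depend on the choice of the frames, because another choice is a unitary change of
variables. -/
def melinValue {V : Type*} [Fintype V] (h : Config V → ℝ) (e : Config V) : ℝ :=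
  melinValueForm (halfHessian h e)

end

/-! ### Growth classes and the Gaussian mean value property -/

noncomputable section

open MeasureTheory Complex ComplexConjugate

variable {V : Type*} [Fintype V]

/-! On unit vectors the energy of a loop is the sum over its triangles of (|S_i|² - 3)/2, where S_i
is the sum of the three vectors of triangle i (`heisenberg_eq_of_mem`). The minimal set is therefore
given by S_i = 0 for all i: consecutive inner vectors have product -1/2, and they determine the
outer ones.

Six triangles. When the inner vectors are u, v, u, v, u, v, the first one can turn about its two
equal neighbours, and so can the second. If the minimal set were a submanifold, the sum of these two
velocities would again be the velocity of a curve in it (`IsSmoothSubmanifold.exists_curve_add`).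
But the alternating sum of the consecutive products is a quadratic form which vanishes on the
minimal set and whose linear part at this point cancels, so it vanishes on all velocities
(`alternatingForm_velocity`); on the sum of the two it equals 3/4.

Four triangles. A unique rotation brings the first two inner vectors to u and v. The other two, a
and b, satisfy v·a = a·b = b·u = -1/2: either a = u and b is free on a circle, or b = v and a is
free, or b is determined by a on a third branch (`IsGauge.cases`). These are the three circles;
their pairwise intersections are exactly the planar configurations.

Melin value. The Hessian is a sum of squares of real linear forms. For such a Q, the bottom of the
spectrum of T₁(Q) is the infimum of ∫Q|f|²exp(-|z|²) / ∫|f|²exp(-|z|²) over entire functions f whose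
growth is strictly slower than exp(|z|²/2) (`exists_isLeast_spectrum`). This rests on the density of
the range of T₁(Q) - l on such f (`toeplitzCore_dense_range`), proved by testing with dilations of a
putative orthogonal vector.

Lower bound: the forms of the even triangles are paired with those of the odd triangles, mixed by an
orthogonal matrix W, and the uncertainty principle is applied to each pair
(`le_melinValueForm_of_orthogonal`); the result is 12 plus a linear expression in W. At a planar
point several W reach 14 + 2√3. On each arc leaving the point, one of them gains a multiple of |sin
t| and loses only a multiple of 1 - |cos t|, so the bound 14 + 2√3 persists nearby. Upper bound:
squeezed Gaussians give at most 14 + 2√3 at every planar configuration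
(`melinValue_planar_le_value`). The two bounds together give the local minimum, which has a corner
rather than a vanishing derivative. -/

/-- The square of the Hermitian norm on `ℂ^V`. -/
def nsq (z : V → ℂ) : ℝ := ∑ v, ‖z v‖ ^ 2

/-- The Hermitian product on `ℂ^V`, antilinear in the first variable. -/
def herm (v z : V → ℂ) : ℂ := ∑ i, conj (v i) * z i

/-- `f` grows at most like `exp (a |z|²)`. -/
def Gr (a : ℝ) (f : (V → ℂ) → ℂ) : Prop := ∃ C, ∀ z, ‖f z‖ ≤ C * Real.exp (a * nsq z)

theorem nsq_nonneg (z : V → ℂ) : 0 ≤ nsq z := Finset.sum_nonneg fun _ _ => sq_nonneg _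

theorem nsq_smul (c : ℂ) (z : V → ℂ) : nsq (c • z) = ‖c‖ ^ 2 * nsq z := by
  simp [nsq, mul_pow, Finset.mul_sum]

theorem nsq_real_smul (c : ℝ) (z : V → ℂ) : nsq (c • z) = c ^ 2 * nsq z := by
  simp [nsq, mul_pow, Finset.mul_sum]

theorem continuous_nsq : Continuous (nsq : (V → ℂ) → ℝ) := by
  unfold nsq; fun_prop

theorem herm_self (z : V → ℂ) : herm z z = (nsq z : ℂ) := by
  simp [herm, nsq, ← Complex.normSq_eq_conj_mul_self, Complex.normSq_eq_norm_sq]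

theorem conj_herm (v z : V → ℂ) : conj (herm v z) = herm z v := by
  simp [herm, mul_comm]

theorem herm_add_right (v z w : V → ℂ) : herm v (z + w) = herm v z + herm v w := by
  simp [herm, mul_add, Finset.sum_add_distrib]

theorem herm_add_left (v z w : V → ℂ) : herm (z + w) v = herm z v + herm w v := by
  simp [herm, add_mul, Finset.sum_add_distrib]

theorem herm_smul_right (c : ℂ) (v z : V → ℂ) : herm v (c • z) = c * herm v z := by
  simp only [herm, Finset.mul_sum, Pi.smul_apply, smul_eq_mul]
  exact Finset.sum_congr rfl fun _ _ => by ring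

theorem herm_smul_left (c : ℂ) (v z : V → ℂ) : herm (c • v) z = conj c * herm v z := by
  simp only [herm, Finset.mul_sum, Pi.smul_apply, smul_eq_mul, map_mul]
  exact Finset.sum_congr rfl fun _ _ => by ring

theorem herm_real_smul_right (c : ℝ) (v z : V → ℂ) : herm v (c • z) = c * herm v z := by
  rw [← herm_smul_right]; rfl

theorem herm_real_smul_left (c : ℝ) (v z : V → ℂ) : herm (c • v) z = c * herm v z := by
  have := herm_smul_left (c : ℂ) v z
  rw [conj_ofReal] at this
  rw [← this]; rfl

theorem herm_zero_right (v : V → ℂ) : herm v 0 = 0 := by simp [herm]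

theorem nsq_add (z w : V → ℂ) : nsq (z + w) = nsq z + nsq w + 2 * (herm z w).re := by
  have h : ((nsq (z + w) : ℝ) : ℂ) = nsq z + nsq w + (herm z w + conj (herm z w)) := by
    rw [← herm_self, ← herm_self, ← herm_self, herm_add_left, herm_add_right, herm_add_right,
      conj_herm]
    ring
  rw [Complex.add_conj] at h
  exact_mod_cast h

/-- The Hermitian product as a continuous linear form. -/
def hermL (v : V → ℂ) : (V → ℂ) →L[ℂ] ℂ := ∑ i, conj (v i) • ContinuousLinearMap.proj i

theorem hermL_apply (v z : V → ℂ) : hermL v z = herm v z := by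
  simp [hermL, herm]

theorem norm_herm_sq_le (v z : V → ℂ) : ‖herm v z‖ ^ 2 ≤ nsq v * nsq z := by
  have h1 : ‖herm v z‖ ≤ ∑ i, ‖v i‖ * ‖z i‖ := by
    refine (norm_sum_le _ _).trans (le_of_eq ?_)
    simp
  calc ‖herm v z‖ ^ 2 ≤ (∑ i, ‖v i‖ * ‖z i‖) ^ 2 := by gcongr
    _ ≤ _ := Finset.sum_mul_sq_le_sq_mul_sq _ _ _

theorem differentiable_herm (v : V → ℂ) : Differentiable ℂ (herm v) := by
  have : herm v = hermL v := funext fun z => (hermL_apply v z).symm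
  rw [this]; exact (hermL v).differentiable

theorem continuous_herm (v : V → ℂ) : Continuous (herm v) := (differentiable_herm v).continuous

theorem integrable_gauss {c : ℝ} (hc : 0 < c) :
    Integrable (fun z : V → ℂ => Real.exp (-c * nsq z)) := by
  have h1 : Integrable (fun z : ℂ => Real.exp (-c * ‖z‖ ^ 2)) := by
    have := (GaussianFourier.integrable_cexp_neg_mul_sq_norm_add (V := ℂ) (b := (c : ℂ))
      (by simpa using hc) 0 0).re
    refine this.congr (Filter.Eventually.of_forall fun z => ?_)
    have : (-(c : ℂ) * (‖z‖ : ℂ) ^ 2 + 0 * (inner ℝ (0 : ℂ) z : ℝ)) = ((-c * ‖z‖ ^ 2 : ℝ) : ℂ) := by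
      push_cast; ring
    simp only
    rw [this, ← Complex.ofReal_exp]
    rfl
  have := Integrable.fintype_prod (ι := V) (f := fun _ z => Real.exp (-c * ‖z‖ ^ 2))
    (μ := fun _ => (volume : Measure ℂ)) (fun _ => h1)
  refine this.congr (Filter.Eventually.of_forall fun z => ?_)
  simp only [nsq, Finset.mul_sum, Real.exp_sum]

theorem Gr.const_nonneg {a C : ℝ} {f : (V → ℂ) → ℂ} (h : ∀ z, ‖f z‖ ≤ C * Real.exp (a * nsq z)) :
    0 ≤ C := by
  have := (norm_nonneg _).trans (h 0)
  exact nonneg_of_mul_nonneg_left this (Real.exp_pos _)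

theorem Gr.integrable {c : ℝ} {f : (V → ℂ) → ℂ} (h : Gr c f) (hc : c < 0)
    (hf : AEStronglyMeasurable f volume) : Integrable f := by
  obtain ⟨C, hC⟩ := h
  refine Integrable.mono' ((integrable_gauss (V := V) (c := -c) (by linarith)).const_mul C) hf ?_
  filter_upwards with z
  simpa using hC z

theorem Gr.mul {a b c : ℝ} {f g : (V → ℂ) → ℂ} (hf : Gr a f) (hg : Gr b g) (hc : a + b ≤ c) :
    Gr c (fun z => f z * g z) := by
  obtain ⟨C, hC⟩ := hf
  obtain ⟨D, hD⟩ := hg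
  refine ⟨C * D, fun z => ?_⟩
  have hC0 := Gr.const_nonneg hC
  have hD0 := Gr.const_nonneg hD
  rw [norm_mul]
  calc ‖f z‖ * ‖g z‖ ≤ (C * Real.exp (a * nsq z)) * (D * Real.exp (b * nsq z)) := by
        gcongr
        · exact hC z
        · exact hD z
    _ = C * D * Real.exp ((a + b) * nsq z) := by rw [add_mul, Real.exp_add]; ring
    _ ≤ _ := by
        have := nsq_nonneg z
        gcongr

theorem Gr.mono {a b : ℝ} {f : (V → ℂ) → ℂ} (hf : Gr a f) (h : a ≤ b) : Gr b f := by
  obtain ⟨C, hC⟩ := hf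
  refine ⟨C, fun z => (hC z).trans ?_⟩
  have := nsq_nonneg z
  have := Gr.const_nonneg hC
  gcongr

theorem Gr.of_norm_le {a : ℝ} {f g : (V → ℂ) → ℂ} (hf : Gr a f) (h : ∀ z, ‖g z‖ ≤ ‖f z‖) :
    Gr a g := by
  obtain ⟨C, hC⟩ := hf
  exact ⟨C, fun z => (h z).trans (hC z)⟩

theorem Gr.conj {a : ℝ} {f : (V → ℂ) → ℂ} (hf : Gr a f) : Gr a (fun z => conj (f z)) :=
  hf.of_norm_le fun z => by simp

theorem Gr.add {a : ℝ} {f g : (V → ℂ) → ℂ} (hf : Gr a f) (hg : Gr a g) :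
    Gr a (fun z => f z + g z) := by
  obtain ⟨C, hC⟩ := hf
  obtain ⟨D, hD⟩ := hg
  refine ⟨C + D, fun z => (norm_add_le _ _).trans ?_⟩
  rw [add_mul]
  exact add_le_add (hC z) (hD z)

theorem Gr.const_mul {a : ℝ} {f : (V → ℂ) → ℂ} (hf : Gr a f) (c : ℂ) :
    Gr a (fun z => c * f z) := by
  obtain ⟨C, hC⟩ := hf
  refine ⟨‖c‖ * C, fun z => ?_⟩
  rw [norm_mul, mul_assoc]
  gcongr
  exact hC z

theorem Gr.comp_smul {a : ℝ} {f : (V → ℂ) → ℂ} (hf : Gr a f) (r : ℝ) :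
    Gr (r ^ 2 * a) (fun z => f (r • z)) := by
  obtain ⟨C, hC⟩ := hf
  refine ⟨C, fun z => (hC _).trans (le_of_eq ?_)⟩
  rw [nsq_real_smul]; ring_nf

theorem gr_exp (a : ℝ) : Gr a (fun z : V → ℂ => (Real.exp (a * nsq z) : ℂ)) :=
  ⟨1, fun z => by rw [Complex.norm_real, Real.norm_eq_abs, abs_of_pos (Real.exp_pos _), one_mul]⟩

theorem gr_herm (v : V → ℂ) {ε : ℝ} (hε : 0 < ε) : Gr ε (herm v) := by
  refine ⟨Real.sqrt (nsq v / ε), fun z => ?_⟩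
  have h1 := norm_herm_sq_le v z
  have hz := nsq_nonneg z
  have hv := nsq_nonneg v
  refine abs_le_of_sq_le_sq' ?_ (by positivity) |>.2
  rw [mul_pow, Real.sq_sqrt (by positivity), ← Real.exp_nat_mul]
  refine h1.trans ?_
  have h2 : ε * nsq z ≤ Real.exp ((2 : ℕ) * (ε * nsq z)) := by
    refine le_trans ?_ (Real.add_one_le_exp _)
    have := mul_nonneg hε.le hz
    push_cast; linarith
  calc nsq v * nsq z = nsq v / ε * (ε * nsq z) := by field_simp
    _ ≤ _ := by gcongr

theorem gr_nsq {ε : ℝ} (hε : 0 < ε) : Gr ε (fun z : V → ℂ => (nsq z : ℂ)) := by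
  refine ⟨1 / ε, fun z => ?_⟩
  have hz := nsq_nonneg z
  rw [Complex.norm_real, Real.norm_eq_abs, abs_of_nonneg hz]
  have h2 : ε * nsq z ≤ Real.exp (ε * nsq z) :=
    le_trans (by linarith) (Real.add_one_le_exp _)
  calc nsq z = 1 / ε * (ε * nsq z) := by field_simp
    _ ≤ _ := by gcongr

/-- The total mass of the Gaussian weight. -/
def gaussMass (V : Type*) [Fintype V] : ℝ := ∫ z : V → ℂ, Real.exp (-nsq z)

theorem gaussMass_pos : 0 < gaussMass V := by
  have h := integrable_gauss (V := V) one_pos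
  simp only [neg_mul, one_mul] at h
  exact integral_exp_pos h

theorem measurePreserving_unit_smul {c : ℂ} (hc : ‖c‖ = 1) :
    MeasurePreserving (fun z : V → ℂ => c • z) volume volume := by
  let a : Circle := ⟨c, by simpa [Submonoid.unitSphere] using hc⟩
  have h : ∀ _ : V, MeasurePreserving (fun z : ℂ => c * z) volume volume := fun _ =>
    (rotation a).measurePreserving
  exact volume_preserving_pi h

theorem integral_comp_unit_smul {c : ℂ} (hc : ‖c‖ = 1) (f : (V → ℂ) → ℂ) :
    ∫ z, f (c • z) = ∫ z, f z := by
  have hc0 : c ≠ 0 := by rintro rfl; simp at hc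
  exact (measurePreserving_unit_smul (V := V) hc).integral_comp
    (Homeomorph.smulOfNeZero c hc0).measurableEmbedding f

/-- The mean value property of entire functions, for the Gaussian weight. -/
theorem integral_mul_gauss {f : (V → ℂ) → ℂ} (hf : Differentiable ℂ f)
    (hi : Integrable (fun z => f z * (Real.exp (-nsq z) : ℂ))) :
    ∫ z, f z * (Real.exp (-nsq z) : ℂ) = f 0 * gaussMass V := by
  set F : (V → ℂ) → ℂ := fun z => f z * (Real.exp (-nsq z) : ℂ) with hF
  have hn : ∀ θ : ℝ, ‖circleMap 0 1 θ‖ = 1 := fun θ => by simp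
  have hFc : Continuous F := by
    have := hf.continuous
    have := continuous_nsq (V := V)
    fun_prop
  have h1 : ∀ θ : ℝ, ∫ z, F (circleMap 0 1 θ • z) = ∫ z, F z := fun θ =>
    integral_comp_unit_smul (hn θ) F
  -- The Gaussian measure is invariant under z ↦ e^{iθ}z, so the integral can be averaged over θ.
  -- After Fubini, the inner average is a one-variable mean value on the complex line through z.
  have h2 : ∫ θ in (0:ℝ)..2 * Real.pi, ∫ z, F (circleMap 0 1 θ • z) =
      (2 * Real.pi) * ∫ z, F z := by
    simp_rw [h1]
    simp
  have hcont : Continuous (fun p : ℝ × (V → ℂ) => F (circleMap 0 1 p.1 • p.2)) := by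
    refine hFc.comp ?_
    have := continuous_circleMap 0 1
    fun_prop
  have hint : Integrable (Function.uncurry fun (θ : ℝ) (z : V → ℂ) => F (circleMap 0 1 θ • z))
      ((volume.restrict (Set.uIoc 0 (2 * Real.pi))).prod volume) := by
    refine (integrable_prod_iff hcont.aestronglyMeasurable).2 ⟨?_, ?_⟩
    · filter_upwards with θ
      exact (measurePreserving_unit_smul (V := V) (hn θ)).integrable_comp_of_integrable hi
    · have : ∀ θ : ℝ, ∫ z, ‖F (circleMap 0 1 θ • z)‖ = ∫ z, ‖F z‖ := fun θ => by
        have hc0 : circleMap 0 1 θ ≠ 0 := by intro h; have := hn θ; simp [h] at this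
        exact (measurePreserving_unit_smul (V := V) (hn θ)).integral_comp
          (Homeomorph.smulOfNeZero _ hc0).measurableEmbedding (fun z => ‖F z‖)
      simp only [this]
      have : IsFiniteMeasure (volume.restrict (Set.uIoc 0 (2 * Real.pi))) :=
        inferInstanceAs (IsFiniteMeasure (volume.restrict (Set.Ioc _ _)))
      exact integrable_const _
  have h3 : ∫ θ in (0:ℝ)..2 * Real.pi, ∫ z, F (circleMap 0 1 θ • z) =
      ∫ z, ∫ θ in (0:ℝ)..2 * Real.pi, F (circleMap 0 1 θ • z) :=
    intervalIntegral_integral_swap hint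
  have h4 : ∀ z : V → ℂ, ∫ θ in (0:ℝ)..2 * Real.pi, F (circleMap 0 1 θ • z) =
      (2 * Real.pi) * f 0 * (Real.exp (-nsq z) : ℂ) := by
    intro z
    have hd : Differentiable ℂ (fun ζ : ℂ => f (ζ • z)) := hf.comp (by fun_prop)
    have := (hd.diffContOnCl (s := Metric.ball 0 |(1:ℝ)|)).circleAverage
    rw [Real.circleAverage_def] at this
    simp only [zero_smul] at this
    have h5 : ∫ θ in (0:ℝ)..2 * Real.pi, f (circleMap 0 1 θ • z) = (2 * Real.pi) * f 0 := by
      rw [← this, Complex.real_smul]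
      push_cast
      field_simp
    have h6 : ∀ θ : ℝ, F (circleMap 0 1 θ • z) =
        f (circleMap 0 1 θ • z) * (Real.exp (-nsq z) : ℂ) := fun θ => by
      simp only [hF, nsq_smul, hn θ]; norm_num
    simp_rw [h6]
    rw [intervalIntegral.integral_mul_const, h5]
  rw [h2] at h3
  simp_rw [h4] at h3
  rw [integral_const_mul, integral_complex_ofReal] at h3
  have hpi : (2 * (Real.pi : ℂ)) ≠ 0 := by
    have := Real.pi_ne_zero; exact_mod_cast mul_ne_zero two_ne_zero this
  refine mul_left_cancel₀ hpi ?_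
  rw [gaussMass]
  linear_combination h3

end

/-! ### The reproducing kernel and derivatives under it -/

noncomputable section

open MeasureTheory Complex ComplexConjugate

variable {V : Type*} [Fintype V]

/-- The Gaussian weight `exp (-|z|²)`. -/
def gw (z : V → ℂ) : ℂ := (Real.exp (-nsq z) : ℂ)

theorem continuous_gw : Continuous (gw : (V → ℂ) → ℂ) := by
  have := continuous_nsq (V := V)
  unfold gw; fun_prop

theorem conj_gw (z : V → ℂ) : conj (gw z) = gw z := conj_ofReal _

theorem gr_gw : Gr (-1) (gw : (V → ℂ) → ℂ) := by
  have := gr_exp (V := V) (-1)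
  have h : (gw : (V → ℂ) → ℂ) = fun z => (Real.exp (-1 * nsq z) : ℂ) :=
    funext fun z => by rw [gw, neg_one_mul]
  rwa [h]

theorem continuous_herm_uncurry :
    Continuous (fun p : (V → ℂ) × (V → ℂ) => herm p.1 p.2) := by
  unfold herm
  have : ∀ i : V, Continuous (fun p : (V → ℂ) × (V → ℂ) => conj (p.1 i)) := fun i =>
    continuous_conj.comp (by fun_prop)
  fun_prop

theorem continuous_herm_left (v : V → ℂ) : Continuous (fun w : V → ℂ => herm w v) :=
  continuous_herm_uncurry.comp (by fun_prop : Continuous fun w : V → ℂ => (w, v))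

theorem norm_herm_le {ε : ℝ} (hε : 0 < ε) (w z : V → ℂ) :
    ‖herm w z‖ ≤ ε * nsq w + nsq z / (4 * ε) := by
  have h1 := norm_herm_sq_le w z
  have hz := nsq_nonneg z
  have hw := nsq_nonneg w
  refine abs_le_of_sq_le_sq' ?_ (by positivity) |>.2
  refine h1.trans ?_
  have h2 : nsq w * nsq z = (ε * nsq w) * (nsq z / (4 * ε)) * 4 := by field_simp
  rw [h2]
  nlinarith [sq_nonneg (ε * nsq w - nsq z / (4 * ε))]

theorem norm_exp_herm_le {ε : ℝ} (hε : 0 < ε) (w z : V → ℂ) :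
    ‖exp (herm w z)‖ ≤ Real.exp (ε * nsq w + nsq z / (4 * ε)) := by
  rw [Complex.norm_exp]
  exact Real.exp_le_exp.2 ((Complex.re_le_norm _).trans (norm_herm_le hε w z))

theorem gr_exp_herm (z : V → ℂ) {ε : ℝ} (hε : 0 < ε) : Gr ε (fun w => exp (herm w z)) := by
  refine ⟨Real.exp (nsq z / (4 * ε)), fun w => (norm_exp_herm_le hε w z).trans (le_of_eq ?_)⟩
  rw [Real.exp_add, mul_comm]

/-- Completing the square: the translated weight differs from the original one by a holomorphic
exponential and an exponential kernel. This turns the mean value property at 0 into a reproducing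
formula at z. -/
theorem gauss_shift (z w : V → ℂ) :
    exp (-herm z w) * gw w = exp (herm (w + z) z) * gw (w + z) := by
  have h : ((nsq (w + z) : ℝ) : ℂ) = nsq w + nsq z + (herm w z + herm z w) := by
    rw [← herm_self, ← herm_self, ← herm_self, herm_add_left, herm_add_right, herm_add_right]
    ring
  simp only [gw, Complex.ofReal_exp, ← Complex.exp_add, Complex.ofReal_neg, h, herm_add_left,
    herm_self]
  congr 1
  ring

/-- The reproducing formula for the Gaussian kernel. -/
theorem reproducing {f : (V → ℂ) → ℂ} (hf : Differentiable ℂ f) (z : V → ℂ)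
    (hi : Integrable (fun w => exp (herm w z) * (f w * gw w))) :
    ∫ w, exp (herm w z) * (f w * gw w) = f z * gaussMass V := by
  have h1 : ∀ w, (f (w + z) * exp (-herm z w)) * (Real.exp (-nsq w) : ℂ) =
      exp (herm (w + z) z) * (f (w + z) * gw (w + z)) := fun w => by
    have := gauss_shift z w
    rw [gw] at this
    rw [mul_assoc, this]; ring
  -- The factor exp(-⟨z,w⟩) is entire in w and equals 1 at w = 0, so the mean value is f z.
  have h2 := integral_mul_gauss (f := fun w => f (w + z) * exp (-herm z w))
    ((hf.comp (by fun_prop : Differentiable ℂ fun w : V → ℂ => w + z)).mul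
      (differentiable_herm z).neg.cexp) (by
        simp_rw [h1]
        exact hi.comp_add_right z)
  simp_rw [h1] at h2
  rw [integral_add_right_eq_self (fun w => exp (herm w z) * (f w * gw w)) z] at h2
  rw [h2]
  simp [herm_zero_right]

/-- The integral transform with kernel `exp ⟨w, z⟩`. -/
def expTransform (h : (V → ℂ) → ℂ) (z : V → ℂ) : ℂ := ∫ w, exp (herm w z) * h w

theorem Gr.integrable_exp_herm {a : ℝ} {f : (V → ℂ) → ℂ} (hf : Gr a f) (ha : a < 1)
    (hm : Continuous f) (z : V → ℂ) : Integrable (fun w => exp (herm w z) * (f w * gw w)) := by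
  have hε : 0 < (1 - a) / 2 := by linarith
  refine Gr.integrable (c := (a - 1) / 2)
    ((gr_exp_herm z hε).mul (hf.mul gr_gw le_rfl) (by linarith)) (by linarith) ?_
  have := continuous_gw (V := V)
  have := continuous_herm_left z
  exact Continuous.aestronglyMeasurable (by fun_prop)

theorem expTransform_eq {a : ℝ} {f : (V → ℂ) → ℂ} (hf : Gr a f) (ha : a < 1)
    (hd : Differentiable ℂ f) (z : V → ℂ) :
    expTransform (fun w => f w * gw w) z = f z * gaussMass V :=
  reproducing hd z (hf.integrable_exp_herm ha hd.continuous z)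

/-- Integrability against all exponentials. -/
def ExpIntegrable (h : (V → ℂ) → ℂ) : Prop :=
  ∀ R : ℝ, Integrable (fun w => (Real.exp (R * ‖w‖) : ℂ) * h w)

theorem sq_norm_le_nsq (w : V → ℂ) : ‖w‖ ^ 2 ≤ nsq w := by
  have h : ‖w‖ ≤ Real.sqrt (nsq w) := by
    refine (pi_norm_le_iff_of_nonneg (Real.sqrt_nonneg _)).2 fun i => Real.le_sqrt_of_sq_le ?_
    exact Finset.single_le_sum (f := fun v => ‖w v‖ ^ 2) (fun _ _ => sq_nonneg _)
      (Finset.mem_univ i)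
  calc ‖w‖ ^ 2 ≤ Real.sqrt (nsq w) ^ 2 := by gcongr
    _ = _ := Real.sq_sqrt (nsq_nonneg w)

theorem gr_exp_norm (R : ℝ) {ε : ℝ} (hε : 0 < ε) :
    Gr ε (fun w : V → ℂ => (Real.exp (R * ‖w‖) : ℂ)) := by
  refine ⟨Real.exp (R ^ 2 / (4 * ε)), fun w => ?_⟩
  rw [Complex.norm_real, Real.norm_eq_abs, abs_of_pos (Real.exp_pos _), ← Real.exp_add]
  refine Real.exp_le_exp.2 ?_
  have h := sq_norm_le_nsq w
  have h2 : R * ‖w‖ ≤ R ^ 2 / (4 * ε) + ε * ‖w‖ ^ 2 := by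
    have : R ^ 2 / (4 * ε) + ε * ‖w‖ ^ 2 - R * ‖w‖ = (R - 2 * ε * ‖w‖) ^ 2 / (4 * ε) := by
      field_simp; ring
    have h3 : 0 ≤ (R - 2 * ε * ‖w‖) ^ 2 / (4 * ε) := by positivity
    linarith
  nlinarith

theorem Gr.expIntegrable {a : ℝ} {f : (V → ℂ) → ℂ} (hf : Gr a f) (ha : a < 1)
    (hm : Continuous f) : ExpIntegrable (fun w => f w * gw w) := by
  intro R
  have hε : 0 < (1 - a) / 2 := by linarith
  refine Gr.integrable (c := (a - 1) / 2)
    ((gr_exp_norm R hε).mul (hf.mul gr_gw le_rfl) (by linarith)) (by linarith) ?_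
  have := continuous_gw (V := V)
  exact Continuous.aestronglyMeasurable (by fun_prop)

theorem norm_herm_le_norm (w z : V → ℂ) : ‖herm w z‖ ≤ Fintype.card V * ‖w‖ * ‖z‖ := by
  refine (norm_sum_le _ _).trans ?_
  calc ∑ i, ‖conj (w i) * z i‖ ≤ ∑ _i : V, ‖w‖ * ‖z‖ := by
        refine Finset.sum_le_sum fun i _ => ?_
        rw [norm_mul, RCLike.norm_conj]
        exact mul_le_mul (norm_le_pi_norm w i) (norm_le_pi_norm z i) (norm_nonneg _)
          (norm_nonneg _)
    _ = _ := by simp [mul_assoc]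

theorem norm_hermL_le (w : V → ℂ) : ‖hermL w‖ ≤ Fintype.card V * ‖w‖ :=
  ContinuousLinearMap.opNorm_le_bound _ (by positivity) fun z => by
    rw [hermL_apply]; exact norm_herm_le_norm w z

theorem continuous_hermL : Continuous (hermL : (V → ℂ) → ((V → ℂ) →L[ℂ] ℂ)) := by
  unfold hermL
  refine continuous_finsetSum _ fun i _ => ?_
  exact (continuous_conj.comp (continuous_apply i)).smul continuous_const

theorem ExpIntegrable.aestronglyMeasurable {h : (V → ℂ) → ℂ} (hh : ExpIntegrable h) :
    AEStronglyMeasurable h volume := by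
  have := (hh 0).aestronglyMeasurable
  simpa using this

theorem norm_exp_herm_le_norm (w z : V → ℂ) {K : ℝ} (hK : ‖z‖ ≤ K) :
    ‖exp (herm w z)‖ ≤ Real.exp (Fintype.card V * K * ‖w‖) := by
  rw [Complex.norm_exp]
  refine Real.exp_le_exp.2 ((Complex.re_le_norm _).trans ((norm_herm_le_norm w z).trans ?_))
  calc (Fintype.card V : ℝ) * ‖w‖ * ‖z‖ ≤ Fintype.card V * ‖w‖ * K := by gcongr
    _ = _ := by ring

theorem hasFDerivAt_expTransform {h : (V → ℂ) → ℂ} (hh : ExpIntegrable h) (z : V → ℂ) :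
    HasFDerivAt (expTransform h) (∫ w, (exp (herm w z) * h w) • hermL w) z := by
  have hm := hh.aestronglyMeasurable
  have hc : ∀ z : V → ℂ, AEStronglyMeasurable (fun w : V → ℂ => exp (herm w z) * h w) volume :=
    fun z => ((continuous_herm_left z).cexp.aestronglyMeasurable).mul hm
  set n : ℝ := (Fintype.card V : ℝ)
  have hn : 0 ≤ n := Nat.cast_nonneg _
  -- K bounds the norm on the unit ball around z. The additional 1 in the exponent of the dominating
  -- function absorbs the factor ‖w‖ that differentiating the kernel produces.
  set K : ℝ := ‖z‖ + 1
  refine hasFDerivAt_integral_of_dominated_of_fderiv_le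
    (F := fun z w => exp (herm w z) * h w) (F' := fun z w => (exp (herm w z) * h w) • hermL w)
    (bound := fun w => n * ‖(Real.exp ((n * K + 1) * ‖w‖) : ℂ) * h w‖)
    (Metric.ball_mem_nhds z one_pos)
    (Filter.Eventually.of_forall fun z => hc z) ?_ ?_ ?_ ?_ ?_
  · refine (hh (n * ‖z‖)).norm.mono' (hc z) (Filter.Eventually.of_forall fun w => ?_)
    rw [norm_mul, norm_mul, Complex.norm_real, Real.norm_eq_abs, abs_of_pos (Real.exp_pos _)]
    gcongr
    exact norm_exp_herm_le_norm w z le_rfl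
  · exact (hc z).smul continuous_hermL.aestronglyMeasurable
  · refine Filter.Eventually.of_forall fun w x hx => ?_
    have hx' : ‖x‖ ≤ K := by
      have h1 : ‖x - z‖ < 1 := by simpa [dist_eq_norm] using hx
      have := norm_add_le (x - z) z
      simp only [sub_add_cancel] at this
      linarith
    rw [norm_smul, norm_mul, norm_mul, Complex.norm_real, Real.norm_eq_abs,
      abs_of_pos (Real.exp_pos _)]
    have h1 := norm_exp_herm_le_norm w x hx'
    have h2 := norm_hermL_le w
    have h3 : ‖w‖ ≤ Real.exp ‖w‖ := le_trans (by linarith) (Real.add_one_le_exp _)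
    calc ‖exp (herm w x)‖ * ‖h w‖ * ‖hermL w‖
        ≤ Real.exp (n * K * ‖w‖) * ‖h w‖ * (n * Real.exp ‖w‖) := by
          gcongr
          exact h2.trans (by gcongr)
      _ = _ := by rw [add_mul, Real.exp_add, one_mul]; ring
  · exact ((hh (n * K + 1)).norm).const_mul n
  · refine Filter.Eventually.of_forall fun w x _ => ?_
    have h1 : HasFDerivAt (fun z => herm w z) (hermL w) x := by
      have : (fun z => herm w z) = hermL w := funext fun z => (hermL_apply w z).symm
      rw [this]; exact (hermL w).hasFDerivAt
    have := (h1.cexp).mul_const (h w)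
    refine this.congr_fderiv ?_
    ext v
    simp only [_root_.smul_apply, smul_eq_mul]
    ring

theorem differentiable_expTransform {h : (V → ℂ) → ℂ} (hh : ExpIntegrable h) :
    Differentiable ℂ (expTransform h) :=
  fun z => (hasFDerivAt_expTransform hh z).differentiableAt

theorem integrable_smul_hermL {h : (V → ℂ) → ℂ} (hh : ExpIntegrable h) (z : V → ℂ) :
    Integrable (fun w => (exp (herm w z) * h w) • hermL w) := by
  have hm := hh.aestronglyMeasurable
  set n : ℝ := (Fintype.card V : ℝ)
  refine (((hh (n * ‖z‖ + 1)).norm).const_mul n).mono'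
    ((((continuous_herm_left z).cexp.aestronglyMeasurable).mul hm).smul
      continuous_hermL.aestronglyMeasurable) (Filter.Eventually.of_forall fun w => ?_)
  rw [norm_smul, norm_mul, norm_mul, Complex.norm_real, Real.norm_eq_abs,
    abs_of_pos (Real.exp_pos _)]
  have h1 := norm_exp_herm_le_norm w z le_rfl
  have h3 : ‖w‖ ≤ Real.exp ‖w‖ := le_trans (by linarith) (Real.add_one_le_exp _)
  calc ‖exp (herm w z)‖ * ‖h w‖ * ‖hermL w‖
      ≤ Real.exp (n * ‖z‖ * ‖w‖) * ‖h w‖ * (n * Real.exp ‖w‖) := by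
        gcongr
        exact (norm_hermL_le w).trans (by gcongr)
    _ = _ := by rw [add_mul, Real.exp_add, one_mul]; ring

theorem fderiv_expTransform {h : (V → ℂ) → ℂ} (hh : ExpIntegrable h) (z v : V → ℂ) :
    fderiv ℂ (expTransform h) z v = expTransform (fun w => herm w v * h w) z := by
  rw [(hasFDerivAt_expTransform hh z).fderiv,
    ContinuousLinearMap.integral_apply (integrable_smul_hermL hh z), expTransform]
  refine integral_congr_ae (Filter.Eventually.of_forall fun w => ?_)
  simp only [_root_.smul_apply, hermL_apply, smul_eq_mul]
  ring

theorem gr_herm_left (v : V → ℂ) {ε : ℝ} (hε : 0 < ε) : Gr ε (fun w => herm w v) :=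
  (gr_herm v hε).of_norm_le fun w => by rw [← conj_herm, RCLike.norm_conj]

/-- Directional derivatives of entire functions through the reproducing kernel. -/
theorem fderiv_eq_expTransform {a : ℝ} {f : (V → ℂ) → ℂ} (hf : Gr a f) (ha : a < 1)
    (hd : Differentiable ℂ f) (z v : V → ℂ) :
    expTransform (fun w => (herm w v * f w) * gw w) z = fderiv ℂ f z v * gaussMass V := by
  have h1 : expTransform (fun w => f w * gw w) = fun z => f z * gaussMass V :=
    funext fun z => expTransform_eq hf ha hd z
  have h2 := fderiv_expTransform (hf.expIntegrable ha hd.continuous) z v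
  rw [h1] at h2
  have h3 : fderiv ℂ (fun z => f z * gaussMass V) z v = fderiv ℂ f z v * gaussMass V := by
    rw [fderiv_mul_const (hd z)]
    simp [mul_comm]
  rw [h3] at h2
  rw [h2]
  simp_rw [mul_assoc]

/-- Splitting |⟨w,z⟩| by the arithmetic-geometric inequality with parameter 1 - a' leaves a
convergent Gaussian of width a' - a in w. The resulting exponent is less than 1/2 exactly when a' <
1/2, which is why derivatives of slowly growing functions remain in the class used below. -/
theorem Gr.expTransform {a : ℝ} {f : (V → ℂ) → ℂ} (hf : Gr a f)
    {a' : ℝ} (haa : a < a') (ha' : a' < 1) :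
    Gr (1 / (4 * (1 - a'))) (expTransform (fun w => f w * gw w)) := by
  obtain ⟨C, hC⟩ := hf.mul gr_gw le_rfl
  have hε : 0 < 1 - a' := by linarith
  have hC0 := Gr.const_nonneg hC
  refine ⟨∫ w : V → ℂ, C * Real.exp (-(a' - a) * nsq w), fun z => ?_⟩
  rw [← integral_mul_const]
  refine norm_integral_le_of_norm_le
    (((integrable_gauss (V := V) (c := a' - a) (by linarith)).const_mul C).mul_const _)
    (Filter.Eventually.of_forall fun w => ?_)
  rw [norm_mul]
  calc ‖exp (herm w z)‖ * ‖f w * gw w‖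
      ≤ Real.exp ((1 - a') * nsq w + nsq z / (4 * (1 - a'))) *
        (C * Real.exp ((a + -1) * nsq w)) :=
        mul_le_mul (norm_exp_herm_le hε w z) (hC w) (norm_nonneg _) (Real.exp_pos _).le
    _ = C * Real.exp (-(a' - a) * nsq w) * Real.exp (1 / (4 * (1 - a')) * nsq z) := by
        rw [mul_assoc C, ← Real.exp_add, mul_left_comm, ← Real.exp_add]
        congr 2
        ring

end

/-! ### Adjoints for the Gaussian scalar product -/

noncomputable section

open MeasureTheory Complex ComplexConjugate

variable {V : Type*} [Fintype V]

/-- The kernel costs r/2 of Gaussian decay in each variable, since |⟨z,w⟩| ≤ (|z|² + |w|²)/2; the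
two strict inequalities say that some decay is left. -/
theorem integrable_exp_kernel {a b r : ℝ} {F G : (V → ℂ) → ℂ} (hG : Gr a G) (hF : Gr b F)
    (hGc : Continuous G) (hFc : Continuous F) (hr : 0 ≤ r) (ha : r / 2 + a < 1)
    (hb : r / 2 + b < 1) :
    Integrable (Function.uncurry fun z w : V → ℂ =>
      exp (r * herm z w) * (conj (G w) * gw w) * (F z * gw z)) (volume.prod volume) := by
  obtain ⟨C, hC⟩ := hG.mul gr_gw le_rfl
  obtain ⟨D, hD⟩ := hF.mul gr_gw le_rfl
  have hC0 := Gr.const_nonneg hC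
  have hD0 := Gr.const_nonneg hD
  have h1 := ((integrable_gauss (V := V) (c := 1 - (r / 2 + b)) (by linarith)).const_mul D).mul_prod
    ((integrable_gauss (V := V) (c := 1 - (r / 2 + a)) (by linarith)).const_mul C)
  refine h1.mono' ?_ (Filter.Eventually.of_forall fun ⟨z, w⟩ => ?_)
  · have := continuous_gw (V := V)
    have h2 := continuous_herm_uncurry (V := V)
    have h3 : Continuous fun p : (V → ℂ) × (V → ℂ) => conj (G p.2) :=
      continuous_conj.comp (hGc.comp continuous_snd)
    refine Continuous.aestronglyMeasurable ?_
    simp only [Function.uncurry_def]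
    fun_prop
  · simp only [Function.uncurry_apply_pair, norm_mul, RCLike.norm_conj]
    have h4 : ‖exp (r * herm z w)‖ ≤ Real.exp (r / 2 * nsq z + r / 2 * nsq w) := by
      rw [Complex.norm_exp]
      refine Real.exp_le_exp.2 ((Complex.re_le_norm _).trans ?_)
      rw [norm_mul, Complex.norm_real, Real.norm_eq_abs, abs_of_nonneg hr]
      have := norm_herm_le (ε := 1 / 2) (by norm_num) z w
      nlinarith
    have h5 := hC w
    have h6 := hD z
    rw [norm_mul] at h5 h6
    calc _ ≤ Real.exp (r / 2 * nsq z + r / 2 * nsq w) * (C * Real.exp ((a + -1) * nsq w)) *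
          (D * Real.exp ((b + -1) * nsq z)) := by gcongr
      _ = D * Real.exp (-(1 - (r / 2 + b)) * nsq z) *
          (C * Real.exp (-(1 - (r / 2 + a)) * nsq w)) := by
        have e1 : -(1 - (r / 2 + b)) * nsq z = r / 2 * nsq z + (b + -1) * nsq z := by ring
        have e2 : -(1 - (r / 2 + a)) * nsq w = r / 2 * nsq w + (a + -1) * nsq w := by ring
        rw [e1, e2, Real.exp_add, Real.exp_add, Real.exp_add]
        ring

theorem conj_exp_herm (r : ℝ) (w z : V → ℂ) :
    conj (exp (herm w (r • z))) = exp (r * herm z w) := by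
  rw [← Complex.exp_conj, conj_herm, herm_real_smul_left]

/-- Fubini for a kernel with Hermitian symmetry. Together with the reproducing formula it yields the
symmetry of dilations (general r) and the adjointness of ∂_v and multiplication by ⟨v,z⟩ (r = 1). -/
theorem exp_transform_symm {a b r : ℝ} {F G : (V → ℂ) → ℂ} (hG : Gr a G) (hF : Gr b F)
    (hGc : Continuous G) (hFc : Continuous F) (hr : 0 ≤ r) (ha : r / 2 + a < 1)
    (hb : r / 2 + b < 1) :
    ∫ z, conj (expTransform (fun w => G w * gw w) (r • z)) * (F z * gw z) =
      ∫ w, conj (G w) * gw w * expTransform (fun z => F z * gw z) (r • w) := by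
  have h := integral_integral_swap (integrable_exp_kernel hG hF hGc hFc hr ha hb)
  have h1 : ∀ z, ∫ w, exp (r * herm z w) * (conj (G w) * gw w) * (F z * gw z) =
      conj (expTransform (fun w => G w * gw w) (r • z)) * (F z * gw z) := fun z => by
    rw [integral_mul_const, expTransform, ← integral_conj]
    congr 2
    ext w
    simp only [map_mul, conj_exp_herm, conj_gw]
  have h2 : ∀ w, ∫ z, exp (r * herm z w) * (conj (G w) * gw w) * (F z * gw z) =
      conj (G w) * gw w * expTransform (fun z => F z * gw z) (r • w) := fun w => by
    rw [expTransform, ← integral_const_mul]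
    congr 1
    ext z
    rw [herm_real_smul_right]
    ring
  simp_rw [h1, h2] at h
  exact h

theorem gaussMass_ne_zero : (gaussMass V : ℂ) ≠ 0 := by
  exact_mod_cast (gaussMass_pos (V := V)).ne'

/-- Dilations are symmetric for the Gaussian scalar product of entire functions. -/
theorem dilation_symm {a b r : ℝ} {F G : (V → ℂ) → ℂ} (hG : Gr a G) (hF : Gr b F)
    (hGd : Differentiable ℂ G) (hFd : Differentiable ℂ F) (hr : 0 ≤ r) (ha : r / 2 + a < 1)
    (hb : r / 2 + b < 1) :
    ∫ z, conj (G (r • z)) * F z * gw z = ∫ w, conj (G w) * F (r • w) * gw w := by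
  have h := exp_transform_symm hG hF hGd.continuous hFd.continuous hr ha hb
  simp_rw [expTransform_eq hG (by linarith) hGd, expTransform_eq hF (by linarith) hFd] at h
  refine mul_left_cancel₀ (gaussMass_ne_zero (V := V)) ?_
  rw [← integral_const_mul, ← integral_const_mul]
  refine (integral_congr_ae (Filter.Eventually.of_forall fun z => ?_)).trans (h.trans
    (integral_congr_ae (Filter.Eventually.of_forall fun z => ?_)))
  · simp only [map_mul, conj_ofReal]; ring
  · ring

theorem gr_fderiv {a a' : ℝ} {f : (V → ℂ) → ℂ} (hf : Gr a f) (haa : a < a') (ha' : a' < 1)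
    (hd : Differentiable ℂ f) (v : V → ℂ) :
    Gr (1 / (4 * (1 - a'))) (fun z => fderiv ℂ f z v) := by
  have hε : 0 < (a' - a) / 2 := by linarith
  have h1 := ((gr_herm_left v hε).mul hf le_rfl).expTransform (a' := a') (by linarith) ha'
  have h2 := h1.const_mul (gaussMass V : ℂ)⁻¹
  refine h2.of_norm_le fun z => ?_
  rw [fderiv_eq_expTransform hf (by linarith) hd, mul_comm (fderiv ℂ f z v),
    inv_mul_cancel_left₀ gaussMass_ne_zero]

/-- The annihilation operator `∂_v` is adjoint to the multiplication by `⟨v, z⟩`. -/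
theorem integral_conj_fderiv_mul {a b : ℝ} {f g : (V → ℂ) → ℂ} (hg : Gr a g) (hf : Gr b f)
    (hgd : Differentiable ℂ g) (hfd : Differentiable ℂ f) (ha : a < 1 / 2) (hb : b < 1 / 2)
    (v : V → ℂ) :
    ∫ z, conj (fderiv ℂ g z v) * f z * gw z = ∫ z, conj (g z) * (herm v z * f z) * gw z := by
  have hε : 0 < (1 / 2 - a) / 2 := by linarith
  have h := exp_transform_symm (r := 1) (a := (1 / 2 + a) / 2) (b := b)
    ((gr_herm_left v hε).mul hg (by linarith)) hf
    ((continuous_herm_left v).mul hgd.continuous) hfd.continuous zero_le_one (by linarith)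
    (by linarith)
  simp_rw [one_smul, fderiv_eq_expTransform hg (by linarith : a < 1) hgd,
    expTransform_eq hf (by linarith : b < 1) hfd] at h
  refine mul_left_cancel₀ (gaussMass_ne_zero (V := V)) ?_
  rw [← integral_const_mul, ← integral_const_mul]
  refine (integral_congr_ae (Filter.Eventually.of_forall fun z => ?_)).trans (h.trans
    (integral_congr_ae (Filter.Eventually.of_forall fun z => ?_)))
  · simp only [map_mul, conj_ofReal]; ring
  · simp only [map_mul, conj_herm]; ring

/-! ### The Bargmann space -/

/-- The function `exp (-|z|²/2) f z` of the Bargmann representation. -/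
def bargmannFun (f : (V → ℂ) → ℂ) (z : V → ℂ) : ℂ := (Real.exp (-(∑ v, ‖z v‖ ^ 2) / 2) : ℂ) * f z

theorem gr_half_gauss : Gr (-(1 / 2)) (fun z : V → ℂ => (Real.exp (-(∑ v, ‖z v‖ ^ 2) / 2) : ℂ)) := by
  refine ⟨1, fun z => ?_⟩
  rw [Complex.norm_real, Real.norm_eq_abs, abs_of_pos (Real.exp_pos _), one_mul]
  refine Real.exp_le_exp.2 (le_of_eq ?_)
  rw [nsq]; ring

theorem half_gauss_mul_self (z : V → ℂ) :
    (Real.exp (-(∑ v, ‖z v‖ ^ 2) / 2) : ℂ) * (Real.exp (-(∑ v, ‖z v‖ ^ 2) / 2) : ℂ) = gw z := by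
  rw [← Complex.ofReal_mul, ← Real.exp_add, gw, nsq]
  congr 2
  ring

theorem continuous_half_gauss :
    Continuous (fun z : V → ℂ => (Real.exp (-(∑ v, ‖z v‖ ^ 2) / 2) : ℂ)) := by
  fun_prop

theorem Gr.memLp {c : ℝ} {f : (V → ℂ) → ℂ} (h : Gr c f) (hc : c < 0)
    (hf : AEStronglyMeasurable f volume) : MemLp f 2 := by
  refine (memLp_two_iff_integrable_sq_norm hf).2 ?_
  have := ((h.mul h le_rfl).integrable (by linarith) (hf.mul hf)).norm
  simpa [← sq] using this

theorem Gr.bargmannFun {a : ℝ} {f : (V → ℂ) → ℂ} (h : Gr a f) : Gr (a - 1 / 2) (bargmannFun f) :=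
  gr_half_gauss.mul h (by linarith)

theorem Gr.memLp_bargmannFun {a : ℝ} {f : (V → ℂ) → ℂ} (h : Gr a f) (ha : a < 1 / 2)
    (hf : Continuous f) : MemLp (_root_.bargmannFun f) 2 (volume : Measure (V → ℂ)) :=
  h.bargmannFun.memLp (by linarith) (continuous_half_gauss.mul hf).aestronglyMeasurable

theorem conj_bargmannFun_mul (f g : (V → ℂ) → ℂ) (z : V → ℂ) :
    conj (bargmannFun g z) * bargmannFun f z = conj (g z) * f z * gw z := by
  rw [← half_gauss_mul_self, bargmannFun, bargmannFun, map_mul, conj_ofReal]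
  ring

/-- For `f` in the Bargmann space, the reproducing formula in `L²`. -/
theorem memLp_half_gauss_exp_herm (z : V → ℂ) :
    MemLp (fun w : V → ℂ => (Real.exp (-(∑ v, ‖w v‖ ^ 2) / 2) : ℂ) * exp (herm w z)) 2 := by
  refine Gr.memLp (c := -(1 / 4))
    (gr_half_gauss.mul (gr_exp_herm z (ε := 1 / 4) (by norm_num)) (by norm_num)) (by norm_num) ?_
  exact (continuous_half_gauss.mul (continuous_herm_left z).cexp).aestronglyMeasurable

/-- The value at `z` of the projection of an `L²` function to the Bargmann space, without the
weight. -/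
def bargmannEval (u : L2C V) (z : V → ℂ) : ℂ :=
  (gaussMass V : ℂ)⁻¹ * expTransform (fun w => (Real.exp (-(∑ v, ‖w v‖ ^ 2) / 2) : ℂ) * u w) z

theorem expIntegrable_half_gauss_mul (u : L2C V) :
    ExpIntegrable (fun w => (Real.exp (-(∑ v, ‖w v‖ ^ 2) / 2) : ℂ) * u w) := by
  intro R
  have h1 : MemLp (fun w : V → ℂ =>
      (Real.exp (R * ‖w‖) : ℂ) * (Real.exp (-(∑ v, ‖w v‖ ^ 2) / 2) : ℂ)) 2 := by
    refine Gr.memLp (c := -(1 / 4))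
      ((gr_exp_norm R (ε := 1 / 4) (by norm_num)).mul gr_half_gauss (by norm_num)) (by norm_num) ?_
    exact Continuous.aestronglyMeasurable (by fun_prop)
  have := h1.integrable_mul (Lp.memLp u)
  refine this.congr (Filter.Eventually.of_forall fun w => ?_)
  simp [mul_assoc]

theorem differentiable_bargmannEval (u : L2C V) : Differentiable ℂ (bargmannEval u) :=
  (differentiable_expTransform (expIntegrable_half_gauss_mul u)).const_mul _

/-- Point evaluation is a scalar product with a fixed L² function, hence continuous for the L² norm.
-/
theorem bargmannEval_eq_inner (u : L2C V) (z : V → ℂ) :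
    bargmannEval u z = (gaussMass V : ℂ)⁻¹ * inner ℂ ((Gr.memLp (c := -(1 / 4))
      (gr_half_gauss.mul ((gr_exp_herm z (ε := 1 / 4) (by norm_num)).conj) (by norm_num))
      (by norm_num) (continuous_half_gauss.mul
        (continuous_conj.comp (continuous_herm_left z).cexp)).aestronglyMeasurable).toLp _) u := by
  rw [bargmannEval, L2.inner_def, expTransform]
  congr 1
  refine integral_congr_ae ?_
  filter_upwards [MemLp.coeFn_toLp (Gr.memLp (c := -(1 / 4))
      (gr_half_gauss.mul ((gr_exp_herm z (ε := 1 / 4) (by norm_num)).conj) (by norm_num))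
      (by norm_num) (continuous_half_gauss.mul
        (continuous_conj.comp (continuous_herm_left z).cexp)).aestronglyMeasurable)] with w hw
  rw [RCLike.inner_apply, hw]
  simp only [map_mul, conj_ofReal, conj_conj]
  ring

theorem tendsto_bargmannEval {u : ℕ → L2C V} {u₀ : L2C V}
    (h : Filter.Tendsto u Filter.atTop (nhds u₀)) (z : V → ℂ) :
    Filter.Tendsto (fun n => bargmannEval (u n) z) Filter.atTop (nhds (bargmannEval u₀ z)) := by
  simp_rw [bargmannEval_eq_inner]
  exact (Filter.Tendsto.inner tendsto_const_nhds h).const_mul _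

theorem bargmannEval_eq {u : L2C V} {f : (V → ℂ) → ℂ} (hf : Differentiable ℂ f)
    (hu : u =ᵐ[volume] bargmannFun f) (z : V → ℂ) : bargmannEval u z = f z := by
  have h1 : (fun w => exp (herm w z) * ((Real.exp (-(∑ v, ‖w v‖ ^ 2) / 2) : ℂ) * u w)) =ᵐ[volume]
      fun w => exp (herm w z) * (f w * gw w) := by
    filter_upwards [hu] with w hw
    rw [hw, bargmannFun, ← half_gauss_mul_self]
    ring
  have h2 : Integrable (fun w => exp (herm w z) * (f w * gw w)) := by
    have := (memLp_half_gauss_exp_herm z).integrable_mul (Lp.memLp u)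
    refine (this.congr ?_)
    filter_upwards [h1] with w hw
    rw [← hw]
    simp only [Pi.mul_apply]
    ring
  rw [bargmannEval, expTransform, integral_congr_ae h1, reproducing hf z h2, mul_comm (f z),
    inv_mul_cancel_left₀ gaussMass_ne_zero]

theorem mem_bargmann_iff {u : L2C V} :
    u ∈ bargmann V ↔ u =ᵐ[volume] bargmannFun (bargmannEval u) := by
  constructor
  · rintro ⟨f, hf, hu⟩
    have : bargmannEval u = f := funext fun z => bargmannEval_eq hf hu z
    rw [this]; exact hu
  · intro h
    exact ⟨bargmannEval u, differentiable_bargmannEval u, h⟩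

/-- An L² limit is an almost everywhere limit along a subsequence, while the values of the entire
representatives converge everywhere by continuity of point evaluation; the two limits must agree. -/
theorem isClosed_bargmann : IsClosed (bargmann V : Set (L2C V)) := by
  refine IsSeqClosed.isClosed fun u u₀ hu h => ?_
  refine mem_bargmann_iff.2 ?_
  have h1 := tendstoInMeasure_of_tendsto_Lp h
  obtain ⟨ns, hns, h2⟩ := h1.exists_seq_tendsto_ae
  have h3 : ∀ᵐ z : V → ℂ, ∀ n, u n z = bargmannFun (bargmannEval (u n)) z :=
    ae_all_iff.2 fun n => mem_bargmann_iff.1 (hu n)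
  filter_upwards [h2, h3] with z hz hz3
  refine tendsto_nhds_unique hz ?_
  simp_rw [hz3, bargmannFun]
  exact ((tendsto_bargmannEval h z).comp hns.tendsto_atTop).const_mul _

instance : CompleteSpace (bargmann V) := isClosed_bargmann.completeSpace_coe

/-- Cauchy–Schwarz after giving the part 1/(4a) < 1/2 of the quadratic exponent to the integration
variable. The exponent 1/2 itself is not reached, so an element of the Bargmann space need not be
`Nice`, but all its dilations by r < 1 are. -/
theorem gr_bargmannEval (u : L2C V) {a : ℝ} (ha : 1 / 2 < a) : Gr a (bargmannEval u) := by
  have ha0 : 0 < a := by linarith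
  have hε : 0 < 1 / (4 * a) := by positivity
  have hε2 : 1 / (4 * a) < 1 / 2 := by
    rw [div_lt_div_iff₀ (by positivity) (by norm_num)]; linarith
  have h1 : MemLp (fun w : V → ℂ => (Real.exp ((1 / (4 * a) - 1 / 2) * nsq w) : ℂ)) 2 :=
    (gr_exp _).memLp (by linarith) (by
      have := continuous_nsq (V := V)
      exact Continuous.aestronglyMeasurable (by fun_prop))
  have h2 := (h1.integrable_mul (Lp.memLp u)).norm
  have h3 : Gr a (expTransform (fun w => (Real.exp (-(∑ v, ‖w v‖ ^ 2) / 2) : ℂ) * u w)) := by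
    refine ⟨∫ w, ‖((fun w : V → ℂ =>
      (Real.exp ((1 / (4 * a) - 1 / 2) * nsq w) : ℂ)) * (u : (V → ℂ) → ℂ)) w‖, fun z => ?_⟩
    rw [← integral_mul_const]
    refine norm_integral_le_of_norm_le (h2.mul_const _) (Filter.Eventually.of_forall fun w => ?_)
    simp only [Pi.mul_apply, norm_mul, Complex.norm_real, Real.norm_eq_abs,
      abs_of_pos (Real.exp_pos _)]
    have h4 := norm_exp_herm_le hε w z
    have e : nsq z / (4 * (1 / (4 * a))) = a * nsq z := by field_simp
    rw [e] at h4
    calc _ ≤ Real.exp (1 / (4 * a) * nsq w + a * nsq z) *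
          (Real.exp (-(∑ v, ‖w v‖ ^ 2) / 2) * ‖u w‖) := by gcongr
      _ = _ := by
        have e2 : (1 / (4 * a) - 1 / 2) * nsq w = 1 / (4 * a) * nsq w + -(∑ v, ‖w v‖ ^ 2) / 2 := by
          rw [nsq]; ring
        rw [e2, Real.exp_add, Real.exp_add]
        ring
  exact h3.const_mul _

end

noncomputable section

/-! ### Spectra of semibounded symmetric operators given by their graphs -/

section SymmetricGraph

variable {H : Type*} [NormedAddCommGroup H] [InnerProductSpace ℂ H]
  {Γ Γ₀ : Submodule ℂ (H × H)}

theorem symmetric_topologicalClosure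
    (hsym : ∀ p ∈ Γ, ∀ q ∈ Γ, inner ℂ p.1 q.2 = inner ℂ p.2 q.1) :
    ∀ p ∈ Γ.topologicalClosure, ∀ q ∈ Γ.topologicalClosure,
      inner ℂ p.1 q.2 = inner ℂ p.2 q.1 := by
  have h1 : ∀ p ∈ Γ, ∀ q ∈ Γ.topologicalClosure, inner ℂ p.1 q.2 = inner ℂ p.2 q.1 := by
    intro p hp q hq
    have hc : IsClosed {q : H × H | inner ℂ p.1 q.2 = inner ℂ p.2 q.1} :=
      isClosed_eq (by fun_prop) (by fun_prop)
    exact closure_minimal (fun q hq => hsym p hp q hq) hc hq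
  intro p hp q hq
  have hc : IsClosed {p : H × H | inner ℂ p.1 q.2 = inner ℂ p.2 q.1} :=
    isClosed_eq (by fun_prop) (by fun_prop)
  exact closure_minimal (fun p hp => h1 p hp q hq) hc hp

theorem lower_bound_topologicalClosure {m : ℝ}
    (hlow : ∀ p ∈ Γ₀, m * ‖p.1‖ ^ 2 ≤ (inner ℂ p.1 p.2 : ℂ).re) :
    ∀ p ∈ Γ₀.topologicalClosure, m * ‖p.1‖ ^ 2 ≤ (inner ℂ p.1 p.2 : ℂ).re := by
  intro p hp
  have hc : IsClosed {p : H × H | m * ‖p.1‖ ^ 2 ≤ (inner ℂ p.1 p.2 : ℂ).re} :=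
    isClosed_le (by fun_prop) (Complex.continuous_re.comp (by fun_prop))
  exact closure_minimal hlow hc hp

/-- Cauchy–Schwarz applied to ⟨u, (T - l)u⟩ ≥ (m - l)‖u‖²: below the lower bound, T - l is injective
with a quantitative estimate. -/
theorem mul_norm_le_of_lower_bound {m l : ℝ} {p : H × H}
    (h : m * ‖p.1‖ ^ 2 ≤ (inner ℂ p.1 p.2 : ℂ).re) :
    (m - l) * ‖p.1‖ ≤ ‖p.2 - (l : ℂ) • p.1‖ := by
  have h1 : (inner ℂ p.1 (p.2 - (l : ℂ) • p.1) : ℂ).re =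
      (inner ℂ p.1 p.2 : ℂ).re - l * ‖p.1‖ ^ 2 := by
    rw [inner_sub_right, inner_smul_right, inner_self_eq_norm_sq_to_K, Complex.sub_re]
    congr 1
    rw [Complex.re_ofReal_mul]
    congr 1
    exact_mod_cast Complex.ofReal_re _
  have h2 : (inner ℂ p.1 (p.2 - (l : ℂ) • p.1) : ℂ).re ≤ ‖p.1‖ * ‖p.2 - (l : ℂ) • p.1‖ :=
    (Complex.re_le_norm _).trans (norm_inner_le_norm _ _)
  rcases (norm_nonneg p.1).eq_or_lt with h0 | h0
  · rw [← h0, mul_zero]; exact norm_nonneg _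
  · refine le_of_mul_le_mul_left ?_ h0
    nlinarith

variable [CompleteSpace H]

/-- The estimate from below makes the range of the closure of T - l closed, and by hypothesis
nothing is orthogonal to it, so it is everything. -/
theorem exists_mem_topologicalClosure_sub_eq {m l : ℝ} (hl : l < m)
    (hlow : ∀ p ∈ Γ₀, m * ‖p.1‖ ^ 2 ≤ (inner ℂ p.1 p.2 : ℂ).re)
    (hdense : ∀ w : H, (∀ p ∈ Γ₀, inner ℂ w (p.2 - (l : ℂ) • p.1) = 0) → w = 0) (g : H) :
    ∃ p ∈ Γ₀.topologicalClosure, p.2 - (l : ℂ) • p.1 = g := by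
  let D : H × H →L[ℂ] H := ContinuousLinearMap.snd ℂ H H - (l : ℂ) • ContinuousLinearMap.fst ℂ H H
  have hD : ∀ p, D p = p.2 - (l : ℂ) • p.1 := fun p => rfl
  let D' : Γ₀.topologicalClosure →L[ℂ] H := D.comp Γ₀.topologicalClosure.subtypeL
  have hml : 0 < m - l := by linarith
  have hlow' := lower_bound_topologicalClosure hlow
  have hb : ∀ p : Γ₀.topologicalClosure,
      ‖p‖ ≤ (Real.toNNReal (1 + (1 + |l|) / (m - l)) : ℝ) * ‖D' p‖ := by
    intro p
    have h1 := mul_norm_le_of_lower_bound (l := l) (hlow' p p.2)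
    rw [← hD] at h1
    change (m - l) * ‖(p : H × H).1‖ ≤ ‖D' p‖ at h1
    have h2 : ‖(p : H × H).1‖ ≤ ‖D' p‖ / (m - l) := by
      rw [le_div_iff₀ hml]; linarith
    have h3 : (p : H × H).2 = D' p + (l : ℂ) • (p : H × H).1 := by
      change _ = (p : H × H).2 - (l : ℂ) • (p : H × H).1 + _
      simp
    have h4 : ‖(p : H × H).2‖ ≤ ‖D' p‖ + |l| * ‖(p : H × H).1‖ := by
      rw [h3]
      refine (norm_add_le _ _).trans ?_
      rw [norm_smul, Complex.norm_real, Real.norm_eq_abs]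
    have h5 : 0 ≤ ‖D' p‖ / (m - l) := by positivity
    rw [Real.coe_toNNReal _ (by positivity)]
    have e : (1 + (1 + |l|) / (m - l)) * ‖D' p‖ =
      ‖D' p‖ + ‖D' p‖ / (m - l) + |l| * (‖D' p‖ / (m - l)) := by ring
    rw [e]
    have h6 := mul_le_mul_of_nonneg_left h2 (abs_nonneg l)
    have h7 := mul_nonneg (abs_nonneg l) h5
    change max ‖(p : H × H).1‖ ‖(p : H × H).2‖ ≤ _
    refine max_le ?_ ?_
    · linarith [norm_nonneg (D' p)]
    · linarith
  have hclosed : IsClosed (Set.range D') :=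
    (AddMonoidHomClass.antilipschitz_of_bound D' hb).isClosed_range D'.uniformContinuous
  have hcompl : (LinearMap.range D'.toLinearMap)ᗮ = ⊥ := by
    refine (Submodule.eq_bot_iff _).2 fun w hw => hdense w fun p hp => ?_
    have := (Submodule.mem_orthogonal' _ _).1 hw (D' ⟨p, Γ₀.le_topologicalClosure hp⟩)
      ⟨_, rfl⟩
    exact this
  have htop := (Submodule.topologicalClosure_eq_top_iff).2 hcompl
  have hcl : (LinearMap.range D'.toLinearMap).topologicalClosure = LinearMap.range D'.toLinearMap := by
    refine IsClosed.submodule_topologicalClosure_eq ?_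
    exact hclosed
  have hg : g ∈ LinearMap.range D'.toLinearMap := by rw [← hcl, htop]; trivial
  obtain ⟨p, hp⟩ := hg
  exact ⟨p, p.2, hp⟩

/-- The core determines the closure. For p in the larger closure, surjectivity gives q in the
smaller one with the same image under T - l; by symmetry p.1 - q.1 is orthogonal to the range of T -
l on the core, hence zero. -/
theorem topologicalClosure_le_of_dense (hle : Γ₀ ≤ Γ)
    (hsym : ∀ p ∈ Γ, ∀ q ∈ Γ, inner ℂ p.1 q.2 = inner ℂ p.2 q.1) {m l : ℝ} (hl : l < m)
    (hlow : ∀ p ∈ Γ₀, m * ‖p.1‖ ^ 2 ≤ (inner ℂ p.1 p.2 : ℂ).re)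
    (hdense : ∀ w : H, (∀ p ∈ Γ₀, inner ℂ w (p.2 - (l : ℂ) • p.1) = 0) → w = 0) :
    Γ.topologicalClosure ≤ Γ₀.topologicalClosure := by
  intro p hp
  obtain ⟨q, hq, hqp⟩ := exists_mem_topologicalClosure_sub_eq hl hlow hdense (p.2 - (l : ℂ) • p.1)
  have hle' : Γ₀.topologicalClosure ≤ Γ.topologicalClosure := Submodule.topologicalClosure_mono hle
  have hs := symmetric_topologicalClosure hsym
  have h0 : p.1 - q.1 = 0 := by
    refine hdense _ fun r hr => ?_
    have h1 := hs (p - q) (sub_mem hp (hle' hq)) r (Γ.le_topologicalClosure (hle hr))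
    simp only [Prod.fst_sub, Prod.snd_sub] at h1
    rw [inner_sub_right, h1, inner_smul_right]
    have h2 : p.2 - q.2 = (l : ℂ) • (p.1 - q.1) := by
      have h3 : p.2 = q.2 - (l : ℂ) • q.1 + (l : ℂ) • p.1 := by rw [hqp, sub_add_cancel]
      rw [h3]
      module
    rw [h2, inner_smul_left, Complex.conj_ofReal, sub_self]
  have h1 : p.1 = q.1 := sub_eq_zero.1 h0
  have h2 : p = q := by
    refine Prod.ext h1 ?_
    rw [h1] at hqp
    exact (sub_left_inj.1 hqp).symm
  rw [h2]; exact hq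

/-- On the closed graph T - l is bijective, and its inverse is bounded by 1/(m - l). -/
theorem notMem_graphSpectrum_of_lower_bound (hle : Γ₀ ≤ Γ)
    (hsym : ∀ p ∈ Γ, ∀ q ∈ Γ, inner ℂ p.1 q.2 = inner ℂ p.2 q.1) {m l : ℝ} (hl : l < m)
    (hlow : ∀ p ∈ Γ₀, m * ‖p.1‖ ^ 2 ≤ (inner ℂ p.1 p.2 : ℂ).re)
    (hdense : ∀ w : H, (∀ p ∈ Γ₀, inner ℂ w (p.2 - (l : ℂ) • p.1) = 0) → w = 0) :
    (l : ℂ) ∉ graphSpectrum (closure (Γ : Set (H × H))) := by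
  have hcl := topologicalClosure_le_of_dense hle hsym hl hlow hdense
  have hlow' : ∀ p ∈ Γ.topologicalClosure, m * ‖p.1‖ ^ 2 ≤ (inner ℂ p.1 p.2 : ℂ).re :=
    fun p hp => lower_bound_topologicalClosure hlow p (hcl hp)
  have hml : 0 < m - l := by linarith
  let D : Γ.topologicalClosure →ₗ[ℂ] H :=
    (LinearMap.snd ℂ H H - (l : ℂ) • LinearMap.fst ℂ H H).comp Γ.topologicalClosure.subtype
  have hD : ∀ p, D p = (p : H × H).2 - (l : ℂ) • (p : H × H).1 := fun p => rfl
  have hb : ∀ p : Γ.topologicalClosure, (m - l) * ‖(p : H × H).1‖ ≤ ‖D p‖ := fun p =>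
    mul_norm_le_of_lower_bound (hlow' p p.2)
  have hinj : Function.Injective D := by
    refine (injective_iff_map_eq_zero D).2 fun p hp => ?_
    have h1 := hb p
    rw [hp, norm_zero] at h1
    have h2 : (p : H × H).1 = 0 := by
      refine norm_eq_zero.1 (le_antisymm ?_ (norm_nonneg _))
      by_contra h
      push Not at h
      have := mul_pos hml h
      linarith
    rw [hD, h2, smul_zero, sub_zero] at hp
    exact Subtype.ext (Prod.ext h2 hp)
  have hsurj : Function.Surjective D := fun g => by
    obtain ⟨p, hp, hpg⟩ := exists_mem_topologicalClosure_sub_eq hl hlow hdense g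
    exact ⟨⟨p, Submodule.topologicalClosure_mono hle hp⟩, hpg⟩
  let e := LinearEquiv.ofBijective D ⟨hinj, hsurj⟩
  let R : H →L[ℂ] H := LinearMap.mkContinuous
    ((LinearMap.fst ℂ H H).comp (Γ.topologicalClosure.subtype.comp e.symm.toLinearMap))
    (1 / (m - l)) fun g => by
      have h1 := hb (e.symm g)
      have h2 : D (e.symm g) = g := e.apply_symm_apply g
      rw [h2] at h1
      change ‖((e.symm g : Γ.topologicalClosure) : H × H).1‖ ≤ _
      rw [one_div, inv_mul_eq_div, le_div_iff₀ hml]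
      linarith
  have hR : ∀ g, R g = ((e.symm g : Γ.topologicalClosure) : H × H).1 := fun g => rfl
  intro hspec
  refine hspec ⟨R, fun u w => ⟨fun h => ?_, fun h => ?_⟩⟩
  · have hmem : (u, w) ∈ Γ.topologicalClosure := h
    have : e ⟨(u, w), hmem⟩ = w - (l : ℂ) • u := rfl
    rw [hR, ← this, e.symm_apply_apply]
  · rw [hR] at h
    set p := e.symm (w - (l : ℂ) • u)
    have h1 : D p = w - (l : ℂ) • u := e.apply_symm_apply _
    rw [hD, h] at h1
    have h2 : (p : H × H).2 = w := sub_left_inj.1 h1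
    have h3 : (p : H × H) = (u, w) := Prod.ext h h2
    have := p.2
    rw [h3] at this
    exact this

/-- If T - m had a bounded inverse R, subtracting a small multiple of Ru from a nearly optimal u
would push the form below its lower bound m. -/
theorem infimum_mem_graphSpectrum (hle : Γ₀ ≤ Γ)
    (hsym : ∀ p ∈ Γ, ∀ q ∈ Γ, inner ℂ p.1 q.2 = inner ℂ p.2 q.1) {m l : ℝ} (hl : l < m)
    (hlow : ∀ p ∈ Γ₀, m * ‖p.1‖ ^ 2 ≤ (inner ℂ p.1 p.2 : ℂ).re)
    (hopt : ∀ m' > m, ∃ p ∈ Γ₀, (inner ℂ p.1 p.2 : ℂ).re < m' * ‖p.1‖ ^ 2)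
    (hdense : ∀ w : H, (∀ p ∈ Γ₀, inner ℂ w (p.2 - (l : ℂ) • p.1) = 0) → w = 0) :
    (m : ℂ) ∈ graphSpectrum (closure (Γ : Set (H × H))) := by
  have hcl := topologicalClosure_le_of_dense hle hsym hl hlow hdense
  have hlow' : ∀ p ∈ Γ.topologicalClosure, m * ‖p.1‖ ^ 2 ≤ (inner ℂ p.1 p.2 : ℂ).re :=
    fun p hp => lower_bound_topologicalClosure hlow p (hcl hp)
  have hs := symmetric_topologicalClosure hsym
  rintro ⟨R, hR⟩
  have hmem : ∀ g, (R g, g + (m : ℂ) • R g) ∈ Γ.topologicalClosure := fun g => by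
    have := (hR (R g) (g + (m : ℂ) • R g)).2 (by rw [add_sub_cancel_right])
    exact this
  set N : ℝ := ‖R‖ + 1
  have hN : 0 < N := by positivity
  obtain ⟨p, hp, hpm⟩ := hopt (m + 1 / N) (by have : 0 < 1 / N := by positivity
                                              linarith)
  have hpΓ : p ∈ Γ.topologicalClosure := Γ.le_topologicalClosure (hle hp)
  -- With 1/N as coefficient, ⟨q,(T - m)q⟩ = ⟨p,(T - m)p⟩ - (2/N)‖p‖² + N⁻²⟨Rp,p⟩. The first term is
  -- less than ‖p‖²/N by the choice of p and the last is at most ‖p‖²/N since ‖R‖ ≤ N, so the whole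
  -- is negative.
  set q : H × H := p - ((1 / N : ℝ) : ℂ) • (R p.1, p.1 + (m : ℂ) • R p.1) with hq
  have hqm : q ∈ Γ.topologicalClosure := sub_mem hpΓ (Submodule.smul_mem _ _ (hmem p.1))
  have h1 := hlow' q hqm
  have hshift : ∀ r : H × H, (inner ℂ r.1 (r.2 - (m : ℂ) • r.1) : ℂ).re =
      (inner ℂ r.1 r.2 : ℂ).re - m * ‖r.1‖ ^ 2 := fun r => by
    rw [inner_sub_right, inner_smul_right, inner_self_eq_norm_sq_to_K, Complex.sub_re]
    congr 1
    rw [Complex.re_ofReal_mul]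
    congr 1
    exact_mod_cast Complex.ofReal_re _
  have h2 := hshift q
  have h3 := hshift p
  set g := p.2 - (m : ℂ) • p.1 with hg
  have e1 : q.2 - (m : ℂ) • q.1 = g - ((1 / N : ℝ) : ℂ) • p.1 := by
    simp only [hq, hg, Prod.snd_sub, Prod.fst_sub, Prod.smul_fst, Prod.smul_snd]
    module
  have e2 : q.1 = p.1 - ((1 / N : ℝ) : ℂ) • R p.1 := rfl
  have h4 : inner ℂ (R p.1) g = inner ℂ p.1 p.1 := by
    have h5 := hs _ (hmem p.1) p hpΓ
    simp only [inner_add_left, inner_smul_left, Complex.conj_ofReal] at h5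
    rw [hg, inner_sub_right, h5, inner_smul_right]
    ring
  have h5 : (inner ℂ q.1 (q.2 - (m : ℂ) • q.1) : ℂ) = inner ℂ p.1 g -
      ((1 / N : ℝ) : ℂ) * (‖p.1‖ ^ 2 : ℝ) - ((1 / N : ℝ) : ℂ) * ((‖p.1‖ ^ 2 : ℝ) -
        ((1 / N : ℝ) : ℂ) * inner ℂ (R p.1) p.1) := by
    rw [e1, e2]
    simp only [inner_sub_left, inner_sub_right, inner_smul_left, inner_smul_right,
      Complex.conj_ofReal, h4, inner_self_eq_norm_sq_to_K]
    push_cast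
    rfl
  have h6 : (inner ℂ (R p.1) p.1 : ℂ).re ≤ ‖R‖ * ‖p.1‖ ^ 2 := by
    refine (Complex.re_le_norm _).trans ((norm_inner_le_norm _ _).trans ?_)
    calc ‖R p.1‖ * ‖p.1‖ ≤ (‖R‖ * ‖p.1‖) * ‖p.1‖ := by gcongr; exact R.le_opNorm _
      _ = _ := by ring
  have h7 : ((inner ℂ p.1 g : ℂ).re - (1 / N) * ‖p.1‖ ^ 2 - ((1 / N) * ‖p.1‖ ^ 2 -
      (1 / N) * ((1 / N) * (inner ℂ (R p.1) p.1 : ℂ).re))) =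
      (inner ℂ q.1 q.2 : ℂ).re - m * ‖q.1‖ ^ 2 := by
    rw [← h2, h5]
    simp only [Complex.sub_re, Complex.re_ofReal_mul, Complex.ofReal_re]
    ring
  have h8 : (1 / N) * ((1 / N) * (inner ℂ (R p.1) p.1 : ℂ).re) ≤ (1 / N) * ‖p.1‖ ^ 2 := by
    refine mul_le_mul_of_nonneg_left ?_ (by positivity)
    rw [one_div, inv_mul_eq_div, div_le_iff₀ hN]
    refine h6.trans ?_
    have : 0 ≤ ‖p.1‖ ^ 2 := by positivity
    have hN' : ‖R‖ ≤ N := by simp [N]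
    nlinarith
  rw [add_mul] at hpm
  linarith

end SymmetricGraph

end

/-! ### Slowly growing entire functions as a core of the Toeplitz operator -/

noncomputable section

open MeasureTheory Complex ComplexConjugate

variable {V : Type*} [Fintype V]

/-- Entire functions which grow slower than the Gaussian weight decays. -/
def Nice (f : (V → ℂ) → ℂ) : Prop := Differentiable ℂ f ∧ ∃ a < 1 / 2, Gr a f

theorem Nice.add {f g : (V → ℂ) → ℂ} (hf : Nice f) (hg : Nice g) : Nice (f + g) := by
  obtain ⟨hf, a, ha, hfa⟩ := hf
  obtain ⟨hg, b, hb, hgb⟩ := hg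
  exact ⟨hf.add hg, max a b, max_lt ha hb, (hfa.mono (le_max_left _ _)).add
    (hgb.mono (le_max_right _ _))⟩

theorem Nice.const_smul {f : (V → ℂ) → ℂ} (hf : Nice f) (c : ℂ) : Nice (c • f) := by
  obtain ⟨hf, a, ha, hfa⟩ := hf
  exact ⟨hf.const_smul c, a, ha, hfa.const_mul c⟩

theorem Nice.herm_mul {f : (V → ℂ) → ℂ} (hf : Nice f) (v : V → ℂ) :
    Nice (fun z => herm v z * f z) := by
  obtain ⟨hf, a, ha, hfa⟩ := hf
  have hε : 0 < (1 / 2 - a) / 2 := by linarith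
  exact ⟨(differentiable_herm v).mul hf, (1 / 2 + a) / 2, by linarith,
    (gr_herm v hε).mul hfa (by linarith)⟩

theorem Nice.memLp {f : (V → ℂ) → ℂ} (hf : Nice f) :
    MemLp (bargmannFun f) 2 (volume : Measure (V → ℂ)) := by
  obtain ⟨hf, a, ha, hfa⟩ := hf
  exact hfa.memLp_bargmannFun ha hf.continuous

theorem Nice.integrable_conj_mul {f g : (V → ℂ) → ℂ} (hg : Nice g) (hf : Nice f) :
    Integrable (fun z => conj (g z) * f z * gw z) := by
  obtain ⟨hf, a, ha, hfa⟩ := hf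
  obtain ⟨hg, b, hb, hgb⟩ := hg
  refine Gr.integrable (c := b + a - 1) ((hgb.conj.mul hfa le_rfl).mul gr_gw (by linarith))
    (by linarith) ?_
  have := hf.continuous
  have := continuous_conj.comp hg.continuous
  have := continuous_gw (V := V)
  exact Continuous.aestronglyMeasurable (by fun_prop)

/-- The element of the Bargmann space given by a nice function. -/
def Nice.toBargmann {f : (V → ℂ) → ℂ} (hf : Nice f) : bargmann V :=
  ⟨hf.memLp.toLp _, f, hf.1, hf.memLp.coeFn_toLp⟩

theorem Nice.coeFn_toBargmann {f : (V → ℂ) → ℂ} (hf : Nice f) :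
    (hf.toBargmann : L2C V) =ᵐ[volume] bargmannFun f := hf.memLp.coeFn_toLp

theorem inner_bargmann_eq {u w : bargmann V} {f g : (V → ℂ) → ℂ}
    (hu : (u : L2C V) =ᵐ[volume] bargmannFun g) (hw : (w : L2C V) =ᵐ[volume] bargmannFun f) :
    inner ℂ u w = ∫ z, conj (g z) * f z * gw z := by
  rw [Submodule.coe_inner, L2.inner_def]
  refine integral_congr_ae ?_
  filter_upwards [hu, hw] with z h1 h2
  rw [RCLike.inner_apply, h1, h2, ← conj_bargmannFun_mul, mul_comm]

/-! ### The Toeplitz operators -/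

/-- The graph of the Toeplitz operator, as a subspace. -/
def toeplitzSubmodule (Q : (V → ℂ) → ℝ) : Submodule ℂ (bargmann V × bargmann V) where
  carrier := toeplitzGraph Q
  zero_mem' := ⟨0, by
    filter_upwards with z
    simp, by simp⟩
  add_mem' := by
    rintro p q ⟨g, hg, hg2⟩ ⟨h, hh, hh2⟩
    refine ⟨g + h, ?_, ?_⟩
    · filter_upwards [Lp.coeFn_add g h, hg, hh, Lp.coeFn_add (p.1 : L2C V) (q.1 : L2C V)]
        with z h1 h2 h3 h4
      rw [h1, Pi.add_apply, h2, h3, Prod.fst_add, Submodule.coe_add, h4, Pi.add_apply, mul_add]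
    · have := add_mem hg2 hh2
      rwa [sub_add_sub_comm] at this
  smul_mem' := by
    rintro c p ⟨g, hg, hg2⟩
    refine ⟨c • g, ?_, ?_⟩
    · filter_upwards [Lp.coeFn_smul c g, hg, Lp.coeFn_smul c (p.1 : L2C V)] with z h1 h2 h4
      rw [h1, Pi.smul_apply, h2, Prod.smul_fst, Submodule.coe_smul, h4, Pi.smul_apply,
        smul_eq_mul, smul_eq_mul, mul_left_comm]
    · have := Submodule.smul_mem _ c hg2
      rwa [smul_sub] at this

/-- The restriction of the Toeplitz operator to nice functions. -/
def toeplitzCore (Q : (V → ℂ) → ℝ) : Submodule ℂ (bargmann V × bargmann V) where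
  carrier := {p | p ∈ toeplitzSubmodule Q ∧ ∃ f, Nice f ∧ (p.1 : L2C V) =ᵐ[volume] bargmannFun f}
  zero_mem' := ⟨zero_mem _, 0, ⟨differentiable_const 0, 0, by norm_num, 0, fun z => by simp⟩, by
    filter_upwards [Lp.coeFn_zero ℂ 2 (volume : Measure (V → ℂ))] with z hz
    simp [bargmannFun]⟩
  add_mem' := by
    rintro p q ⟨hp, f, hf, hpf⟩ ⟨hq, g, hg, hqg⟩
    refine ⟨add_mem hp hq, f + g, hf.add hg, ?_⟩
    filter_upwards [hpf, hqg, Lp.coeFn_add (p.1 : L2C V) (q.1 : L2C V)] with z h1 h2 h3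
    rw [Prod.fst_add, Submodule.coe_add, h3, Pi.add_apply, h1, h2]
    simp only [bargmannFun, Pi.add_apply]
    ring
  smul_mem' := by
    rintro c p ⟨hp, f, hf, hpf⟩
    refine ⟨Submodule.smul_mem _ c hp, c • f, hf.const_smul c, ?_⟩
    filter_upwards [hpf, Lp.coeFn_smul c (p.1 : L2C V)] with z h1 h3
    rw [Prod.smul_fst, Submodule.coe_smul, h3, Pi.smul_apply, h1]
    simp only [bargmannFun, Pi.smul_apply, smul_eq_mul]
    ring

theorem toeplitzCore_le (Q : (V → ℂ) → ℝ) : toeplitzCore Q ≤ toeplitzSubmodule Q :=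
  fun _ h => h.1

/-- Pairing with an element of the Bargmann space erases the projection, so the operator enters only
through the integral of its symbol. -/
theorem inner_toeplitz {Q : (V → ℂ) → ℝ} {p : bargmann V × bargmann V}
    (hp : p ∈ toeplitzSubmodule Q) (w : bargmann V) :
    inner ℂ w p.2 = ∫ z, conj ((w : L2C V) z) * (Q z * (p.1 : L2C V) z) := by
  obtain ⟨g, hg, hg2⟩ := hp
  have h1 : inner ℂ (w : L2C V) (g - (p.2 : L2C V)) = 0 :=
    (Submodule.mem_orthogonal _ _).1 hg2 w w.2
  rw [inner_sub_right, sub_eq_zero] at h1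
  rw [Submodule.coe_inner, ← h1, L2.inner_def]
  refine integral_congr_ae ?_
  filter_upwards [hg] with z hz
  rw [RCLike.inner_apply, hz, mul_comm]

theorem symmetric_toeplitz (Q : (V → ℂ) → ℝ) :
    ∀ p ∈ toeplitzSubmodule Q, ∀ q ∈ toeplitzSubmodule Q,
      inner ℂ p.1 q.2 = inner ℂ p.2 q.1 := by
  intro p hp q hq
  rw [← inner_conj_symm p.2 q.1, inner_toeplitz hq, inner_toeplitz hp, ← integral_conj]
  congr 1
  ext z
  simp only [map_mul, conj_conj, conj_ofReal]
  ring

theorem inner_toeplitz_of_nice {Q : (V → ℂ) → ℝ} {p : bargmann V × bargmann V}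
    (hp : p ∈ toeplitzSubmodule Q) {w : bargmann V} {f g : (V → ℂ) → ℂ}
    (hpf : (p.1 : L2C V) =ᵐ[volume] bargmannFun f) (hw : (w : L2C V) =ᵐ[volume] bargmannFun g) :
    inner ℂ w p.2 = ∫ z, conj (g z) * (Q z * f z) * gw z := by
  rw [inner_toeplitz hp]
  refine integral_congr_ae ?_
  filter_upwards [hpf, hw] with z h1 h2
  rw [h1, h2]
  have := conj_bargmannFun_mul f g z
  linear_combination (Q z : ℂ) * this

/-- The quadratic form `∑ (Re ⟨c_k, z⟩)²`. -/
def sumSq {ι : Type*} [Fintype ι] (c : ι → V → ℂ) (z : V → ℂ) : ℝ := ∑ k, (herm (c k) z).re ^ 2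

section SumSq

variable {ι : Type*} [Fintype ι] (c : ι → V → ℂ)

theorem continuous_sumSq : Continuous (sumSq c) := by
  unfold sumSq
  refine continuous_finsetSum _ fun k _ => ?_
  exact (continuous_re.comp (continuous_herm (c k))).pow 2

theorem sumSq_nonneg (z : V → ℂ) : 0 ≤ sumSq c z := Finset.sum_nonneg fun _ _ => sq_nonneg _

theorem re_herm_sq_le (v z : V → ℂ) : (herm v z).re ^ 2 ≤ nsq v * nsq z := by
  refine le_trans ?_ (norm_herm_sq_le v z)
  rw [← sq_abs]
  gcongr
  exact abs_re_le_norm _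

theorem gr_sumSq {ε : ℝ} (hε : 0 < ε) : Gr ε (fun z => (sumSq c z : ℂ)) := by
  refine ((gr_nsq (V := V) hε).const_mul (((∑ k, nsq (c k) : ℝ)) : ℂ)).of_norm_le fun z => ?_
  rw [← ofReal_mul, norm_real, norm_real, Real.norm_eq_abs, Real.norm_eq_abs,
    abs_of_nonneg (sumSq_nonneg c z)]
  refine le_trans ?_ (le_abs_self _)
  rw [Finset.sum_mul]
  exact Finset.sum_le_sum fun k _ => re_herm_sq_le _ _

theorem Nice.exists_mem_toeplitzCore {f : (V → ℂ) → ℂ} (hf : Nice f) :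
    ∃ p ∈ toeplitzCore (sumSq c), p.1 = hf.toBargmann := by
  obtain ⟨hfd, a, ha, hfa⟩ := id hf
  have hε : 0 < (1 / 2 - a) / 2 := by linarith
  have hm : MemLp (fun z => (sumSq c z : ℂ) * bargmannFun f z) 2 := by
    refine Gr.memLp (c := (a - 1 / 2) / 2)
      ((gr_sumSq c hε).mul hfa.bargmannFun (by linarith)) (by linarith) ?_
    have := continuous_sumSq c
    have h2 := continuous_half_gauss (V := V)
    have h3 := hfd.continuous
    have h4 : Continuous (bargmannFun f) := h2.mul h3
    exact Continuous.aestronglyMeasurable (by fun_prop)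
  refine ⟨(hf.toBargmann, (bargmann V).orthogonalProjectionOnto (hm.toLp _)),
    ⟨⟨hm.toLp _, ?_, ?_⟩, f, hf, hf.coeFn_toBargmann⟩, rfl⟩
  · filter_upwards [hm.coeFn_toLp, hf.coeFn_toBargmann] with z h1 h2
    rw [h1, h2]
  · exact Submodule.sub_starProjection_mem_orthogonal _

end SumSq

/-! ### The quadratic form of a Toeplitz operator on nice functions -/

/-- `∫ Q |f|² exp (-|z|²)`. -/
def weightedForm (Q : (V → ℂ) → ℝ) (f : (V → ℂ) → ℂ) : ℝ :=
  ∫ z, Q z * ‖f z‖ ^ 2 * Real.exp (-nsq z)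

theorem conj_mul_real_mul (q : ℝ) (f : (V → ℂ) → ℂ) (z : V → ℂ) :
    conj (f z) * (q * f z) * gw z = ((q * ‖f z‖ ^ 2 * Real.exp (-nsq z) : ℝ) : ℂ) := by
  have : conj (f z) * f z = ((‖f z‖ ^ 2 : ℝ) : ℂ) := by
    rw [← Complex.normSq_eq_conj_mul_self, Complex.normSq_eq_norm_sq]
  rw [gw, ofReal_mul, ofReal_mul, ← this]
  ring

theorem integral_conj_mul_real_mul (Q : (V → ℂ) → ℝ) (f : (V → ℂ) → ℂ) :
    ∫ z, conj (f z) * (Q z * f z) * gw z = weightedForm Q f := by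
  simp_rw [conj_mul_real_mul]
  exact integral_complex_ofReal

theorem norm_sq_bargmann {u : bargmann V} {f : (V → ℂ) → ℂ}
    (hu : (u : L2C V) =ᵐ[volume] bargmannFun f) : ‖u‖ ^ 2 = weightedForm (fun _ => 1) f := by
  have h1 := inner_bargmann_eq hu hu
  have h2 := integral_conj_mul_real_mul (fun _ => 1) f
  simp only [ofReal_one, one_mul] at h2
  rw [h2] at h1
  have h3 := (inner_self_eq_norm_sq_to_K (𝕜 := ℂ) u).symm.trans h1
  refine Complex.ofReal_injective ?_
  rw [Complex.ofReal_pow]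
  exact h3

theorem inner_toeplitz_self {Q : (V → ℂ) → ℝ} {p : bargmann V × bargmann V}
    (hp : p ∈ toeplitzSubmodule Q) {f : (V → ℂ) → ℂ}
    (hpf : (p.1 : L2C V) =ᵐ[volume] bargmannFun f) :
    inner ℂ p.1 p.2 = (weightedForm Q f : ℂ) := by
  rw [inner_toeplitz_of_nice hp hpf hpf, integral_conj_mul_real_mul]

end

noncomputable section

open MeasureTheory Complex ComplexConjugate

variable {V : Type*} [Fintype V]

/-! ### Density of the range -/

section Dilation

variable {F : (V → ℂ) → ℂ} (hF : Differentiable ℂ F) (hg : ∀ a > 1 / 2, Gr a F) {r : ℝ}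
  (hr0 : 0 < r) (hr1 : r < 1)

include hF hg hr0 hr1

/-- A dilation by r multiplies the growth exponent by r². Starting from the exponent 1/2 + (1 -
r)/4, the result is below 1/2 because (1 - r)(2 - r) > 0. -/
theorem nice_dilation : Nice (fun z => F (r • z)) := by
  refine ⟨hF.comp (by fun_prop), r ^ 2 * (1 / 2 + (1 - r) / 4), ?_,
    (hg (1 / 2 + (1 - r) / 4) (by linarith)).comp_smul r⟩
  have h1 : r ^ 2 ≤ r := by nlinarith
  nlinarith

/-- Dilations are symmetric, so one of the two dilations on the right can be moved to the left. It
has to cross ⟨v,z⟩², which is homogeneous of degree two, and this costs r⁻². The conjugate square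
and the mixed term, treated next, cost r² and 1. These are the three parts into which (Re⟨v,z⟩)²
splits. -/
theorem integral_conj_herm_sq_mul_dilation (v : V → ℂ) :
    ∫ z, conj (F z) * (herm v z ^ 2 * F (r • r • z)) * gw z =
      ((r ^ 2)⁻¹ : ℝ) * ∫ z, conj (F (r • z)) * (herm v z ^ 2 * F (r • z)) * gw z := by
  obtain ⟨hGd, a, ha, hGa⟩ := ((nice_dilation hF hg hr0 hr1).herm_mul v).herm_mul v
  have h := dilation_symm (r := r) (G := F) (F := fun z => herm v z * (herm v z * F (r • z)))
    (hg (1 / 2 + (1 - r) / 4) (by linarith)) hGa hF hGd hr0.le (by linarith) (by linarith)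
  rw [← integral_const_mul]
  have hr : (r : ℂ) ≠ 0 := by exact_mod_cast hr0.ne'
  have h2 := congrArg (fun x => (((r ^ 2)⁻¹ : ℝ) : ℂ) * x) h
  simp only [← integral_const_mul] at h2
  refine Eq.trans (integral_congr_ae (Filter.Eventually.of_forall fun z => ?_)) (h2.symm.trans
    (integral_congr_ae (Filter.Eventually.of_forall fun z => ?_)))
  · simp only [herm_real_smul_right]
    push_cast
    field_simp
  · simp only
    ring

theorem integral_conj_conj_herm_sq_mul_dilation (v : V → ℂ) :
    ∫ z, conj (F z) * (conj (herm v z) ^ 2 * F (r • r • z)) * gw z =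
      (r ^ 2 : ℝ) * ∫ z, conj (F (r • z)) * (conj (herm v z) ^ 2 * F (r • z)) * gw z := by
  obtain ⟨hGd, b, hb, hGb⟩ := nice_dilation hF hg hr0 hr1
  have hε : 0 < (1 - r) / 8 := by linarith
  have h1 : Gr (1 / 2 + 3 * (1 - r) / 8) (fun z => herm v z * (herm v z * F z)) :=
    (gr_herm v hε).mul ((gr_herm v hε).mul (hg (1 / 2 + (1 - r) / 8) (by linarith)) le_rfl)
      (by linarith)
  have h := dilation_symm (r := r) (G := fun z => herm v z * (herm v z * F z))
    (F := fun z => F (r • z)) h1 hGb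
    ((differentiable_herm v).mul ((differentiable_herm v).mul hF)) hGd hr0.le (by linarith)
    (by linarith)
  rw [← integral_const_mul]
  refine Eq.trans (integral_congr_ae (Filter.Eventually.of_forall fun z => ?_)) (h.symm.trans
    (integral_congr_ae (Filter.Eventually.of_forall fun z => ?_)))
  · simp only [map_mul]
    ring
  · simp only [map_mul, herm_real_smul_right, conj_ofReal]
    push_cast
    ring

theorem integral_norm_herm_sq_mul_dilation (v : V → ℂ) :
    ∫ z, conj (F z) * (conj (herm v z) * herm v z * F (r • r • z)) * gw z =
      ∫ z, conj (F (r • z)) * (conj (herm v z) * herm v z * F (r • z)) * gw z := by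
  obtain ⟨hGd, b, hb, hGb⟩ := (nice_dilation hF hg hr0 hr1).herm_mul v
  have hε : 0 < (1 - r) / 8 := by linarith
  have h1 : Gr (1 / 2 + 2 * (1 - r) / 8) (fun z => herm v z * F z) :=
    (gr_herm v hε).mul (hg (1 / 2 + (1 - r) / 8) (by linarith)) (by linarith)
  have h := dilation_symm (r := r) (G := fun z => herm v z * F z)
    (F := fun z => herm v z * F (r • z)) h1 hGb
    ((differentiable_herm v).mul hF) hGd hr0.le (by linarith)
    (by linarith)
  have hr : (r : ℂ) ≠ 0 := by exact_mod_cast hr0.ne'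
  have h2 := congrArg (fun x => ((r⁻¹ : ℝ) : ℂ) * x) h
  simp only [← integral_const_mul] at h2
  refine Eq.trans (integral_congr_ae (Filter.Eventually.of_forall fun z => ?_)) (h2.symm.trans
    (integral_congr_ae (Filter.Eventually.of_forall fun z => ?_)))
  · simp only [map_mul, herm_real_smul_right]
    push_cast
    field_simp
  · simp only [map_mul, herm_real_smul_right, conj_ofReal]
    push_cast
    field_simp

theorem integral_conj_mul_dilation :
    ∫ z, conj (F z) * F (r • r • z) * gw z =
      ∫ z, conj (F (r • z)) * F (r • z) * gw z := by
  obtain ⟨hGd, b, hb, hGb⟩ := nice_dilation hF hg hr0 hr1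
  have h := dilation_symm (r := r) (G := F)
    (F := fun z => F (r • z)) (hg (1 / 2 + (1 - r) / 8) (by linarith)) hGb
    hF hGd hr0.le (by linarith) (by linarith)
  exact h.symm

end Dilation

theorem re_sq_eq (w : ℂ) : ((w.re ^ 2 : ℝ) : ℂ) = (w ^ 2 + conj w ^ 2 + 2 * (conj w * w)) / 4 := by
  have : (w.re : ℂ) = (w + conj w) / 2 := by rw [Complex.add_conj]; simp
  rw [ofReal_pow, this]; ring

theorem Gr.integrable_weight {a b : ℝ} {F G P : (V → ℂ) → ℂ} (hF : Gr a F) (hG : Gr b G)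
    (hab : a + b < 1) (hP : ∀ ε > 0, Gr ε P) (hFc : Continuous F) (hGc : Continuous G)
    (hPc : Continuous P) : Integrable (fun z => conj (F z) * (P z * G z) * gw z) := by
  have hε : 0 < (1 - (a + b)) / 2 := by linarith
  refine Gr.integrable (c := (a + b - 1) / 2) ((hF.conj.mul ((hP _ hε).mul hG le_rfl) le_rfl).mul
    gr_gw (by linarith)) (by linarith) ?_
  have := continuous_conj.comp hFc
  have := continuous_gw (V := V)
  exact Continuous.aestronglyMeasurable (by fun_prop)

theorem gr_herm_sq (v : V → ℂ) {ε : ℝ} (hε : 0 < ε) : Gr ε (fun z => herm v z ^ 2) := by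
  have := (gr_herm v (half_pos hε)).mul (gr_herm v (half_pos hε)) (add_halves ε).le
  simpa [sq] using this

theorem gr_conj_herm_sq (v : V → ℂ) {ε : ℝ} (hε : 0 < ε) : Gr ε (fun z => conj (herm v z) ^ 2) := by
  simpa using (gr_herm_sq v hε).conj

theorem gr_norm_herm_sq (v : V → ℂ) {ε : ℝ} (hε : 0 < ε) :
    Gr ε (fun z => conj (herm v z) * herm v z) :=
  (gr_herm v (half_pos hε)).conj.mul (gr_herm v (half_pos hε)) (add_halves ε).le

theorem continuous_conj_herm (v : V → ℂ) : Continuous (fun z => conj (herm v z)) :=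
  continuous_conj.comp (continuous_herm v)

/-- Splitting of `(Re ⟨v, z⟩)²` under the integral sign. -/
theorem integral_re_herm_sq {a b : ℝ} {F G : (V → ℂ) → ℂ} (hF : Gr a F) (hG : Gr b G)
    (hab : a + b < 1) (hFc : Continuous F) (hGc : Continuous G) (v : V → ℂ) :
    ∫ z, conj (F z) * (((herm v z).re ^ 2 : ℝ) * G z) * gw z =
      ((∫ z, conj (F z) * (herm v z ^ 2 * G z) * gw z) +
        (∫ z, conj (F z) * (conj (herm v z) ^ 2 * G z) * gw z) +
        2 * ∫ z, conj (F z) * (conj (herm v z) * herm v z * G z) * gw z) / 4 := by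
  have h1 := hF.integrable_weight hG hab (fun ε hε => gr_herm_sq v hε) hFc hGc
    ((continuous_herm v).pow 2)
  have h2 := hF.integrable_weight hG hab (fun ε hε => gr_conj_herm_sq v hε) hFc hGc
    ((continuous_conj_herm v).pow 2)
  have h3 := hF.integrable_weight hG hab (fun ε hε => gr_norm_herm_sq v hε) hFc hGc
    ((continuous_conj_herm v).mul (continuous_herm v))
  have h12 : Integrable (fun z => conj (F z) * (herm v z ^ 2 * G z) * gw z +
      conj (F z) * (conj (herm v z) ^ 2 * G z) * gw z) := h1.add h2
  rw [← integral_const_mul, ← integral_add h1 h2, ← integral_add h12 (h3.const_mul 2),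
    ← integral_div]
  refine integral_congr_ae (Filter.Eventually.of_forall fun z => ?_)
  simp only [re_sq_eq]
  ring

theorem Nice.integrable_weight {f : (V → ℂ) → ℂ} (hf : Nice f) {Q : (V → ℂ) → ℝ}
    (hQ : ∀ ε > 0, Gr ε (fun z => (Q z : ℂ))) (hQc : Continuous Q) :
    Integrable (fun z => Q z * ‖f z‖ ^ 2 * Real.exp (-nsq z)) := by
  obtain ⟨hd, a, ha, hfa⟩ := hf
  have := (hfa.integrable_weight hfa (by linarith) hQ hd.continuous hd.continuous
    (continuous_ofReal.comp hQc)).re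
  refine this.congr (Filter.Eventually.of_forall fun z => ?_)
  simp only [conj_mul_real_mul]
  exact ofReal_re _

/-- The change of variables transfers the dilation from F to the Gaussian weight, after which the
dependence on r is monotone. -/
theorem weightedForm_dilation (F : (V → ℂ) → ℂ) {r : ℝ} (hr0 : 0 < r) (Q : (V → ℂ) → ℝ) :
    weightedForm (fun z => Q (r • z)) (fun z => F (r • z)) =
      |(r ^ Module.finrank ℝ (V → ℂ))⁻¹| *
        ∫ z, Q z * ‖F z‖ ^ 2 * Real.exp (-((r ^ 2)⁻¹ * nsq z)) := by
  have := Measure.integral_comp_smul (volume : Measure (V → ℂ))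
    (fun z => Q z * ‖F z‖ ^ 2 * Real.exp (-((r ^ 2)⁻¹ * nsq z))) r
  rw [smul_eq_mul] at this
  rw [← this, weightedForm]
  refine integral_congr_ae (Filter.Eventually.of_forall fun z => ?_)
  simp only [nsq_real_smul]
  rw [inv_mul_cancel_left₀ (by positivity)]

end

noncomputable section

open MeasureTheory Complex ComplexConjugate

variable {V : Type*} [Fintype V]

theorem weightedForm_nonneg {Q : (V → ℂ) → ℝ} (hQ : ∀ z, 0 ≤ Q z) (f : (V → ℂ) → ℂ) :
    0 ≤ weightedForm Q f :=
  integral_nonneg fun z => mul_nonneg (mul_nonneg (hQ z) (sq_nonneg _)) (Real.exp_pos _).le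

theorem norm_integral_herm_sq_le {f : (V → ℂ) → ℂ} (hf : Nice f) (v : V → ℂ) :
    ‖∫ z, conj (f z) * (herm v z ^ 2 * f z) * gw z‖ ≤ nsq v * weightedForm nsq f := by
  rw [weightedForm, ← integral_const_mul]
  refine norm_integral_le_of_norm_le
    ((hf.integrable_weight (fun ε hε => gr_nsq hε) continuous_nsq).const_mul _)
    (Filter.Eventually.of_forall fun z => ?_)
  rw [norm_mul, norm_mul, norm_mul, norm_pow, RCLike.norm_conj, gw, norm_real, Real.norm_eq_abs,
    abs_of_pos (Real.exp_pos _)]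
  have h1 := norm_herm_sq_le v z
  calc ‖f z‖ * (‖herm v z‖ ^ 2 * ‖f z‖) * Real.exp (-nsq z)
      = ‖herm v z‖ ^ 2 * (‖f z‖ ^ 2 * Real.exp (-nsq z)) := by ring
    _ ≤ (nsq v * nsq z) * (‖f z‖ ^ 2 * Real.exp (-nsq z)) := by gcongr
    _ = _ := by ring

variable {ι : Type*} [Fintype ι] (c : ι → V → ℂ)

theorem integral_sumSq {a b : ℝ} {F G : (V → ℂ) → ℂ} (hF : Gr a F) (hG : Gr b G)
    (hab : a + b < 1) (hFc : Continuous F) (hGc : Continuous G) :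
    ∫ z, conj (F z) * (sumSq c z * G z) * gw z =
      ∑ k, ∫ z, conj (F z) * (((herm (c k) z).re ^ 2 : ℝ) * G z) * gw z := by
  rw [← integral_finsetSum]
  · refine integral_congr_ae (Filter.Eventually.of_forall fun z => ?_)
    simp only [sumSq, ofReal_sum, Finset.sum_mul, Finset.mul_sum]
  · intro k _
    refine hF.integrable_weight hG hab (fun ε hε => ?_) hFc hGc
      (continuous_ofReal.comp ((continuous_re.comp (continuous_herm (c k))).pow 2))
    have := gr_sumSq (fun _ : Unit => c k) hε
    simpa [sumSq] using this

/-- If F is a weak eigenvector against its dilation by r², then the dilation by r almost satisfies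
the eigenvalue equation in the form sense. Distributing the dilation evenly changes only the parts
of degree ±2, with factors r^{∓2} instead of 1, and the average error (r⁻² + r²)/2 - 1 = (r⁻¹ -
r)²/2 is of second order in 1 - r. -/
theorem weightedForm_dilation_le {F : (V → ℂ) → ℂ} (hF : Differentiable ℂ F)
    (hg : ∀ a > 1 / 2, Gr a F) {r : ℝ} (hr0 : 0 < r) (hr1 : r < 1) {l : ℝ}
    (h0 : ∫ z, conj (F z) * (sumSq c z * F (r • r • z)) * gw z =
      l * ∫ z, conj (F z) * F (r • r • z) * gw z) :
    weightedForm (sumSq c) (fun z => F (r • z)) ≤ l * weightedForm (fun _ => 1) (fun z => F (r • z))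
      + (r⁻¹ - r) ^ 2 / 4 * ((∑ k, nsq (c k)) * weightedForm nsq (fun z => F (r • z))) := by
  have hG := nice_dilation hF hg hr0 hr1
  have hGG : Nice (fun z => F (r • r • z)) := by
    have h := nice_dilation hF hg (r := r * r) (by positivity) (by nlinarith)
    simpa only [smul_smul] using h
  obtain ⟨hGd, a, ha, hGa⟩ := id hG
  obtain ⟨hGGd, b, hb, hGGb⟩ := hGG
  set G : (V → ℂ) → ℂ := fun z => F (r • z) with hGdef
  set α : ι → ℂ := fun k => ∫ z, conj (G z) * (herm (c k) z ^ 2 * G z) * gw z with hα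
  set β : ι → ℂ := fun k => ∫ z, conj (G z) * (conj (herm (c k) z) * herm (c k) z * G z) * gw z
    with hβ
  have hconj : ∀ k, ∫ z, conj (G z) * (conj (herm (c k) z) ^ 2 * G z) * gw z = conj (α k) := by
    intro k
    rw [hα, ← integral_conj]
    refine integral_congr_ae (Filter.Eventually.of_forall fun z => ?_)
    simp only [map_mul, map_pow, conj_conj, conj_gw]
    ring
  rw [integral_sumSq c (hg ((1 - b) / 2 + 1 / 4) (by linarith)) hGGb (by linarith) hF.continuous
    hGGd.continuous] at h0
  have h1 : ∀ k, ∫ z, conj (F z) * (((herm (c k) z).re ^ 2 : ℝ) * F (r • r • z)) * gw z =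
      (((r ^ 2)⁻¹ : ℝ) * α k + (r ^ 2 : ℝ) * conj (α k) + 2 * β k) / 4 := fun k => by
    rw [integral_re_herm_sq (hg ((1 - b) / 2 + 1 / 4) (by linarith)) hGGb (by linarith)
      hF.continuous hGGd.continuous, integral_conj_herm_sq_mul_dilation hF hg hr0 hr1,
      integral_conj_conj_herm_sq_mul_dilation hF hg hr0 hr1,
      integral_norm_herm_sq_mul_dilation hF hg hr0 hr1, ← hconj k]
  simp_rw [h1] at h0
  rw [integral_conj_mul_dilation hF hg hr0 hr1] at h0
  have h2 : (weightedForm (sumSq c) G : ℂ) = ∑ k, (α k + conj (α k) + 2 * β k) / 4 := by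
    rw [← integral_conj_mul_real_mul, integral_sumSq c hGa hGa (by linarith) hGd.continuous
      hGd.continuous]
    refine Finset.sum_congr rfl fun k _ => ?_
    rw [integral_re_herm_sq hGa hGa (by linarith) hGd.continuous hGd.continuous, hconj k]
  have h3 : ∫ z, conj (F (r • z)) * F (r • z) * gw z = (weightedForm (fun _ => 1) G : ℂ) := by
    rw [← integral_conj_mul_real_mul]
    simp [hGdef]
  rw [h3] at h0
  have h4 := congrArg re h2
  have h5 := congrArg re h0
  rw [ofReal_re] at h4
  rw [← ofReal_mul, ofReal_re] at h5
  simp only [re_sum] at h4 h5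
  have h6 : ∀ k, ((α k + conj (α k) + 2 * β k) / 4).re = (2 * (α k).re + 2 * (β k).re) / 4 :=
    fun k => by
      have : ((4 : ℝ) : ℂ) = 4 := by norm_num
      rw [← this, div_ofReal_re]; simp; ring
  have h7 : ∀ k, ((((r ^ 2)⁻¹ : ℝ) * α k + (r ^ 2 : ℝ) * conj (α k) + 2 * β k) / 4).re =
      (((r ^ 2)⁻¹ + r ^ 2) * (α k).re + 2 * (β k).re) / 4 := fun k => by
      have : ((4 : ℝ) : ℂ) = 4 := by norm_num
      rw [← this, div_ofReal_re]
      simp only [add_re, re_ofReal_mul, conj_re]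
      simp; ring
  simp only [h6] at h4
  simp only [h7] at h5
  have h8 : (r⁻¹ - r) ^ 2 = (r ^ 2)⁻¹ + r ^ 2 - 2 := by field_simp; ring
  have h9 : -((∑ k, nsq (c k)) * weightedForm nsq G) ≤ ∑ k, (α k).re := by
    rw [Finset.sum_mul, ← Finset.sum_neg_distrib]
    refine Finset.sum_le_sum fun k _ => ?_
    have := norm_integral_herm_sq_le hG (c k)
    have h10 := (abs_le.1 (abs_re_le_norm (α k))).1
    exact le_trans (neg_le_neg this) h10
  have h11 : ∑ k, (((r ^ 2)⁻¹ + r ^ 2) * (α k).re + 2 * (β k).re) / 4 =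
      ∑ k, (2 * (α k).re + 2 * (β k).re) / 4 + (r⁻¹ - r) ^ 2 / 4 * ∑ k, (α k).re := by
    rw [Finset.mul_sum, ← Finset.sum_add_distrib, h8]
    exact Finset.sum_congr rfl fun k _ => by ring
  rw [h11, ← h4] at h5
  nlinarith [mul_le_mul_of_nonneg_left h9 (by positivity : 0 ≤ (r⁻¹ - r) ^ 2 / 4)]

/-- The orthogonal of the range of `T₁(Q) - l` on nice functions is trivial, for `l` below a lower
bound of the quadratic form. -/
theorem toeplitzCore_dense_range {m l : ℝ} (hl : l < m)
    (hlow : ∀ f : (V → ℂ) → ℂ, Nice f →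
      m * weightedForm (fun _ => 1) f ≤ weightedForm (sumSq c) f) (w : bargmann V)
    (hw : ∀ p ∈ toeplitzCore (sumSq c), inner ℂ w (p.2 - (l : ℂ) • p.1) = 0) : w = 0 := by
  set F := bargmannEval (w : L2C V) with hFdef
  have hFd : Differentiable ℂ F := differentiable_bargmannEval _
  have hg : ∀ a > 1 / 2, Gr a F := fun a ha => gr_bargmannEval _ ha
  have hwF : (w : L2C V) =ᵐ[volume] bargmannFun F := mem_bargmann_iff.1 w.2
  have hml : 0 < m - l := by linarith
  set C := ∑ k, nsq (c k) with hC
  have hC0 : 0 ≤ C := Finset.sum_nonneg fun _ _ => nsq_nonneg _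
  set I : ℝ := ∫ z, ‖F z‖ ^ 2 * Real.exp (-nsq z) with hI
  set K : ℝ := ∫ z, ‖F z‖ ^ 2 * Real.exp (-(2 * nsq z)) with hK
  have hint : Integrable (fun z => ‖F z‖ ^ 2 * Real.exp (-nsq z)) := by
    have h1 := ((memLp_two_iff_integrable_sq_norm (Lp.memLp (w : L2C V)).1).1
      (Lp.memLp (w : L2C V)))
    refine h1.congr ?_
    filter_upwards [hwF] with z hz
    rw [hz, bargmannFun, norm_mul, mul_pow, norm_real, Real.norm_eq_abs,
      abs_of_pos (Real.exp_pos _), ← Real.exp_nat_mul, mul_comm, nsq]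
    congr 2
    push_cast
    ring
  have hcont := hFd.continuous
  have hnc := continuous_nsq (V := V)
  have hmeas : ∀ s : ℝ, AEStronglyMeasurable (fun z => ‖F z‖ ^ 2 * Real.exp (-(s * nsq z))) volume :=
    fun s => Continuous.aestronglyMeasurable (by fun_prop)
  have hints : ∀ s ≥ 1, Integrable (fun z => ‖F z‖ ^ 2 * Real.exp (-(s * nsq z))) := fun s hs => by
    refine hint.mono' (hmeas s) (Filter.Eventually.of_forall fun z => ?_)
    rw [Real.norm_eq_abs, abs_of_nonneg (by positivity)]
    have := nsq_nonneg z
    gcongr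
    nlinarith
  have hI0 : 0 ≤ I := integral_nonneg fun z => by positivity
  -- The restriction r² ≥ 1/2 gives r⁻² ≤ 2, so that K bounds the weighted norms from below
  -- independently of r. As r tends to 1 the right-hand side tends to 0.
  have key : ∀ r : ℝ, 0 < r → r < 1 → 1 / 2 ≤ r ^ 2 → (m - l) * K ≤ C * (1 - r ^ 2) / 2 * I := by
    intro r hr0 hr1 hr2
    have hGG : Nice (fun z => F (r • r • z)) := by
      have h := nice_dilation hFd hg (r := r * r) (by positivity) (by nlinarith)
      simpa only [smul_smul] using h
    -- The test function is the dilation of F itself by r², one half of which is then moved to the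
    -- other factor of the scalar product.
    obtain ⟨p, hp, hp1⟩ := hGG.exists_mem_toeplitzCore c
    have hpf : (p.1 : L2C V) =ᵐ[volume] bargmannFun fun z => F (r • r • z) := by
      rw [hp1]; exact hGG.coeFn_toBargmann
    have h0 := hw p hp
    have hsm : inner ℂ w ((l : ℂ) • p.1) = (l : ℂ) * inner ℂ w p.1 :=
      inner_smul_right (𝕜 := ℂ) (E := bargmann V) w p.1 (l : ℂ)
    rw [inner_sub_right, hsm, inner_toeplitz_of_nice hp.1 hpf hwF,
      inner_bargmann_eq hwF hpf, sub_eq_zero] at h0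
    have h1 := weightedForm_dilation_le c hFd hg hr0 hr1 h0
    have h2 := hlow _ (nice_dilation hFd hg hr0 hr1)
    have e1 := weightedForm_dilation F hr0 (fun _ => 1)
    have e2 := weightedForm_dilation F hr0 (fun z => (r ^ 2)⁻¹ * nsq z)
    have e3 : weightedForm (fun z => (r ^ 2)⁻¹ * nsq (r • z)) (fun z => F (r • z)) =
        weightedForm nsq (fun z => F (r • z)) := by
      congr 1
      ext z
      rw [nsq_real_smul, inv_mul_cancel_left₀ (by positivity)]
    simp only [e3] at e2
    rw [e1] at h1 h2
    rw [e2] at h1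
    set J := |(r ^ Module.finrank ℝ (V → ℂ))⁻¹|
    have hJ : 0 < J := by positivity
    set A := ∫ z, (1 : ℝ) * ‖F z‖ ^ 2 * Real.exp (-((r ^ 2)⁻¹ * nsq z)) with hA
    set B := ∫ z, (r ^ 2)⁻¹ * nsq z * ‖F z‖ ^ 2 * Real.exp (-((r ^ 2)⁻¹ * nsq z)) with hB
    have h3 : (m - l) * A ≤ (r⁻¹ - r) ^ 2 / 4 * (C * B) := by
      refine le_of_mul_le_mul_left ?_ hJ
      nlinarith
    have hr2p : 0 < r ^ 2 := by positivity
    have hinv1 : 1 ≤ (r ^ 2)⁻¹ := (one_le_inv₀ hr2p).2 (by nlinarith)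
    have hinv2 : (r ^ 2)⁻¹ ≤ 2 := by
      rw [inv_le_comm₀ hr2p two_pos]; linarith
    have h4 : K ≤ A := by
      simp only [hA, one_mul]
      refine integral_mono (hints 2 (by norm_num)) (hints _ hinv1) fun z => ?_
      have := nsq_nonneg z
      dsimp only
      gcongr
    -- The dilated weight carries an additional factor exp(-s|z|²), and x·exp(-sx) ≤ 1/s controls
    -- the moment |z|². The price 1/s = r²/(1 - r²) is beaten by (r⁻¹ - r)², which is of order (1 -
    -- r²)².
    set s := (r ^ 2)⁻¹ - 1 with hs
    have hr21 : r ^ 2 < 1 := by nlinarith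
    have hs0 : 0 < s := by
      have : 1 < (r ^ 2)⁻¹ := (one_lt_inv₀ hr2p).2 hr21
      linarith
    have hB' : B ≤ (r ^ 2)⁻¹ * s⁻¹ * I := by
      rw [hB, hI, ← integral_const_mul]
      refine integral_mono_of_nonneg (Filter.Eventually.of_forall fun z => ?_)
        (hint.const_mul _) (Filter.Eventually.of_forall fun z => ?_)
      · have := nsq_nonneg z
        simp only [Pi.zero_apply]
        positivity
      · have hn := nsq_nonneg z
        have e : Real.exp (-((r ^ 2)⁻¹ * nsq z)) = Real.exp (-(s * nsq z)) * Real.exp (-nsq z) := by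
          rw [← Real.exp_add, hs]; ring_nf
        have h5 : nsq z * Real.exp (-(s * nsq z)) ≤ s⁻¹ := by
          rw [Real.exp_neg, ← div_eq_mul_inv, div_le_iff₀ (Real.exp_pos _), inv_mul_eq_div,
            le_div_iff₀ hs0]
          have := Real.add_one_le_exp (s * nsq z)
          linarith
        dsimp only
        rw [e]
        calc (r ^ 2)⁻¹ * nsq z * ‖F z‖ ^ 2 * (Real.exp (-(s * nsq z)) * Real.exp (-nsq z))
            = (r ^ 2)⁻¹ * (nsq z * Real.exp (-(s * nsq z))) * (‖F z‖ ^ 2 * Real.exp (-nsq z)) := by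
              ring
          _ ≤ _ := by gcongr
    have h6 : (r⁻¹ - r) ^ 2 / 4 * (C * ((r ^ 2)⁻¹ * s⁻¹ * I)) =
        C * ((1 - r ^ 2) * (r ^ 2)⁻¹) / 4 * I := by
      have : s = (1 - r ^ 2) / r ^ 2 := by rw [hs]; field_simp
      have h1r : 1 - r ^ 2 ≠ 0 := by linarith
      rw [this]
      field_simp
    calc (m - l) * K ≤ (m - l) * A := by gcongr
      _ ≤ (r⁻¹ - r) ^ 2 / 4 * (C * B) := h3
      _ ≤ (r⁻¹ - r) ^ 2 / 4 * (C * ((r ^ 2)⁻¹ * s⁻¹ * I)) := by gcongr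
      _ = C * ((1 - r ^ 2) * (r ^ 2)⁻¹) / 4 * I := h6
      _ ≤ C * ((1 - r ^ 2) * 2) / 4 * I := by
        have : 0 ≤ 1 - r ^ 2 := by linarith
        gcongr
      _ = _ := by ring
  have hK0 : K ≤ 0 := by
    by_contra hKpos
    push Not at hKpos
    have hpos : 0 < (m - l) * K := mul_pos hml hKpos
    -- ε stands for 1 - r². The second term of the minimum is chosen so that Cε/2·I < (m - l)K,
    -- against `key`.
    set ε := min (1 / 2) ((m - l) * K / (C * I + 1)) with hε
    have hCI : 0 ≤ C * I := mul_nonneg hC0 hI0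
    have hε0 : 0 < ε := lt_min (by norm_num) (by positivity)
    have hε1 : ε ≤ 1 / 2 := min_le_left _ _
    have hε2 : ε * (C * I + 1) ≤ (m - l) * K :=
      (le_div_iff₀ (by positivity)).1 (min_le_right _ _)
    have hsq : Real.sqrt (1 - ε) ^ 2 = 1 - ε := Real.sq_sqrt (by linarith)
    have := key (Real.sqrt (1 - ε)) (Real.sqrt_pos.2 (by linarith))
      (by rw [Real.sqrt_lt' one_pos]; linarith) (by rw [hsq]; linarith)
    rw [hsq] at this
    nlinarith
  have hKz : K = 0 := le_antisymm hK0 (integral_nonneg fun z => by positivity)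
  have h1 := (integral_eq_zero_iff_of_nonneg (fun z => by positivity)
    (hints 2 (by norm_num))).1 hKz
  have h2 : (w : L2C V) = 0 := by
    refine Lp.ext ?_
    filter_upwards [h1, hwF, Lp.coeFn_zero ℂ 2 (volume : Measure (V → ℂ))] with z hz hz2 hz3
    have h3 : ‖F z‖ ^ 2 = 0 := by
      rcases mul_eq_zero.1 hz with h | h
      · exact h
      · exact absurd h (Real.exp_ne_zero _)
    have h4 : F z = 0 := by simpa using h3
    rw [hz2, hz3, bargmannFun, h4, mul_zero, Pi.zero_apply]
  exact Subtype.ext h2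

end

/-! ### The Melin value as the infimum of a quadratic form -/

noncomputable section

open MeasureTheory Complex ComplexConjugate

variable {V : Type*} [Fintype V]

section Melin

variable {ι : Type*} [Fintype ι] (c : ι → V → ℂ)

theorem lower_bound_toeplitzCore {m : ℝ}
    (hlow : ∀ f : (V → ℂ) → ℂ, Nice f →
      m * weightedForm (fun _ => 1) f ≤ weightedForm (sumSq c) f) :
    ∀ p ∈ toeplitzCore (sumSq c), m * ‖p.1‖ ^ 2 ≤ (inner ℂ p.1 p.2 : ℂ).re := by
  rintro p ⟨hp, f, hf, hpf⟩
  rw [inner_toeplitz_self hp hpf, norm_sq_bargmann hpf, ofReal_re]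
  exact hlow f hf

theorem nice_const_one : Nice (fun _ : V → ℂ => (1 : ℂ)) :=
  ⟨differentiable_const 1, 0, by norm_num, 1, fun z => by simp⟩

/-- The infimum of the quadratic form on nice functions is in the spectrum, which is bounded below
by it. -/
theorem exists_isLeast_spectrum :
    ∃ m : ℝ, (∀ f : (V → ℂ) → ℂ, Nice f →
        m * weightedForm (fun _ => 1) f ≤ weightedForm (sumSq c) f) ∧
      (∀ m' > m, ∃ f : (V → ℂ) → ℂ, Nice f ∧
        weightedForm (sumSq c) f < m' * weightedForm (fun _ => 1) f) ∧
      melinValueForm (sumSq c) = m := by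
  -- The infimum of the quotient is taken as the supremum of its lower bounds, which requires no
  -- division by the norm. The set contains 0 because the symbol is nonnegative, and f = 1 bounds it
  -- above.
  set S : Set ℝ := {m | ∀ f : (V → ℂ) → ℂ, Nice f →
        m * weightedForm (fun _ => 1) f ≤ weightedForm (sumSq c) f} with hS
  have hpos : 0 < weightedForm (fun _ => 1) (fun _ : V → ℂ => (1 : ℂ)) := by
    simpa [weightedForm, gaussMass] using gaussMass_pos (V := V)
  have hS0 : (0 : ℝ) ∈ S := fun f _ => by
    rw [zero_mul]; exact weightedForm_nonneg (sumSq_nonneg c) f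
  have hSb : BddAbove S := by
    refine ⟨weightedForm (sumSq c) (fun _ => 1) / weightedForm (fun _ => 1)
      (fun _ : V → ℂ => (1 : ℂ)), fun m hm => ?_⟩
    rw [le_div_iff₀ hpos]
    exact hm _ nice_const_one
  set m := sSup S with hm
  have hlow : m ∈ S := by
    intro f hf
    rcases (weightedForm_nonneg (fun _ => zero_le_one) f).eq_or_lt with h | h
    · rw [← h, mul_zero]; exact weightedForm_nonneg (sumSq_nonneg c) f
    · rw [← le_div_iff₀ h]
      refine csSup_le ⟨0, hS0⟩ fun m' hm' => ?_
      rw [le_div_iff₀ h]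
      exact hm' f hf
  have hopt : ∀ m' > m, ∃ f : (V → ℂ) → ℂ, Nice f ∧
      weightedForm (sumSq c) f < m' * weightedForm (fun _ => 1) f := by
    intro m' hm'
    by_contra hcon
    push Not at hcon
    have : m' ∈ S := hcon
    exact absurd (le_csSup hSb this) (not_le.2 hm')
  refine ⟨m, hlow, hopt, ?_⟩
  have hleast : IsLeast {x : ℝ | (x : ℂ) ∈ graphSpectrum (closure (toeplitzGraph (sumSq c)))} m := by
    constructor
    -- Any l < m would do here; it only serves to identify the closure with that of the core.
    · refine infimum_mem_graphSpectrum (Γ := toeplitzSubmodule (sumSq c)) (toeplitzCore_le _)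
        (symmetric_toeplitz _) (l := m - 1) (by linarith) (lower_bound_toeplitzCore c hlow) ?_
        (toeplitzCore_dense_range c (m := m) (by linarith) hlow)
      intro m' hm'
      obtain ⟨f, hf, hfm⟩ := hopt m' hm'
      obtain ⟨p, hp, hp1⟩ := hf.exists_mem_toeplitzCore c
      have hpf : (p.1 : L2C V) =ᵐ[volume] bargmannFun f := by
        rw [hp1]; exact hf.coeFn_toBargmann
      refine ⟨p, hp, ?_⟩
      rw [inner_toeplitz_self hp.1 hpf, norm_sq_bargmann hpf, ofReal_re]
      exact hfm
    · intro x hx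
      by_contra hlt
      push Not at hlt
      exact notMem_graphSpectrum_of_lower_bound (Γ := toeplitzSubmodule (sumSq c))
        (toeplitzCore_le _) (symmetric_toeplitz _) hlt (lower_bound_toeplitzCore c hlow)
        (toeplitzCore_dense_range c hlt hlow) hx
  exact hleast.csInf_eq

theorem le_melinValueForm {m : ℝ}
    (hlow : ∀ f : (V → ℂ) → ℂ, Nice f →
      m * weightedForm (fun _ => 1) f ≤ weightedForm (sumSq c) f) :
    m ≤ melinValueForm (sumSq c) := by
  obtain ⟨m₀, -, h2, h3⟩ := exists_isLeast_spectrum c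
  rw [h3]
  by_contra hlt
  push Not at hlt
  obtain ⟨f, hf, hfm⟩ := h2 m hlt
  exact absurd (hlow f hf) (not_le.2 hfm)

theorem melinValueForm_le {f : (V → ℂ) → ℂ} (hf : Nice f)
    (hpos : 0 < weightedForm (fun _ => 1) f) {m : ℝ}
    (h : weightedForm (sumSq c) f ≤ m * weightedForm (fun _ => 1) f) :
    melinValueForm (sumSq c) ≤ m := by
  obtain ⟨m₀, h1, -, h3⟩ := exists_isLeast_spectrum c
  rw [h3]
  exact le_of_mul_le_mul_right ((h1 f hf).trans h) hpos

end Melin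

theorem weightedForm_one_pos {f : (V → ℂ) → ℂ} (hf : Nice f) (h0 : f 0 ≠ 0) :
    0 < weightedForm (fun _ => 1) f := by
  have hc := hf.1.continuous
  have hn := continuous_nsq (V := V)
  have hint : Integrable (fun z => (1 : ℝ) * ‖f z‖ ^ 2 * Real.exp (-nsq z)) :=
    hf.integrable_weight (Q := fun _ => 1)
      (fun ε hε => ⟨1, fun z => by
        have := nsq_nonneg z
        simp only [ofReal_one, norm_one, one_mul]
        exact Real.one_le_exp (by positivity)⟩) continuous_const
  refine (weightedForm_nonneg (fun _ => zero_le_one) f).lt_of_ne fun h => h0 ?_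
  have h1 := (integral_eq_zero_iff_of_nonneg (fun z => by positivity) hint).1 h.symm
  have h2 := congrFun ((Continuous.ae_eq_iff_eq (μ := (volume : Measure (V → ℂ))) (by fun_prop)
    continuous_zero).1 h1) 0
  simpa [Real.exp_ne_zero] using h2

/-! ### Commutation relations and lower bounds -/

/-- The Gaussian scalar product. -/
def gip (g f : (V → ℂ) → ℂ) : ℂ := ∫ z, conj (g z) * f z * gw z

theorem conj_gip (g f : (V → ℂ) → ℂ) : conj (gip g f) = gip f g := by
  rw [gip, gip, ← integral_conj]
  refine integral_congr_ae (Filter.Eventually.of_forall fun z => ?_)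
  simp only [map_mul, conj_conj, conj_gw]
  ring

theorem gip_self (f : (V → ℂ) → ℂ) : gip f f = (weightedForm (fun _ => 1) f : ℂ) := by
  rw [← integral_conj_mul_real_mul]
  simp [gip]

theorem gip_add_right {f g h : (V → ℂ) → ℂ} (hf : Nice f) (hg : Nice g) (hh : Nice h) :
    gip f (fun z => g z + h z) = gip f g + gip f h := by
  rw [gip, gip, gip, ← integral_add (hf.integrable_conj_mul hg) (hf.integrable_conj_mul hh)]
  refine integral_congr_ae (Filter.Eventually.of_forall fun z => ?_)
  simp only
  ring

theorem gip_add_left {f g h : (V → ℂ) → ℂ} (hf : Nice f) (hg : Nice g) (hh : Nice h) :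
    gip (fun z => g z + h z) f = gip g f + gip h f := by
  rw [← conj_gip, gip_add_right hf hg hh, map_add, conj_gip, conj_gip]

theorem gip_const_mul_right (a : ℂ) (g f : (V → ℂ) → ℂ) :
    gip g (fun z => a * f z) = a * gip g f := by
  rw [gip, gip, ← integral_const_mul]
  refine integral_congr_ae (Filter.Eventually.of_forall fun z => ?_)
  simp only
  ring

theorem gip_const_mul_left (a : ℂ) (g f : (V → ℂ) → ℂ) :
    gip (fun z => a * g z) f = conj a * gip g f := by
  rw [← conj_gip, gip_const_mul_right, map_mul, conj_gip]

theorem Nice.fderiv {f : (V → ℂ) → ℂ} (hf : Nice f) (v : V → ℂ) :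
    Nice (fun z => fderiv ℂ f z v) := by
  obtain ⟨hd, a, ha, hfa⟩ := hf
  refine ⟨?_, _, ?_, gr_fderiv hfa (a' := (1 / 2 + a) / 2) (by linarith) (by linarith) hd v⟩
  · have h1 : (fun z => _root_.fderiv ℂ f z v) =
        fun z => (gaussMass V : ℂ)⁻¹ * expTransform (fun w => (herm w v * f w) * gw w) z := by
      ext z
      rw [fderiv_eq_expTransform hfa (by linarith) hd, mul_comm (_root_.fderiv ℂ f z v),
        inv_mul_cancel_left₀ gaussMass_ne_zero]
    rw [h1]
    have hε : 0 < (1 / 2 - a) := by linarith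
    exact (differentiable_expTransform (((gr_herm_left v hε).mul hfa le_rfl).expIntegrable
      (by linarith) ((continuous_herm_left v).mul hd.continuous))).const_mul _
  · rw [div_lt_div_iff₀ (by linarith) (by norm_num)]
    linarith

theorem gip_fderiv_left {f g : (V → ℂ) → ℂ} (hg : Nice g) (hf : Nice f) (v : V → ℂ) :
    gip (fun z => fderiv ℂ g z v) f = gip g (fun z => herm v z * f z) := by
  obtain ⟨hd, a, ha, hfa⟩ := hf
  obtain ⟨hgd, b, hb, hgb⟩ := hg
  exact integral_conj_fderiv_mul hgb hfa hgd hd hb ha v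

theorem fderiv_herm_mul {f : (V → ℂ) → ℂ} (hf : Differentiable ℂ f) (w v z : V → ℂ) :
    fderiv ℂ (fun z => herm w z * f z) z v = herm w v * f z + herm w z * fderiv ℂ f z v := by
  have h1 : HasFDerivAt (fun z => herm w z) (hermL w) z := by
    have : (fun z => herm w z) = hermL w := funext fun z => (hermL_apply w z).symm
    rw [this]; exact (hermL w).hasFDerivAt
  rw [(h1.fun_mul (hf z).hasFDerivAt).fderiv]
  simp only [_root_.add_apply, _root_.smul_apply, hermL_apply, smul_eq_mul]
  ring

/-- The canonical commutation relation in weak form. -/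
theorem gip_herm_mul_herm_mul {f : (V → ℂ) → ℂ} (hf : Nice f) (w v : V → ℂ) :
    gip (fun z => herm w z * f z) (fun z => herm v z * f z) =
      herm v w * gip f f + gip (fun z => fderiv ℂ f z v) (fun z => fderiv ℂ f z w) := by
  rw [← gip_fderiv_left (hf.herm_mul w) hf v]
  have h1 : (fun z => fderiv ℂ (fun z => herm w z * f z) z v) =
      fun z => herm w v * f z + herm w z * fderiv ℂ f z v :=
    funext fun z => fderiv_herm_mul hf.1 w v z
  rw [h1, gip_add_left hf (g := fun z => herm w v * f z) (hf.const_smul _)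
      ((hf.fderiv v).herm_mul w), gip_const_mul_left,
    conj_herm, ← conj_gip f (fun z => herm w z * fderiv ℂ f z v), ← gip_fderiv_left hf (hf.fderiv v),
    conj_gip]

theorem herm_sub_I_smul (v w z : V → ℂ) : herm (v - I • w) z = herm v z + I * herm w z := by
  rw [sub_eq_add_neg, ← neg_smul, herm_add_left, herm_smul_left]
  simp

theorem herm_add_I_smul (v w z : V → ℂ) : herm (v + I • w) z = herm v z - I * herm w z := by
  rw [herm_add_left, herm_smul_left, conj_I]
  ring

theorem nsq_add_I_smul (v w : V → ℂ) :
    nsq (v + I • w) = nsq v + nsq w - 2 * (herm v w).im := by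
  rw [nsq_add, nsq_smul, herm_smul_right, norm_I, I_mul_re]
  ring

/-- The lower bound for two real linear forms given by their commutator. -/
theorem pair_bound {f : (V → ℂ) → ℂ} (hf : Nice f) (v w : V → ℂ) :
    (nsq v + nsq w - 2 * (herm v w).im) / 4 * weightedForm (fun _ => 1) f ≤
      weightedForm (fun z => (herm v z).re ^ 2 + (herm w z).re ^ 2) f := by
  set a := v - I • w with ha
  set b := v + I • w with hb
  have hA := hf.herm_mul a
  have hB := hf.herm_mul b
  have hD := hf.fderiv b
  have hBA := hA.herm_mul b
  -- This function is 2(A + iB)f, where A = (⟨v,z⟩ + ∂_v)/2 and B = (⟨w,z⟩ + ∂_w)/2 are the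
  -- self-adjoint operators of the two linear forms. The bound is the positivity of its norm: the
  -- cross terms are the commutator, and the diagonal terms are the two squares up to the constants
  -- due to antiwick ordering.
  have hS : Nice (fun z => herm a z * f z + fderiv ℂ f z b) := hA.add hD
  have h1 : gip (fun z => herm a z * f z + fderiv ℂ f z b)
      (fun z => herm a z * f z + fderiv ℂ f z b) =
      gip (fun z => herm a z * f z) (fun z => herm a z * f z) +
      gip (fun z => herm b z * f z) (fun z => herm b z * f z) +
      gip f (fun z => herm b z * (herm a z * f z)) +
      gip (fun z => herm b z * (herm a z * f z)) f - nsq b * gip f f := by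
    rw [gip_add_left hS hA hD, gip_add_right hA hA hD, gip_add_right hD hA hD,
      gip_fderiv_left hf hA, ← conj_gip (fun z => fderiv ℂ f z b) (fun z => herm a z * f z),
      gip_fderiv_left hf hA, conj_gip, gip_herm_mul_herm_mul hf b b, herm_self]
    ring
  have h2 : (weightedForm (fun z => (herm v z).re ^ 2 + (herm w z).re ^ 2) f : ℂ) =
      (gip (fun z => herm a z * f z) (fun z => herm a z * f z) +
      gip (fun z => herm b z * f z) (fun z => herm b z * f z) +
      gip f (fun z => herm b z * (herm a z * f z)) +
      gip (fun z => herm b z * (herm a z * f z)) f) / 4 := by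
    have i1 := hA.integrable_conj_mul hA
    have i2 := hB.integrable_conj_mul hB
    have i3 := hf.integrable_conj_mul hBA
    have i4 := hBA.integrable_conj_mul hf
    simp only [gip]
    rw [← integral_add i1 i2]
    have i12 : Integrable fun z => conj (herm a z * f z) * (herm a z * f z) * gw z +
      conj (herm b z * f z) * (herm b z * f z) * gw z := i1.add i2
    rw [← integral_add i12 i3]
    have i123 : Integrable fun z => conj (herm a z * f z) * (herm a z * f z) * gw z +
      conj (herm b z * f z) * (herm b z * f z) * gw z +
      conj (f z) * (herm b z * (herm a z * f z)) * gw z := i12.add i3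
    rw [← integral_add i123 i4, ← integral_div, ← integral_conj_mul_real_mul]
    refine integral_congr_ae (Filter.Eventually.of_forall fun z => ?_)
    simp only
    rw [ofReal_add, re_sq_eq, re_sq_eq, ha, hb, herm_sub_I_smul, herm_add_I_smul]
    simp only [map_mul, map_add, map_sub, conj_I]
    linear_combination ((1 / 2) * conj (f z) * f z * gw z *
      (conj (herm w z) * herm w z + (herm w z) ^ 2 / 2 + conj (herm w z) ^ 2 / 2)) * I_sq
  have h3 : 0 ≤ weightedForm (fun _ => 1) (fun z => herm a z * f z + fderiv ℂ f z b) :=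
    weightedForm_nonneg (fun _ => zero_le_one) _
  rw [gip_self] at h1
  have h4 : ((weightedForm (fun _ => 1) (fun z => herm a z * f z + fderiv ℂ f z b) : ℝ) : ℂ) =
      ((4 * weightedForm (fun z => (herm v z).re ^ 2 + (herm w z).re ^ 2) f -
        nsq b * weightedForm (fun _ => 1) f : ℝ) : ℂ) := by
    rw [h1, gip_self f]
    push_cast
    rw [h2]
    ring
  have h5 := ofReal_injective h4
  rw [hb, nsq_add_I_smul] at h5
  linarith

theorem herm_sum_smul_left {κ : Type*} [Fintype κ] (a : κ → ℝ) (y : κ → V → ℂ) (z : V → ℂ) :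
    herm (∑ k, (a k : ℂ) • y k) z = ∑ k, (a k : ℂ) * herm (y k) z := by
  simp only [herm, Finset.sum_apply, Pi.smul_apply, smul_eq_mul, map_sum, map_mul, conj_ofReal,
    Finset.sum_mul, Finset.mul_sum]
  rw [Finset.sum_comm]
  simp only [mul_assoc]

theorem im_herm_comm (a b : V → ℂ) : (herm a b).im = -(herm b a).im := by
  rw [← conj_herm b a, conj_im]

section Orthogonal

variable {κ : Type*} [Fintype κ] [DecidableEq κ] {W : Matrix κ κ ℝ}

theorem sum_sq_mulVec (hW : Wᵀ * W = 1) (t : κ → ℝ) :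
    ∑ j, (∑ k, W j k * t k) ^ 2 = ∑ k, t k ^ 2 := by
  have h : (W *ᵥ t) ⬝ᵥ (W *ᵥ t) = t ⬝ᵥ t := by
    rw [Matrix.dotProduct_mulVec, Matrix.vecMul_mulVec, hW, Matrix.vecMul_one]
  simpa [dotProduct, Matrix.mulVec, sq] using h

theorem sum_nsq_orthogonal (hW : Wᵀ * W = 1) (y : κ → V → ℂ) :
    ∑ j, nsq (∑ k, (W j k : ℂ) • y k) = ∑ k, nsq (y k) := by
  have h : ∀ z : V → ℂ, nsq z = ∑ v, ((z v).re ^ 2 + (z v).im ^ 2) := fun z =>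
    Finset.sum_congr rfl fun v _ => by
      rw [← Complex.normSq_eq_norm_sq, Complex.normSq_apply]; ring
  simp only [h]
  rw [Finset.sum_comm, Finset.sum_comm (s := (Finset.univ : Finset κ))]
  refine Finset.sum_congr rfl fun v _ => ?_
  rw [Finset.sum_add_distrib, Finset.sum_add_distrib]
  have h1 := sum_sq_mulVec hW fun k => (y k v).re
  have h2 := sum_sq_mulVec hW fun k => (y k v).im
  rw [← h1, ← h2]
  simp only [Finset.sum_apply, Pi.smul_apply, smul_eq_mul, re_sum, im_sum, re_ofReal_mul,
    im_ofReal_mul]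

/-- The lower bound of the Melin value given by an orthogonal matrix pairing two families of
linear forms. -/
theorem le_melinValueForm_of_orthogonal (hW : Wᵀ * W = 1) (x y : κ → V → ℂ) :
    (∑ k, nsq (x k) + ∑ k, nsq (y k)) / 4 + (∑ j, ∑ k, W j k * (herm (y k) (x j)).im) / 2 ≤
      melinValueForm (sumSq (Sum.elim x y)) := by
  refine le_melinValueForm _ fun f hf => ?_
  -- A real orthogonal W preserves both the sum of the squares of the forms y and the sum of their
  -- norms; only the commutators with x see it. Hence every W gives a valid bound.
  have h1 := fun j => pair_bound hf (x j) (∑ k, (W j k : ℂ) • y k)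
  have hint : ∀ v : V → ℂ, Integrable (fun z => (herm v z).re ^ 2 * ‖f z‖ ^ 2 * Real.exp (-nsq z)) :=
    fun v => hf.integrable_weight (fun ε hε => by
      have := gr_sumSq (fun _ : Unit => v) hε
      simpa [sumSq] using this) ((continuous_re.comp (continuous_herm v)).pow 2)
  have h2 : weightedForm (sumSq (Sum.elim x y)) f = ∑ j, weightedForm (fun z =>
      (herm (x j) z).re ^ 2 + (herm (∑ k, (W j k : ℂ) • y k) z).re ^ 2) f := by
    simp only [weightedForm]
    rw [← integral_finsetSum]
    · refine integral_congr_ae (Filter.Eventually.of_forall fun z => ?_)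
      simp only
      rw [← Finset.sum_mul, ← Finset.sum_mul, Finset.sum_add_distrib]
      have h3 := sum_sq_mulVec hW fun k => (herm (y k) z).re
      simp only [herm_sum_smul_left, re_sum, re_ofReal_mul, h3]
      simp [sumSq]
    · intro j _
      have := (hint (x j)).add (hint (∑ k, (W j k : ℂ) • y k))
      refine this.congr (Filter.Eventually.of_forall fun z => ?_)
      simp only [Pi.add_apply]
      ring
  rw [h2]
  refine le_trans (le_of_eq ?_) (Finset.sum_le_sum fun j _ => h1 j)
  rw [← Finset.sum_mul]
  congr 1
  rw [← Finset.sum_div, Finset.sum_sub_distrib, Finset.sum_add_distrib, sum_nsq_orthogonal hW,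
    ← Finset.mul_sum]
  have h4 : ∀ j, (herm (x j) (∑ k, (W j k : ℂ) • y k)).im = -∑ k, W j k * (herm (y k) (x j)).im :=
    fun j => by
      rw [im_herm_comm, herm_sum_smul_left]
      simp only [im_sum, im_ofReal_mul]
  simp only [h4, Finset.sum_neg_distrib]
  ring

end Orthogonal

end

noncomputable section

open MeasureTheory Complex ComplexConjugate

variable {V : Type*} [Fintype V]

/-! ### Gaussian trial functions -/

theorem Nice.sum {κ : Type*} {s : Finset κ} {g : κ → (V → ℂ) → ℂ} (hg : ∀ k, Nice (g k)) :
    Nice (fun z => ∑ k ∈ s, g k z) := by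
  classical
  induction s using Finset.induction_on with
  | empty => exact ⟨by simp, 0, by norm_num, 0, fun z => by simp⟩
  | insert a s ha ih =>
    simp only [Finset.sum_insert ha]
    exact (hg a).add ih

theorem gip_sum_right {κ : Type*} [Fintype κ] {f : (V → ℂ) → ℂ} (hf : Nice f)
    {g : κ → (V → ℂ) → ℂ} (hg : ∀ k, Nice (g k)) :
    gip f (fun z => ∑ k, g k z) = ∑ k, gip f (g k) := by
  simp only [gip]
  rw [← integral_finsetSum _ fun k _ => hf.integrable_conj_mul (hg k)]
  refine integral_congr_ae (Filter.Eventually.of_forall fun z => ?_)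
  simp only [Finset.mul_sum, Finset.sum_mul]

theorem gip_sum_left {κ : Type*} [Fintype κ] {f : (V → ℂ) → ℂ} (hf : Nice f)
    {g : κ → (V → ℂ) → ℂ} (hg : ∀ k, Nice (g k)) :
    gip (fun z => ∑ k, g k z) f = ∑ k, gip (g k) f := by
  rw [← conj_gip, gip_sum_right hf hg, map_sum]
  simp only [conj_gip]

theorem weightedForm_re_herm_sq {f : (V → ℂ) → ℂ} (hf : Nice f) (v : V → ℂ) :
    weightedForm (fun z => (herm v z).re ^ 2) f =
      ((gip f (fun z => herm v z * (herm v z * f z))).re +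
        (gip (fun z => herm v z * f z) (fun z => herm v z * f z)).re) / 2 := by
  obtain ⟨hd, a, ha, hfa⟩ := id hf
  have h := integral_re_herm_sq hfa hfa (by linarith) hd.continuous hd.continuous v
  rw [integral_conj_mul_real_mul (fun z => (herm v z).re ^ 2)] at h
  have h1 : ∫ z, conj (f z) * (herm v z ^ 2 * f z) * gw z =
      gip f (fun z => herm v z * (herm v z * f z)) := by
    simp only [gip, sq, mul_assoc]
  have h2 : ∫ z, conj (f z) * (conj (herm v z) ^ 2 * f z) * gw z =
      conj (gip f (fun z => herm v z * (herm v z * f z))) := by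
    rw [conj_gip, gip]
    refine integral_congr_ae (Filter.Eventually.of_forall fun z => ?_)
    simp only [map_mul]
    ring
  have h3 : ∫ z, conj (f z) * (conj (herm v z) * herm v z * f z) * gw z =
      gip (fun z => herm v z * f z) (fun z => herm v z * f z) := by
    rw [gip]
    refine integral_congr_ae (Filter.Eventually.of_forall fun z => ?_)
    simp only [map_mul]
    ring
  rw [h1, h2, h3] at h
  have h4 := congrArg re h
  have h5 : ((4 : ℝ) : ℂ) = 4 := by norm_num
  rw [ofReal_re, ← h5, div_ofReal_re] at h4
  simp only [add_re, conj_re, re_ofNat, im_ofNat, mul_re] at h4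
  linarith

theorem sum_weightedForm {κ : Type*} [Fintype κ] {f : (V → ℂ) → ℂ} (hf : Nice f) (c : κ → V → ℂ) :
    weightedForm (sumSq c) f = ∑ k, weightedForm (fun z => (herm (c k) z).re ^ 2) f := by
  simp only [weightedForm]
  rw [← integral_finsetSum]
  · refine integral_congr_ae (Filter.Eventually.of_forall fun z => ?_)
    simp only [sumSq, Finset.sum_mul]
  · intro k _
    refine hf.integrable_weight (fun ε hε => ?_)
      ((continuous_re.comp (continuous_herm (c k))).pow 2)
    have := gr_sumSq (fun _ : Unit => c k) hε
    simpa [sumSq] using this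

section Trial

variable {κ : Type*} [Fintype κ]

/-- The squeezed Gaussian state with squeezing parameters `b j` in the directions `η j`. -/
def squeezed (η : κ → V → ℂ) (b : κ → ℝ) (z : V → ℂ) : ℂ :=
  exp (∑ j, (b j : ℂ) / 2 * herm (η j) z ^ 2)

variable {η : κ → V → ℂ} {b : κ → ℝ}

theorem herm_eq_sum (hc : ∀ z, ∑ j, herm (η j) z • η j = z) (v z : V → ℂ) :
    herm v z = ∑ j, herm v (η j) * herm (η j) z := by
  conv_lhs => rw [← hc z]
  have : ∀ s : Finset κ, herm v (∑ j ∈ s, herm (η j) z • η j) =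
      ∑ j ∈ s, herm v (η j) * herm (η j) z := fun s => by
    simp only [← hermL_apply, map_sum, map_smul, smul_eq_mul, mul_comm]
  exact this _

theorem hasFDerivAt_squeezed (z : V → ℂ) :
    HasFDerivAt (squeezed η b)
      (squeezed η b z • ∑ j, ((b j : ℂ) * herm (η j) z) • hermL (η j)) z := by
  refine (HasFDerivAt.cexp (f := fun z => ∑ j, (b j : ℂ) / 2 * herm (η j) z ^ 2)
    (HasFDerivAt.fun_sum fun j _ => ?_))
  have h1 : HasFDerivAt (fun z => herm (η j) z) (hermL (η j)) z := by
    have : (fun z => herm (η j) z) = hermL (η j) := funext fun z => (hermL_apply _ z).symm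
    rw [this]; exact (hermL (η j)).hasFDerivAt
  refine ((h1.pow 2).const_mul ((b j : ℂ) / 2)).congr_fderiv ?_
  ext w
  simp only [_root_.smul_apply, smul_eq_mul]
  norm_num
  ring

theorem fderiv_squeezed (z v : V → ℂ) :
    fderiv ℂ (squeezed η b) z v =
      ∑ j, ((b j : ℂ) * herm (η j) v) * (herm (η j) z * squeezed η b z) := by
  rw [(hasFDerivAt_squeezed z).fderiv]
  simp only [_root_.smul_apply, _root_.sum_apply, smul_eq_mul, hermL_apply, Finset.mul_sum]
  exact Finset.sum_congr rfl fun j _ => by ring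

/-- By Parseval for η, the exponent is at most half the largest |b j| times |z|²; finiteness of the
family makes this maximum smaller than 1. -/
theorem nice_squeezed (hc : ∀ z, ∑ j, herm (η j) z • η j = z) (hb : ∀ j, |b j| < 1) :
    Nice (squeezed η b) := by
  obtain ⟨β, hβ0, hβ1, hβ⟩ : ∃ β : ℝ, 0 ≤ β ∧ β < 1 ∧ ∀ j, |b j| ≤ β := by
    rcases isEmpty_or_nonempty κ with h | h
    · exact ⟨0, le_rfl, one_pos, fun j => h.elim j⟩
    · obtain ⟨j, hj⟩ := Finite.exists_max fun j => |b j|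
      exact ⟨|b j|, abs_nonneg _, hb j, hj⟩
  refine ⟨fun z => (hasFDerivAt_squeezed z).differentiableAt, β / 2, by linarith, 1, fun z => ?_⟩
  rw [squeezed, norm_exp, one_mul]
  refine Real.exp_le_exp.2 ((re_le_norm _).trans ((norm_sum_le _ _).trans ?_))
  have h1 : (nsq z : ℂ) = ((∑ j, ‖herm (η j) z‖ ^ 2 : ℝ) : ℂ) := by
    rw [← herm_self, herm_eq_sum hc z z, ofReal_sum]
    refine Finset.sum_congr rfl fun j _ => ?_
    rw [← conj_herm (η j) z, ← normSq_eq_conj_mul_self, normSq_eq_norm_sq]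
  rw [ofReal_injective h1, Finset.mul_sum]
  refine Finset.sum_le_sum fun j _ => ?_
  rw [norm_mul, norm_pow, norm_div, norm_real, Real.norm_eq_abs, norm_ofNat]
  have := hβ j
  gcongr

variable [DecidableEq κ] (hη : ∀ j k, herm (η j) (η k) = if j = k then 1 else 0)
  (hc : ∀ z, ∑ j, herm (η j) z • η j = z) (hb : ∀ j, |b j| < 1)

include hη hc hb

theorem gip_squeezed (j k : κ) :
    gip (fun z => herm (η j) z * squeezed η b z) (fun z => herm (η k) z * squeezed η b z) =
      if j = k then ((1 - b j ^ 2)⁻¹ : ℝ) * gip (squeezed η b) (squeezed η b) else 0 := by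
  have hn := nice_squeezed hc hb
  have hd : ∀ k, (fun z => fderiv ℂ (squeezed η b) z (η k)) =
      fun z => (b k : ℂ) * (herm (η k) z * squeezed η b z) := fun k => by
    ext z
    rw [fderiv_squeezed, Finset.sum_eq_single k]
    · rw [hη]; simp
    · intro j _ hj
      rw [hη]; simp [hj]
    · simp
  -- The derivative along η k multiplies the squeezed state by b k⟨η k,z⟩, so the commutation
  -- relation becomes the closed system G_jk = δ_jk‖f‖² + b_j b_k G_kj. No Gaussian integral has to
  -- be computed; for j ≠ k the system is used twice.
  have hG : ∀ j k, gip (fun z => herm (η j) z * squeezed η b z)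
      (fun z => herm (η k) z * squeezed η b z) =
      (if k = j then 1 else 0) * gip (squeezed η b) (squeezed η b) + b k * (b j *
      gip (fun z => herm (η k) z * squeezed η b z) (fun z => herm (η j) z * squeezed η b z)) :=
    fun j k => by
      rw [gip_herm_mul_herm_mul hn, hd, hd, gip_const_mul_left, gip_const_mul_right, hη,
        conj_ofReal]
  have hbj : b j ^ 2 < 1 := by rw [← sq_abs]; have := hb j; have := abs_nonneg (b j); nlinarith
  have hbk : b k ^ 2 < 1 := by rw [← sq_abs]; have := hb k; have := abs_nonneg (b k); nlinarith
  have h1 := hG j k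
  have h2 := hG k j
  split_ifs with h
  · subst h
    rw [if_pos rfl] at h1
    have h3 : ((1 - b j ^ 2 : ℝ) : ℂ) ≠ 0 := by exact_mod_cast (by linarith : (1 - b j ^ 2) ≠ 0)
    rw [ofReal_inv, eq_inv_mul_iff_mul_eq₀ h3]
    push_cast
    linear_combination h1
  · rw [if_neg (fun h' => h h'.symm)] at h1
    rw [if_neg h] at h2
    have h3 : ((1 - b j ^ 2 * b k ^ 2 : ℝ) : ℂ) ≠ 0 := by
      have : 1 - b j ^ 2 * b k ^ 2 ≠ 0 := by nlinarith [sq_nonneg (b j), sq_nonneg (b k)]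
      exact_mod_cast this
    refine (mul_eq_zero.1 (?_ : ((1 - b j ^ 2 * b k ^ 2 : ℝ) : ℂ) * _ = 0)).resolve_left h3
    push_cast
    linear_combination h1 + (b j : ℂ) * b k * h2

/-- The real coordinates along η j and iη j are uncorrelated, with variances 1/(2(1 - b j)) and
1/(2(1 + b j)): one is stretched and the other compressed, and both are 1/2 without squeezing. -/
theorem weightedForm_squeezed (v : V → ℂ) :
    weightedForm (fun z => (herm v z).re ^ 2) (squeezed η b) =
      (∑ j, ((herm v (η j)).re ^ 2 / (2 * (1 - b j)) +
        (herm v (I • η j)).re ^ 2 / (2 * (1 + b j)))) *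
        weightedForm (fun _ => 1) (squeezed η b) := by
  have hn := nice_squeezed hc hb
  set f := squeezed η b with hf
  have hG := gip_squeezed hη hc hb
  have hw : ∀ j, Nice (fun z => herm v (η j) * (herm (η j) z * f z)) := fun j =>
    (hn.herm_mul (η j)).const_smul _
  have hw' : ∀ j, Nice (fun z => ((b j : ℂ) * herm (η j) v) * (herm (η j) z * f z)) := fun j =>
    (hn.herm_mul (η j)).const_smul _
  have e1 : (fun z => herm v z * f z) = fun z => ∑ j, herm v (η j) * (herm (η j) z * f z) := by
    ext z
    rw [herm_eq_sum hc v z, Finset.sum_mul]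
    simp only [mul_assoc]
  have h1 : gip (fun z => herm v z * f z) (fun z => herm v z * f z) =
      (∑ j, conj (herm v (η j)) * herm v (η j) * ((1 - b j ^ 2)⁻¹ : ℝ)) * gip f f := by
    rw [e1, gip_sum_left (Nice.sum hw) hw, Finset.sum_mul]
    refine Finset.sum_congr rfl fun j _ => ?_
    rw [gip_sum_right (hw j) hw, Finset.sum_eq_single j]
    · rw [gip_const_mul_left, gip_const_mul_right, hG, if_pos rfl]; ring
    · intro k _ hk
      rw [gip_const_mul_left, gip_const_mul_right, hG, if_neg hk.symm]; ring
    · simp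
  have h2 : gip f (fun z => herm v z * (herm v z * f z)) =
      (∑ j, (b j : ℂ) * herm v (η j) ^ 2 * ((1 - b j ^ 2)⁻¹ : ℝ)) * gip f f := by
    rw [← gip_fderiv_left hn (hn.herm_mul v)]
    have e2 : (fun z => fderiv ℂ f z v) =
        fun z => ∑ j, ((b j : ℂ) * herm (η j) v) * (herm (η j) z * f z) :=
      funext fun z => fderiv_squeezed z v
    rw [e1, e2, gip_sum_left (Nice.sum hw) hw', Finset.sum_mul]
    refine Finset.sum_congr rfl fun j _ => ?_
    rw [gip_sum_right (hw' j) hw, Finset.sum_eq_single j]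
    · rw [gip_const_mul_left, gip_const_mul_right, hG, if_pos rfl, map_mul, conj_herm, conj_ofReal]
      ring
    · intro k _ hk
      rw [gip_const_mul_left, gip_const_mul_right, hG, if_neg hk.symm]; ring
    · simp
  rw [weightedForm_re_herm_sq hn, h1, h2, gip_self, re_mul_ofReal, re_mul_ofReal, ← add_mul,
    ← add_re, ← Finset.sum_add_distrib, mul_div_right_comm]
  congr 1
  rw [re_sum, Finset.sum_div]
  refine Finset.sum_congr rfl fun j _ => ?_
  have hb1 := abs_lt.1 (hb j)
  have hb2 : 1 - b j ≠ 0 := by linarith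
  have hb3 : 1 + b j ≠ 0 := by linarith
  have hb4 : (1 - b j ^ 2) = (1 - b j) * (1 + b j) := by ring
  rw [herm_smul_right, I_mul_re, add_re, re_mul_ofReal, re_mul_ofReal, re_ofReal_mul, hb4,
    ← normSq_eq_conj_mul_self, ofReal_re, normSq_apply, sq (herm v (η j)), mul_re]
  field_simp
  ring

/-- With α = Q(η j) and β = Q(iη j) both positive, the best parameter satisfies (1 - b)/(1 + b) =
√(α/β) and the term becomes (√α + √β)²/4. For β = 0 this value α/4 is only approached, as b tends to
-1. -/
theorem melinValueForm_le_of_squeezed {ι : Type*} [Fintype ι] (c : ι → V → ℂ) :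
    melinValueForm (sumSq c) ≤ ∑ j, (sumSq c (η j) / (2 * (1 - b j)) +
      sumSq c (I • η j) / (2 * (1 + b j))) := by
  have hn := nice_squeezed hc hb
  refine melinValueForm_le c hn (weightedForm_one_pos hn (exp_ne_zero _)) (le_of_eq ?_)
  rw [sum_weightedForm hn]
  simp only [weightedForm_squeezed hη hc hb]
  rw [← Finset.sum_mul, Finset.sum_comm]
  congr 1
  refine Finset.sum_congr rfl fun j _ => ?_
  rw [Finset.sum_add_distrib, sumSq, sumSq, Finset.sum_div, Finset.sum_div]

end Trial

end

noncomputable section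

/-! ### Loops of triangles -/

/-- The three edges of a triangle. -/
def triangleEdges (n : ℕ) (i : ZMod n) : Finset (Sym2 (LoopSite n)) :=
  {s(Sum.inl i, Sum.inl (i + 1)), s(Sum.inl i, Sum.inr i), s(Sum.inl (i + 1), Sum.inr i)}

/-- The sum of the vectors of a triangle. -/
def triSum {n : ℕ} {E : Type*} [Add E] (e : LoopSite n → E) (i : ZMod n) : E :=
  e (Sum.inl i) + e (Sum.inl (i + 1)) + e (Sum.inr i)

/-- The edges of the loop are those of its triangles, without repetition. -/
structure EdgesOfTriangles (n : ℕ) [NeZero n] : Prop where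
  adj : ∀ u v, (triangleLoop n).Adj u v ↔ s(u, v) ∈ Finset.univ.biUnion (triangleEdges n)
  disjoint : ∀ i ∈ (Finset.univ : Finset (ZMod n)), ∀ j ∈ (Finset.univ : Finset (ZMod n)), i ≠ j →
    Disjoint (triangleEdges n i) (triangleEdges n j)
  succ_ne : ∀ i : ZMod n, i + 1 ≠ i

theorem edgesOfTriangles_four : EdgesOfTriangles 4 := ⟨by decide, by decide, by decide⟩

set_option maxRecDepth 4000 in
theorem edgesOfTriangles_six : EdgesOfTriangles 6 := ⟨by decide, by decide, by decide⟩

theorem norm_sq_triSum {n : ℕ} (e : Config (LoopSite n)) (he : e ∈ spinSpace (LoopSite n)) (i : ZMod n) :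
    ‖triSum e i‖ ^ 2 = 3 + 2 * (inner ℝ (e (Sum.inl i)) (e (Sum.inl (i + 1))) +
      inner ℝ (e (Sum.inl i)) (e (Sum.inr i)) + inner ℝ (e (Sum.inl (i + 1))) (e (Sum.inr i))) := by
  rw [triSum, norm_add_sq_real, norm_add_sq_real, inner_add_left, he, he, he]
  ring

section Loop

variable {n : ℕ} [NeZero n]

theorem heisenberg_eq (hn : EdgesOfTriangles n) (e : Config (LoopSite n)) :
    heisenberg (triangleLoop n) e = ∑ i : ZMod n,
      (inner ℝ (e (Sum.inl i)) (e (Sum.inl (i + 1))) + inner ℝ (e (Sum.inl i)) (e (Sum.inr i)) +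
        inner ℝ (e (Sum.inl (i + 1))) (e (Sum.inr i))) := by
  have h : (triangleLoop n).edgeFinset = Finset.univ.biUnion (triangleEdges n) := by
    ext b
    induction b with
    | _ u v => rw [SimpleGraph.mem_edgeFinset, SimpleGraph.mem_edgeSet, hn.adj]
  rw [heisenberg, h, Finset.sum_biUnion (by
    intro i hi j hj hij; exact hn.disjoint i (Finset.mem_univ _) j (Finset.mem_univ _) hij)]
  refine Finset.sum_congr rfl fun i _ => ?_
  have h1 := hn.succ_ne i
  rw [triangleEdges, Finset.sum_insert, Finset.sum_insert, Finset.sum_singleton]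
  · simp only [Sym2.lift_mk]
    ring
  · simp [h1.symm]
  · simp [h1.symm]

/-- Completing the square in each triangle, whose three vectors have norm 1. -/
theorem heisenberg_eq_of_mem (hn : EdgesOfTriangles n) {e : Config (LoopSite n)}
    (he : e ∈ spinSpace (LoopSite n)) :
    heisenberg (triangleLoop n) e = ∑ i : ZMod n, (‖triSum e i‖ ^ 2 - 3) / 2 := by
  rw [heisenberg_eq hn]
  refine Finset.sum_congr rfl fun i _ => ?_
  rw [norm_sq_triSum e he]
  ring

/-- The configuration f shows that the bound -3/2 per triangle is attained simultaneously in all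
triangles, so minimality forces every square to vanish. -/
theorem mem_minimalSet_iff (hn : EdgesOfTriangles n) {f : Config (LoopSite n)}
    (hf : f ∈ spinSpace (LoopSite n)) (hf0 : ∀ i, triSum f i = 0) (e : Config (LoopSite n)) :
    e ∈ minimalSet (heisenberg (triangleLoop n)) ↔
      e ∈ spinSpace (LoopSite n) ∧ ∀ i, triSum e i = 0 := by
  have key : ∀ g ∈ spinSpace (LoopSite n), (∀ i, triSum g i = 0) →
      heisenberg (triangleLoop n) g = ∑ i : ZMod n, (-3 / 2 : ℝ) := fun g hg hg0 => by
    rw [heisenberg_eq_of_mem hn hg]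
    exact Finset.sum_congr rfl fun i _ => by rw [hg0]; norm_num
  constructor
  · rintro ⟨he, hmin⟩
    refine ⟨he, ?_⟩
    have h1 := hmin f hf
    rw [key f hf hf0, heisenberg_eq_of_mem hn he] at h1
    have h2 : ∑ i : ZMod n, ‖triSum e i‖ ^ 2 / 2 ≤ 0 := by
      have : ∑ i : ZMod n, (‖triSum e i‖ ^ 2 - 3) / 2 =
          ∑ i : ZMod n, ‖triSum e i‖ ^ 2 / 2 + ∑ i : ZMod n, (-3 / 2 : ℝ) := by
        rw [← Finset.sum_add_distrib]
        exact Finset.sum_congr rfl fun i _ => by ring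
      linarith
    have h3 := (Finset.sum_eq_zero_iff_of_nonneg fun i _ => by positivity).1
      (le_antisymm h2 (Finset.sum_nonneg fun i _ => by positivity))
    intro i
    have := h3 i (Finset.mem_univ i)
    simpa using this
  · rintro ⟨he, he0⟩
    refine ⟨he, fun g hg => ?_⟩
    rw [key e he he0, heisenberg_eq_of_mem hn hg]
    exact Finset.sum_le_sum fun i _ => by have := sq_nonneg ‖triSum g i‖; linarith

end Loop

/-! ### The cross product and the tangent frames -/

theorem inner_r3 (x y : R3) : inner ℝ x y = x 0 * y 0 + x 1 * y 1 + x 2 * y 2 := by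
  simp [PiLp.inner_apply, Fin.sum_univ_three]
  ring

theorem norm_sq_r3 (x : R3) : ‖x‖ ^ 2 = x 0 ^ 2 + x 1 ^ 2 + x 2 ^ 2 := by
  rw [← real_inner_self_eq_norm_sq, inner_r3]
  ring

theorem cross_eq_vec (x y : R3) : cross x y = !₂[x 1 * y 2 - x 2 * y 1, x 2 * y 0 - x 0 * y 2,
    x 0 * y 1 - x 1 * y 0] := by
  simp [cross, crossProduct]

theorem r3_ext {x y : R3} (h0 : x 0 = y 0) (h1 : x 1 = y 1) (h2 : x 2 = y 2) : x = y := by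
  ext i
  fin_cases i
  · exact h0
  · exact h1
  · exact h2

theorem cross_zero_apply (x y : R3) : cross x y 0 = x 1 * y 2 - x 2 * y 1 := by
  rw [cross_eq_vec]; simp
theorem cross_one_apply (x y : R3) : cross x y 1 = x 2 * y 0 - x 0 * y 2 := by
  rw [cross_eq_vec]; simp
theorem cross_two_apply (x y : R3) : cross x y 2 = x 0 * y 1 - x 1 * y 0 := by
  rw [cross_eq_vec]; simp

theorem inner_self_cross (x y : R3) : inner ℝ x (cross x y) = 0 := by
  rw [inner_r3, cross_zero_apply, cross_one_apply, cross_two_apply]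
  ring

theorem inner_cross_cross (x y z w : R3) : inner ℝ (cross x y) (cross z w) =
    inner ℝ x z * inner ℝ y w - inner ℝ x w * inner ℝ y z := by
  simp only [inner_r3, cross_zero_apply, cross_one_apply, cross_two_apply]
  ring

theorem cross_cross_eq (x y z : R3) : cross x (cross y z) =
    inner ℝ x z • y - inner ℝ x y • z := by
  refine r3_ext ?_ ?_ ?_ <;>
  simp only [inner_r3, cross_zero_apply, cross_one_apply, cross_two_apply, PiLp.sub_apply,
    PiLp.smul_apply, smul_eq_mul] <;>
  ring

theorem norm_unitPerp (e : R3) : ‖unitPerp e‖ = 1 := (exists_unit_perp e).choose_spec.1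

theorem inner_unitPerp (e : R3) : inner ℝ e (unitPerp e) = 0 := (exists_unit_perp e).choose_spec.2

theorem norm_cross_unitPerp {e : R3} (he : ‖e‖ = 1) : ‖cross e (unitPerp e)‖ = 1 := by
  have h : ‖cross e (unitPerp e)‖ ^ 2 = 1 := by
    rw [← real_inner_self_eq_norm_sq, inner_cross_cross, real_inner_self_eq_norm_sq,
      real_inner_self_eq_norm_sq, he, norm_unitPerp, inner_unitPerp]
    norm_num
  exact (pow_eq_one_iff_of_nonneg (norm_nonneg _) two_ne_zero).1 h

theorem inner_tangentFrame (e : R3) (z : ℂ) : inner ℝ e (tangentFrame e z) = 0 := by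
  rw [tangentFrame, inner_smul_right, inner_add_right, inner_smul_right, inner_smul_right,
    inner_unitPerp, inner_self_cross]
  ring

theorem tangentFrame_real_smul (e : R3) (t : ℝ) (z : ℂ) :
    tangentFrame e (t • z) = t • tangentFrame e z := by
  simp only [tangentFrame, Complex.real_smul, Complex.re_ofReal_mul, Complex.im_ofReal_mul]
  module

/-- Since cos and sinc are even, the absolute value in ‖tξ‖ disappears and the curve is visibly
smooth in t. For ξ = 0 the division by zero is harmless, as it multiplies ξ. -/
theorem sphereExp_smul (e ξ : R3) (t : ℝ) : sphereExp e (t • ξ) =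
    Real.cos (‖ξ‖ * t) • e + (Real.sin (‖ξ‖ * t) / ‖ξ‖) • ξ := by
  rw [sphereExp, norm_smul, Real.norm_eq_abs]
  rcases eq_or_ne ξ 0 with h | h
  · subst h; simp
  have hk : ‖ξ‖ ≠ 0 := norm_ne_zero_iff.2 h
  rcases eq_or_ne t 0 with ht | ht
  · subst ht; simp
  have h1 : Real.cos (|t| * ‖ξ‖) = Real.cos (‖ξ‖ * t) := by
    rw [← Real.cos_abs (‖ξ‖ * t), abs_mul, abs_norm, mul_comm]
  have h2 : Real.sinc (|t| * ‖ξ‖) = Real.sinc (‖ξ‖ * t) := by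
    rcases abs_choice t with h | h <;> rw [h]
    · rw [mul_comm]
    · rw [neg_mul, Real.sinc_neg, mul_comm]
  rw [h1, h2, Real.sinc_of_ne_zero (mul_ne_zero hk ht), smul_smul]
  congr 2
  field_simp

theorem norm_sphereExp {e ξ : R3} (he : ‖e‖ = 1) (h : inner ℝ e ξ = 0) : ‖sphereExp e ξ‖ = 1 := by
  have h1 : ‖sphereExp e ξ‖ ^ 2 = 1 := by
    rw [sphereExp, norm_add_sq_real, norm_smul, norm_smul, inner_smul_left, inner_smul_right, h, he,
      mul_pow, mul_pow, Real.norm_eq_abs, Real.norm_eq_abs, sq_abs, sq_abs]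
    have h2 : Real.sinc ‖ξ‖ * ‖ξ‖ = Real.sin ‖ξ‖ := by
      rcases eq_or_ne ‖ξ‖ 0 with h0 | h0
      · rw [h0]; simp
      · rw [Real.sinc_of_ne_zero h0, div_mul_cancel₀ _ h0]
    have h3 : Real.sinc ‖ξ‖ ^ 2 * ‖ξ‖ ^ 2 = Real.sin ‖ξ‖ ^ 2 := by rw [← mul_pow, h2]
    rw [h3]
    have := Real.sin_sq_add_cos_sq ‖ξ‖
    simp only [mul_zero, one_pow, mul_one]
    linarith
  exact (pow_eq_one_iff_of_nonneg (norm_nonneg _) two_ne_zero).1 h1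

theorem normalMap_mem_spinSpace {V : Type*} {e : Config V} (he : e ∈ spinSpace V) (z : V → ℂ) :
    normalMap e z ∈ spinSpace V :=
  fun v => norm_sphereExp (he v) (inner_tangentFrame _ _)

theorem hasDerivAt_sphereExp (e ξ : R3) (t : ℝ) :
    HasDerivAt (fun t : ℝ => sphereExp e (t • ξ))
      ((-Real.sin (‖ξ‖ * t) * ‖ξ‖) • e + Real.cos (‖ξ‖ * t) • ξ) t := by
  simp only [sphereExp_smul]
  have h0 : HasDerivAt (fun t : ℝ => ‖ξ‖ * t) ‖ξ‖ t := by
    simpa using (hasDerivAt_id t).const_mul ‖ξ‖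
  have h1 := (h0.cos.smul_const e).add ((h0.sin.div_const ‖ξ‖).smul_const ξ)
  refine h1.congr_deriv ?_
  rcases eq_or_ne ξ 0 with h | h
  · subst h; simp
  · rw [mul_div_assoc, div_self (norm_ne_zero_iff.2 h), mul_one]

theorem hasDerivAt_deriv_sphereExp (e ξ : R3) (t : ℝ) :
    HasDerivAt (fun t : ℝ => (-Real.sin (‖ξ‖ * t) * ‖ξ‖) • e + Real.cos (‖ξ‖ * t) • ξ)
      ((-(Real.cos (‖ξ‖ * t) * ‖ξ‖) * ‖ξ‖) • e + (-Real.sin (‖ξ‖ * t) * ‖ξ‖) • ξ) t := by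
  have h0 : HasDerivAt (fun t : ℝ => ‖ξ‖ * t) ‖ξ‖ t := by
    simpa using (hasDerivAt_id t).const_mul ‖ξ‖
  exact ((h0.sin.neg.mul_const ‖ξ‖).smul_const e).add (h0.cos.smul_const ξ)

/-- The sums over the triangles vanish at e, so the accelerations drop out of the second derivative
of |S_i|²/2 and only the squared velocities remain. -/
theorem halfHessian_eq {n : ℕ} [NeZero n] (hn : EdgesOfTriangles n) {e : Config (LoopSite n)}
    (he : e ∈ spinSpace (LoopSite n)) (he0 : ∀ i, triSum e i = 0) (z : LoopSite n → ℂ) :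
    halfHessian (heisenberg (triangleLoop n)) e z =
      ∑ i : ZMod n, ‖triSum (fun v => tangentFrame (e v) (z v)) i‖ ^ 2 / 2 := by
  set ξ : Config (LoopSite n) := fun v => tangentFrame (e v) (z v) with hξ
  set c : ℝ → Config (LoopSite n) := fun t v => sphereExp (e v) (t • ξ v) with hc
  set c' : ℝ → Config (LoopSite n) := fun t v =>
    (-Real.sin (‖ξ v‖ * t) * ‖ξ v‖) • e v + Real.cos (‖ξ v‖ * t) • ξ v with hc'
  set c'' : ℝ → Config (LoopSite n) := fun t v =>
    (-(Real.cos (‖ξ v‖ * t) * ‖ξ v‖) * ‖ξ v‖) • e v + (-Real.sin (‖ξ v‖ * t) * ‖ξ v‖) • ξ v with hc''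
  have hS : ∀ i t, HasDerivAt (fun t => triSum (c t) i) (triSum (c' t) i) t := fun i t =>
    ((hasDerivAt_sphereExp _ _ t).add (hasDerivAt_sphereExp _ _ t)).add (hasDerivAt_sphereExp _ _ t)
  have hS' : ∀ i t, HasDerivAt (fun t => triSum (c' t) i) (triSum (c'' t) i) t := fun i t =>
    ((hasDerivAt_deriv_sphereExp _ _ t).add (hasDerivAt_deriv_sphereExp _ _ t)).add
      (hasDerivAt_deriv_sphereExp _ _ t)
  have hg : (fun t : ℝ => heisenberg (triangleLoop n) (normalMap e (t • z))) =
      fun t => ∑ i : ZMod n, (‖triSum (c t) i‖ ^ 2 - 3) / 2 := by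
    ext t
    have h1 : normalMap e (t • z) = c t := by
      ext1 v
      simp only [normalMap, Pi.smul_apply, tangentFrame_real_smul, hc, hξ]
    rw [heisenberg_eq_of_mem hn (normalMap_mem_spinSpace he _), h1]
  have hd : deriv (fun t => ∑ i : ZMod n, (‖triSum (c t) i‖ ^ 2 - 3) / 2) =
      fun t => ∑ i : ZMod n, inner ℝ (triSum (c t) i) (triSum (c' t) i) := by
    ext t
    refine HasDerivAt.deriv (HasDerivAt.fun_sum fun i _ => ?_)
    exact (((hS i t).norm_sq.sub_const 3).div_const 2).congr_deriv (by ring)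
  have hd2 : HasDerivAt (fun t => ∑ i : ZMod n, inner ℝ (triSum (c t) i) (triSum (c' t) i))
      (∑ i : ZMod n, (inner ℝ (triSum (c 0) i) (triSum (c'' 0) i) +
        inner ℝ (triSum (c' 0) i) (triSum (c' 0) i))) 0 :=
    HasDerivAt.fun_sum fun i _ => (hS i 0).inner ℝ (hS' i 0)
  have e1 : c 0 = e := by ext1 v; simp [hc, sphereExp]
  have e2 : c' 0 = ξ := by ext1 v; simp [hc']
  rw [halfHessian, hg, iteratedDeriv_succ, iteratedDeriv_one, hd, hd2.deriv, e1, e2, Finset.sum_div]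
  refine Finset.sum_congr rfl fun i _ => ?_
  rw [he0, inner_zero_left, zero_add, real_inner_self_eq_norm_sq]

end

noncomputable section

/-! ### Rotations -/

/-- The action of a rotation on a vector. -/
def rot (R : SO3) : R3 →ₗ[ℝ] R3 := Matrix.toLpLin 2 2 (R : Matrix (Fin 3) (Fin 3) ℝ)

theorem rotate_apply {V : Type*} (R : SO3) (e : Config V) (v : V) : rotate R e v = rot R (e v) :=
  rfl

theorem rot_apply (R : SO3) (x : R3) (i : Fin 3) : rot R x i =
    (R : Matrix (Fin 3) (Fin 3) ℝ) i 0 * x 0 + (R : Matrix (Fin 3) (Fin 3) ℝ) i 1 * x 1 +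
      (R : Matrix (Fin 3) (Fin 3) ℝ) i 2 * x 2 := by
  simp [rot, Matrix.toLpLin_apply, Matrix.mulVec, dotProduct, Fin.sum_univ_three]

theorem rot_mul (R S : SO3) (x : R3) : rot (R * S) x = rot R (rot S x) := by
  simp [rot]

theorem rot_one (x : R3) : rot 1 x = x := by
  simp [rot]

theorem rot_rot_inv (R : SO3) (x : R3) : rot R (rot R⁻¹ x) = x := by
  rw [← rot_mul, mul_inv_cancel, rot_one]

theorem rot_inv_rot (R : SO3) (x : R3) : rot R⁻¹ (rot R x) = x := by
  rw [← rot_mul, inv_mul_cancel, rot_one]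

theorem inner_rot (R : SO3) (x y : R3) : inner ℝ (rot R x) (rot R y) = inner ℝ x y := by
  have h := (Matrix.mem_specialOrthogonalGroup_iff.1 R.2).1
  rw [Matrix.mem_orthogonalGroup_iff'] at h
  have h' : ∀ i j, ((R : Matrix (Fin 3) (Fin 3) ℝ)ᵀ * R) i j =
      (1 : Matrix (Fin 3) (Fin 3) ℝ) i j := fun i j => congrFun (congrFun h i) j
  have h00 := h' 0 0
  have h01 := h' 0 1
  have h02 := h' 0 2
  have h11 := h' 1 1
  have h12 := h' 1 2
  have h22 := h' 2 2
  simp only [Matrix.mul_apply, Fin.sum_univ_three, Matrix.transpose_apply, Matrix.one_apply_eq] at h00 h01 h02 h11 h12 h22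
  rw [Matrix.one_apply_ne (by decide)] at h01 h02 h12
  simp only [inner_r3, rot_apply]
  linear_combination x 0 * y 0 * h00 + (x 0 * y 1 + x 1 * y 0) * h01 +
    (x 0 * y 2 + x 2 * y 0) * h02 + x 1 * y 1 * h11 + (x 1 * y 2 + x 2 * y 1) * h12 +
    x 2 * y 2 * h22

theorem norm_rot (R : SO3) (x : R3) : ‖rot R x‖ = ‖x‖ := by
  rw [← sq_eq_sq₀ (norm_nonneg _) (norm_nonneg _), ← real_inner_self_eq_norm_sq,
    ← real_inner_self_eq_norm_sq, inner_rot]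

theorem inner_rot_cross_rot (R : SO3) (x y z : R3) :
    inner ℝ (rot R x) (cross (rot R y) (rot R z)) = inner ℝ x (cross y z) := by
  have h := (Matrix.mem_specialOrthogonalGroup_iff.1 R.2).2
  rw [Matrix.det_fin_three] at h
  simp only [inner_r3, rot_apply, cross_zero_apply, cross_one_apply, cross_two_apply]
  linear_combination (x 0 * (y 1 * z 2 - y 2 * z 1) + x 1 * (y 2 * z 0 - y 0 * z 2) +
    x 2 * (y 0 * z 1 - y 1 * z 0)) * h

theorem cross_rot (R : SO3) (x y : R3) : cross (rot R x) (rot R y) = rot R (cross x y) := by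
  refine ext_inner_left ℝ fun v => ?_
  rw [← rot_rot_inv R v, inner_rot_cross_rot, inner_rot]

theorem sum_inner_rot_single_sq (R : SO3) (w : R3) :
    ∑ a : Fin 3, inner ℝ (rot R (EuclideanSpace.single a 1)) w ^ 2 = ‖w‖ ^ 2 := by
  obtain ⟨w, rfl⟩ : ∃ w', rot R w' = w := ⟨rot R⁻¹ w, rot_rot_inv R w⟩
  simp only [inner_rot, norm_rot, norm_sq_r3, Fin.sum_univ_three,
    EuclideanSpace.inner_single_left]
  simp

theorem triSum_rotate {n : ℕ} (R : SO3) (e : Config (LoopSite n)) (i : ZMod n) :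
    triSum (rotate R e) i = rot R (triSum e i) := by
  simp only [triSum, rotate_apply, map_add]

theorem rotate_mem_spinSpace {V : Type*} (R : SO3) {e : Config V} (he : e ∈ spinSpace V) :
    rotate R e ∈ spinSpace V := fun v => by rw [rotate_apply, norm_rot, he]

/-! ### The linear forms of which the Hessian is the sum of squares -/

/-- The vector representing the linear form `z ↦ ⟪ξ, ∑ v ∈ T, tangentFrame (e v) (z v)⟫ / √2`. -/
def sumCovector {V : Type*} [DecidableEq V] (e : Config V) (T : Finset V) (ξ : R3) (v : V) : ℂ :=
  if v ∈ T then (Real.sqrt 2 : ℂ) * ⟨inner ℝ ξ (unitPerp (e v)),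
    inner ℝ ξ (cross (e v) (unitPerp (e v)))⟩ else 0

section Covector

variable {V : Type*} [Fintype V] [DecidableEq V] (e : Config V)

theorem herm_sumCovector_re_sq (T : Finset V) (ξ : R3) (z : V → ℂ) :
    (herm (sumCovector e T ξ) z).re ^ 2 =
      inner ℝ ξ (∑ v ∈ T, tangentFrame (e v) (z v)) ^ 2 / 2 := by
  have h : (herm (sumCovector e T ξ) z).re * Real.sqrt 2 =
      inner ℝ ξ (∑ v ∈ T, tangentFrame (e v) (z v)) := by
    rw [herm, Complex.re_sum, Finset.sum_mul, inner_sum, ← Finset.sum_subset (Finset.subset_univ T)]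
    · refine Finset.sum_congr rfl fun v hv => ?_
      rw [sumCovector, if_pos hv, tangentFrame, inner_smul_right, inner_add_right, inner_smul_right,
        inner_smul_right]
      have h2 : Real.sqrt 2 * Real.sqrt 2 = 2 := Real.mul_self_sqrt (by norm_num)
      simp only [map_mul, Complex.conj_ofReal, Complex.mul_re, Complex.mul_im, Complex.ofReal_re,
        Complex.ofReal_im, Complex.conj_re, Complex.conj_im]
      linear_combination (inner ℝ ξ (unitPerp (e v)) * (z v).re +
        inner ℝ ξ (cross (e v) (unitPerp (e v))) * (z v).im) * h2
    · intro v _ hv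
      rw [sumCovector, if_neg hv]
      simp
  rw [← h, mul_pow, Real.sq_sqrt (by norm_num)]
  ring

variable {e}

theorem cross_unitPerp_cross (u : R3) :
    cross (unitPerp u) (cross u (unitPerp u)) = u := by
  rw [cross_cross_eq, real_inner_self_eq_norm_sq, norm_unitPerp, real_inner_comm, inner_unitPerp]
  simp

theorem sq_inner_cross (x y z : R3) : inner ℝ x (cross y z) ^ 2 =
    inner ℝ x x * (inner ℝ y y * inner ℝ z z - inner ℝ y z ^ 2) - inner ℝ x y ^ 2 * inner ℝ z z -
      inner ℝ x z ^ 2 * inner ℝ y y + 2 * (inner ℝ x y * inner ℝ y z * inner ℝ x z) := by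
  simp only [inner_r3, cross_zero_apply, cross_one_apply, cross_two_apply]
  ring

theorem inner_unitPerp_sq_add {u : R3} (hu : ‖u‖ = 1) (ξ : R3) :
    inner ℝ ξ (unitPerp u) ^ 2 + inner ℝ ξ (cross u (unitPerp u)) ^ 2 =
      ‖ξ‖ ^ 2 - inner ℝ ξ u ^ 2 := by
  have h := sq_inner_cross ξ u (unitPerp u)
  simp only [real_inner_self_eq_norm_sq, hu, norm_unitPerp, inner_unitPerp] at h
  rw [h]
  ring

theorem nsq_sumCovector (he : e ∈ spinSpace V) (T : Finset V) (ξ : R3) :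
    nsq (sumCovector e T ξ) = 2 * ∑ v ∈ T, (‖ξ‖ ^ 2 - inner ℝ ξ (e v) ^ 2) := by
  rw [nsq, ← Finset.sum_subset (Finset.subset_univ T), Finset.mul_sum]
  · refine Finset.sum_congr rfl fun v hv => ?_
    rw [sumCovector, if_pos hv, norm_mul, mul_pow, Complex.norm_real, Real.norm_eq_abs, sq_abs,
      Real.sq_sqrt (by norm_num), Complex.sq_norm, Complex.normSq_mk, ← sq, ← sq,
      inner_unitPerp_sq_add (he v)]
  · intro v _ hv
    rw [sumCovector, if_neg hv]
    simp

/-- The imaginary part is the symplectic pairing, that is, the commutator of two forms. Only common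
sites contribute, and at each of them the area form of the tangent plane is a triple product. -/
theorem herm_sumCovector_im (e : Config V) (T T' : Finset V) (ξ η : R3) :
    (herm (sumCovector e T η) (sumCovector e T' ξ)).im =
      2 * ∑ v ∈ T ∩ T', inner ℝ (e v) (cross η ξ) := by
  rw [herm, Complex.im_sum, ← Finset.sum_subset (Finset.subset_univ (T ∩ T')), Finset.mul_sum]
  · refine Finset.sum_congr rfl fun v hv => ?_
    rw [Finset.mem_inter] at hv
    have h2 : Real.sqrt 2 * Real.sqrt 2 = 2 := Real.mul_self_sqrt (by norm_num)
    have h3 : inner ℝ (e v) (cross η ξ) = inner ℝ η (unitPerp (e v)) *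
        inner ℝ ξ (cross (e v) (unitPerp (e v))) - inner ℝ ξ (unitPerp (e v)) *
        inner ℝ η (cross (e v) (unitPerp (e v))) := by
      conv_lhs => rw [← cross_unitPerp_cross (e v)]
      rw [inner_cross_cross, real_inner_comm, real_inner_comm ξ, real_inner_comm ξ,
        real_inner_comm η]
    rw [sumCovector, sumCovector, if_pos hv.1, if_pos hv.2, h3]
    simp only [map_mul, Complex.conj_ofReal, Complex.mul_re, Complex.mul_im, Complex.ofReal_re,
        Complex.ofReal_im, Complex.conj_re, Complex.conj_im]
    linear_combination (inner ℝ η (unitPerp (e v)) * inner ℝ ξ (cross (e v) (unitPerp (e v))) -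
      inner ℝ ξ (unitPerp (e v)) * inner ℝ η (cross (e v) (unitPerp (e v)))) * h2
  · intro v _ hv
    rw [Finset.mem_inter, not_and_or] at hv
    rcases hv with hv | hv
    · rw [sumCovector, if_neg hv]; simp
    · rw [sumCovector, sumCovector, if_neg hv]; simp

end Covector

theorem sum_loopTriangle {n : ℕ} [NeZero n] (hn : EdgesOfTriangles n) {E : Type*} [AddCommMonoid E]
    (f : LoopSite n → E) (i : ZMod n) : ∑ v ∈ loopTriangle n i, f v = triSum f i := by
  have h1 := hn.succ_ne i
  rw [loopTriangle, Finset.sum_insert (by simp [h1.symm]), Finset.sum_insert (by simp),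
    Finset.sum_singleton, triSum, add_assoc]

theorem sum_zmod_four {E : Type*} [AddCommMonoid E] (f : ZMod 4 → E) :
    ∑ i, f i = f 0 + f 1 + f 2 + f 3 := Fin.sum_univ_four f

/-- The number of the inner site common to the triangles `2 s` and `2 s' + 1`. -/
def commonSite : Fin 2 → Fin 2 → ZMod 4 := ![![1, 0], ![2, 3]]

/-- The matrix of `y ↦ x × y`. -/
def skew (x : R3) : Matrix (Fin 3) (Fin 3) ℝ := !![0, -x 2, x 1; x 2, 0, -x 0; -x 1, x 0, 0]

theorem inner_cross_single (x : R3) (a b : Fin 3) :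
    inner ℝ x (cross (EuclideanSpace.single b 1) (EuclideanSpace.single a 1)) = skew x a b := by
  rw [inner_r3, cross_zero_apply, cross_one_apply, cross_two_apply]
  fin_cases a <;> fin_cases b <;> simp [skew]

/-- An even and an odd triangle of the loop share exactly one inner site, so the commutators between
their forms make up a 2 × 2 array of blocks, each the skew matrix of one inner vector. Using the
rotated axes in the sums of squares removes R from the bound. -/
theorem le_melinValue_of_orthogonal {W : Matrix (Fin 2 × Fin 3) (Fin 2 × Fin 3) ℝ}
    (hW : Wᵀ * W = 1) {x : Config (LoopSite 4)} (hx : x ∈ spinSpace (LoopSite 4))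
    (hx0 : ∀ i, triSum x i = 0) (R : SO3) :
    12 + ∑ s, ∑ s', ∑ a, ∑ b, W (s, a) (s', b) * skew (x (Sum.inl (commonSite s s'))) a b ≤
      melinValue (heisenberg (triangleLoop 4)) (rotate R x) := by
  set e := rotate R x with he_def
  have he : e ∈ spinSpace (LoopSite 4) := rotate_mem_spinSpace R hx
  have he0 : ∀ i, triSum e i = 0 := fun i => by rw [he_def, triSum_rotate, hx0, map_zero]
  set p : Fin 2 → ZMod 4 := ![0, 2] with hp
  set q : Fin 2 → ZMod 4 := ![1, 3] with hq
  set ε : Fin 3 → R3 := fun a => EuclideanSpace.single a 1 with hε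
  set X : Fin 2 × Fin 3 → LoopSite 4 → ℂ := fun k =>
    sumCovector e (loopTriangle 4 (p k.1)) (rot R (ε k.2)) with hX
  set Y : Fin 2 × Fin 3 → LoopSite 4 → ℂ := fun k =>
    sumCovector e (loopTriangle 4 (q k.1)) (rot R (ε k.2)) with hY
  have hQ : halfHessian (heisenberg (triangleLoop 4)) e = sumSq (Sum.elim X Y) := by
    ext z
    have key : ∀ i : ZMod 4, ‖triSum (fun v => tangentFrame (e v) (z v)) i‖ ^ 2 / 2 =
        ∑ a, (herm (sumCovector e (loopTriangle 4 i) (rot R (ε a))) z).re ^ 2 := fun i => by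
      simp only [herm_sumCovector_re_sq]
      rw [← Finset.sum_div, sum_inner_rot_single_sq, sum_loopTriangle edgesOfTriangles_four]
    rw [halfHessian_eq edgesOfTriangles_four he he0, sumSq, Fintype.sum_sum_type]
    simp only [Sum.elim_inl, Sum.elim_inr, hX, hY, Fintype.sum_prod_type, Fin.sum_univ_two, hp, hq,
      key, sum_zmod_four, Matrix.cons_val_zero, Matrix.cons_val_one]
    ring
  -- Each triangle contributes 2·3·2: the normalisation, the three sites, and the dimension of the
  -- tangent plane. Four triangles divided by 4 give the constant 12.
  have hN : ∀ i : ZMod 4, ∑ a, nsq (sumCovector e (loopTriangle 4 i) (rot R (ε a))) = 12 := by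
    intro i
    simp only [nsq_sumCovector he, norm_rot]
    rw [← Finset.mul_sum, Finset.sum_comm]
    have : ∀ v, ∑ a, (‖ε a‖ ^ 2 - inner ℝ (rot R (ε a)) (e v) ^ 2) = 2 := fun v => by
      rw [Finset.sum_sub_distrib, sum_inner_rot_single_sq, he]
      simp [hε]
      norm_num
    simp only [this]
    rw [sum_loopTriangle edgesOfTriangles_four, triSum]
    norm_num
  have hI : ∀ s s', loopTriangle 4 (q s') ∩ loopTriangle 4 (p s) = {Sum.inl (commonSite s s')} := by
    decide
  have h := le_melinValueForm_of_orthogonal hW X Y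
  rw [melinValue, hQ]
  refine le_trans (le_of_eq ?_) h
  congr 1
  · simp only [hX, hY, Fintype.sum_prod_type, hN]
    norm_num
  · simp only [hX, hY, Fintype.sum_prod_type, herm_sumCovector_im, hI, Finset.sum_singleton]
    rw [Finset.sum_div]
    refine Finset.sum_congr rfl fun s _ => ?_
    rw [Finset.sum_comm, Finset.sum_div]
    refine Finset.sum_congr rfl fun a _ => ?_
    rw [Finset.sum_div]
    refine Finset.sum_congr rfl fun s' _ => ?_
    rw [Finset.sum_div]
    refine Finset.sum_congr rfl fun b _ => ?_
    rw [he_def, rotate_apply, inner_rot_cross_rot, inner_cross_single]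
    ring

end

noncomputable section

/-! ### Orthogonal matrices certifying lower bounds of the Melin value -/

/-- A matrix made of four blocks. -/
def ofBlocks (B : Fin 2 → Fin 2 → Matrix (Fin 3) (Fin 3) ℝ) :
    Matrix (Fin 2 × Fin 3) (Fin 2 × Fin 3) ℝ := Matrix.of fun j k => B j.1 k.1 j.2 k.2

theorem ofBlocks_orthogonal {B : Fin 2 → Fin 2 → Matrix (Fin 3) (Fin 3) ℝ}
    (h : ∀ s t, (B 0 s)ᵀ * B 0 t + (B 1 s)ᵀ * B 1 t = if s = t then 1 else 0) :
    (ofBlocks B)ᵀ * ofBlocks B = 1 := by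
  ext ⟨s, a⟩ ⟨t, b⟩
  have h1 := congrFun (congrFun (h s t) a) b
  simp only [Matrix.add_apply, Matrix.mul_apply, Matrix.transpose_apply] at h1
  rw [Matrix.mul_apply, Fintype.sum_prod_type, Fin.sum_univ_two]
  simp only [ofBlocks, Matrix.of_apply, Matrix.transpose_apply]
  rw [h1]
  by_cases hst : s = t
  · subst hst
    rw [if_pos rfl]
    by_cases hab : a = b
    · subst hab; simp
    · rw [Matrix.one_apply_ne hab, Matrix.one_apply_ne (by simp [hab])]
  · rw [if_neg hst, Matrix.zero_apply, Matrix.one_apply_ne (by simp [hst])]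

/-- The blocks of the certificates. -/
def certBlock (a b c d p q r t : ℝ) : Matrix (Fin 3) (Fin 3) ℝ := !![a, b, p; c, d, q; r, t, 0]

/-- Only the antisymmetric part of a block counts. At a planar point x 2 = 0, so the value depends
on p, q, r, t alone, and these are the same in the two certificates of each planar point. The
entries a, b, c, d are constrained only by orthogonality, which leaves their global sign σ free, and
are felt through the heights x 2: they produce the slope along a circle. -/
theorem sum_certBlock_mul_skew (a b c d p q r t : ℝ) (x : R3) :
    ∑ i, ∑ j, certBlock a b c d p q r t i j * skew x i j =
      x 0 * (t - q) + x 1 * (p - r) + x 2 * (c - b) := by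
  simp [certBlock, skew, Fin.sum_univ_three]
  ring

/-- The certificate at the planar point `(u, v, u, v)`, for the circle moving the fourth vector. -/
def certUV_moveThree (σ : ℝ) : Fin 2 → Fin 2 → Matrix (Fin 3) (Fin 3) ℝ :=
  ![![certBlock 0 (σ / 2) (-σ / 2) 0 (1 / 2) (1 / 2) (-1 / 2) (-1 / 2),
      certBlock 0 (-σ / 2) (-σ / 2) 0 (-1 / 2) (1 / 2) (1 / 2) (-1 / 2)],
    ![certBlock 0 (σ / 2) (σ / 2) 0 (-1 / 2) (1 / 2) (1 / 2) (-1 / 2),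
      certBlock 0 (-σ / 2) (σ / 2) 0 (1 / 2) (1 / 2) (-1 / 2) (-1 / 2)]]

theorem certUV_moveThree_orthogonal {σ : ℝ} (hσ : σ ^ 2 = 1) :
    (ofBlocks (certUV_moveThree σ))ᵀ * ofBlocks (certUV_moveThree σ) = 1 := by
  refine ofBlocks_orthogonal fun i j => ?_
  ext a b
  fin_cases i <;> fin_cases j <;> fin_cases a <;> fin_cases b <;>
    simp [certUV_moveThree, certBlock, Matrix.mul_apply, Fin.sum_univ_three] <;> grind

/-- The certificate at the planar point `(u, v, u, v)`, for the circle moving the third vector. -/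
def certUV_moveTwo (σ : ℝ) : Fin 2 → Fin 2 → Matrix (Fin 3) (Fin 3) ℝ :=
  ![![certBlock 0 (-σ / 2) (-σ / 2) 0 (1 / 2) (1 / 2) (-1 / 2) (-1 / 2),
      certBlock 0 (σ / 2) (-σ / 2) 0 (-1 / 2) (1 / 2) (1 / 2) (-1 / 2)],
    ![certBlock 0 (-σ / 2) (σ / 2) 0 (-1 / 2) (1 / 2) (1 / 2) (-1 / 2),
      certBlock 0 (σ / 2) (σ / 2) 0 (1 / 2) (1 / 2) (-1 / 2) (-1 / 2)]]

theorem certUV_moveTwo_orthogonal {σ : ℝ} (hσ : σ ^ 2 = 1) :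
    (ofBlocks (certUV_moveTwo σ))ᵀ * ofBlocks (certUV_moveTwo σ) = 1 := by
  refine ofBlocks_orthogonal fun i j => ?_
  ext a b
  fin_cases i <;> fin_cases j <;> fin_cases a <;> fin_cases b <;>
    simp [certUV_moveTwo, certBlock, Matrix.mul_apply, Fin.sum_univ_three] <;> grind

/-- The certificate at the planar point `(u, v, u, w)`, for the circle moving the fourth vector. -/
def certUW_moveThree (s σ : ℝ) : Fin 2 → Fin 2 → Matrix (Fin 3) (Fin 3) ℝ :=
  ![![certBlock 0 (σ / 2) (-σ / 2) 0 (1 / 2) (1 / 2) (-1 / 2) (-1 / 2),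
      certBlock (σ * s / 4) (σ / 4) (-σ / 4) (σ * s / 4) (-1 / 2) (1 / 2) ((1 + s) / 4)
        ((1 - s) / 4)],
    ![certBlock (-(σ * s) / 4) (σ / 4) (-σ / 4) (-(σ * s) / 4) ((-1 - s) / 4) ((-1 + s) / 4)
        (1 / 2) (-1 / 2),
      certBlock 0 (σ / 2) (-σ / 2) 0 ((1 - s) / 4) ((-1 - s) / 4) ((-1 + s) / 4) ((1 + s) / 4)]]

theorem certUW_moveThree_orthogonal {s σ : ℝ} (hs : s ^ 2 = 3) (hσ : σ ^ 2 = 1) :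
    (ofBlocks (certUW_moveThree s σ))ᵀ * ofBlocks (certUW_moveThree s σ) = 1 := by
  refine ofBlocks_orthogonal fun i j => ?_
  ext a b
  fin_cases i <;> fin_cases j <;> fin_cases a <;> fin_cases b <;>
    simp [certUW_moveThree, certBlock, Matrix.mul_apply, Fin.sum_univ_three] <;> grind

/-- The certificate at the planar point `(u, v, u, w)`, for the circle moving the third and
fourth vectors. -/
def certUW_moveBoth (s σ : ℝ) : Fin 2 → Fin 2 → Matrix (Fin 3) (Fin 3) ℝ :=
  ![![certBlock (-σ / 2) 0 0 (-σ / 2) (1 / 2) (1 / 2) (-1 / 2) (-1 / 2),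
      certBlock (-σ / 4) (σ * s / 4) (-(σ * s) / 4) (-σ / 4) (-1 / 2) (1 / 2) ((1 + s) / 4)
        ((1 - s) / 4)],
    ![certBlock (-σ / 4) (-(σ * s) / 4) (σ * s / 4) (-σ / 4) ((-1 - s) / 4) ((-1 + s) / 4)
        (1 / 2) (-1 / 2),
      certBlock (-σ / 2) 0 0 (-σ / 2) ((1 - s) / 4) ((-1 - s) / 4) ((-1 + s) / 4) ((1 + s) / 4)]]

theorem certUW_moveBoth_orthogonal {s σ : ℝ} (hs : s ^ 2 = 3) (hσ : σ ^ 2 = 1) :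
    (ofBlocks (certUW_moveBoth s σ))ᵀ * ofBlocks (certUW_moveBoth s σ) = 1 := by
  refine ofBlocks_orthogonal fun i j => ?_
  ext a b
  fin_cases i <;> fin_cases j <;> fin_cases a <;> fin_cases b <;>
    simp [certUW_moveBoth, certBlock, Matrix.mul_apply, Fin.sum_univ_three] <;> grind

/-- The certificate at the planar point `(u, v, w, v)`, for the circle moving the third vector. -/
def certWV_moveTwo (s σ : ℝ) : Fin 2 → Fin 2 → Matrix (Fin 3) (Fin 3) ℝ :=
  ![![certBlock (-(σ * s) / 4) (σ / 4) (-σ / 4) (-(σ * s) / 4) (1 / 2) (1 / 2) ((-1 - s) / 4)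
        ((1 - s) / 4),
      certBlock 0 (σ / 2) (-σ / 2) 0 (-1 / 2) (1 / 2) (1 / 2) (-1 / 2)],
    ![certBlock 0 (σ / 2) (-σ / 2) 0 ((-1 + s) / 4) ((-1 - s) / 4) ((1 - s) / 4) ((1 + s) / 4),
      certBlock (σ * s / 4) (σ / 4) (-σ / 4) (σ * s / 4) ((1 + s) / 4) ((-1 + s) / 4) (-1 / 2)
        (-1 / 2)]]

theorem certWV_moveTwo_orthogonal {s σ : ℝ} (hs : s ^ 2 = 3) (hσ : σ ^ 2 = 1) :
    (ofBlocks (certWV_moveTwo s σ))ᵀ * ofBlocks (certWV_moveTwo s σ) = 1 := by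
  refine ofBlocks_orthogonal fun i j => ?_
  ext a b
  fin_cases i <;> fin_cases j <;> fin_cases a <;> fin_cases b <;>
    simp [certWV_moveTwo, certBlock, Matrix.mul_apply, Fin.sum_univ_three] <;> grind

/-- The certificate at the planar point `(u, v, w, v)`, for the circle moving the third and
fourth vectors. -/
def certWV_moveBoth (s σ : ℝ) : Fin 2 → Fin 2 → Matrix (Fin 3) (Fin 3) ℝ :=
  ![![certBlock (σ / 4) (σ * s / 4) (-(σ * s) / 4) (σ / 4) (1 / 2) (1 / 2) ((-1 - s) / 4)
        ((1 - s) / 4),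
      certBlock (σ / 2) 0 0 (σ / 2) (-1 / 2) (1 / 2) (1 / 2) (-1 / 2)],
    ![certBlock (σ / 2) 0 0 (σ / 2) ((-1 + s) / 4) ((-1 - s) / 4) ((1 - s) / 4) ((1 + s) / 4),
      certBlock (σ / 4) (-(σ * s) / 4) (σ * s / 4) (σ / 4) ((1 + s) / 4) ((-1 + s) / 4)
        (-1 / 2) (-1 / 2)]]

theorem certWV_moveBoth_orthogonal {s σ : ℝ} (hs : s ^ 2 = 3) (hσ : σ ^ 2 = 1) :
    (ofBlocks (certWV_moveBoth s σ))ᵀ * ofBlocks (certWV_moveBoth s σ) = 1 := by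
  refine ofBlocks_orthogonal fun i j => ?_
  ext a b
  fin_cases i <;> fin_cases j <;> fin_cases a <;> fin_cases b <;>
    simp [certWV_moveBoth, certBlock, Matrix.mul_apply, Fin.sum_univ_three] <;> grind


end

noncomputable section

/-! ### Minimal configurations given by their inner vectors -/

/-- The configuration with given vectors at the inner sites, where the sum of the vectors of each
triangle vanishes. -/
def loopConfig {n : ℕ} (a : ZMod n → R3) : Config (LoopSite n) :=
  Sum.elim a fun i => -(a i + a (i + 1))

theorem triSum_loopConfig {n : ℕ} (a : ZMod n → R3) (i : ZMod n) : triSum (loopConfig a) i = 0 := by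
  simp [triSum, loopConfig]

theorem eq_loopConfig {n : ℕ} {e : Config (LoopSite n)} (he : ∀ i, triSum e i = 0) :
    e = loopConfig fun i => e (Sum.inl i) := by
  ext1 v
  rcases v with i | i
  · rfl
  · have h := he i
    rw [triSum] at h
    exact (neg_eq_of_add_eq_zero_right h).symm

theorem norm_neg_add_eq_one {x y : R3} (hx : ‖x‖ = 1) (hy : ‖y‖ = 1) (h : inner ℝ x y = -1 / 2) :
    ‖-(x + y)‖ = 1 := by
  have h1 : ‖-(x + y)‖ ^ 2 = 1 := by
    rw [norm_neg, norm_add_sq_real, hx, hy, h]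
    norm_num
  exact (pow_eq_one_iff_of_nonneg (norm_nonneg _) two_ne_zero).1 h1

theorem loopConfig_mem_spinSpace {n : ℕ} {a : ZMod n → R3} (h1 : ∀ i, ‖a i‖ = 1)
    (h2 : ∀ i, inner ℝ (a i) (a (i + 1)) = -1 / 2) : loopConfig a ∈ spinSpace (LoopSite n) := by
  rintro (i | i)
  · exact h1 i
  · exact norm_neg_add_eq_one (h1 _) (h1 _) (h2 i)

theorem inner_succ {n : ℕ} {e : Config (LoopSite n)} (he : e ∈ spinSpace (LoopSite n))
    (he0 : ∀ i, triSum e i = 0) (i : ZMod n) :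
    inner ℝ (e (Sum.inl i)) (e (Sum.inl (i + 1))) = -1 / 2 := by
  have h : ‖e (Sum.inr i)‖ ^ 2 = 1 := by rw [he, one_pow]
  rw [eq_loopConfig he0] at h
  change ‖-(e (Sum.inl i) + e (Sum.inl (i + 1)))‖ ^ 2 = 1 at h
  rw [norm_neg, norm_add_sq_real, he, he] at h
  linarith

/-! ### Configurations of the loop of four triangles whose first two vectors are fixed -/

theorem sqrt_three_sq : √3 ^ 2 = (3 : ℝ) := Real.sq_sqrt (by norm_num)

/-- The first vector. -/
def vecU : R3 := !₂[-1 / 2, -√3 / 2, 0]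

/-- The second vector. -/
def vecV : R3 := !₂[-1 / 2, √3 / 2, 0]

/-- The opposite of the sum of the first two vectors. -/
def vecW : R3 := !₂[1, 0, 0]

/-- The configuration of the loop of four triangles where the vectors at the inner sites are
`u, v, a, b`. -/
def gaugeConfig (a b : R3) : Config (LoopSite 4) :=
  loopConfig (n := 4) (![vecU, vecV, a, b] : Fin 4 → R3)

theorem norm_eq_one_of_sq {x : R3} (h : x 0 ^ 2 + x 1 ^ 2 + x 2 ^ 2 = 1) : ‖x‖ = 1 := by
  rw [← norm_sq_r3] at h
  exact (pow_eq_one_iff_of_nonneg (norm_nonneg _) two_ne_zero).1 h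

theorem norm_vecU : ‖vecU‖ = 1 := norm_eq_one_of_sq (by
  simp [vecU]; linear_combination sqrt_three_sq / 4)

theorem norm_vecV : ‖vecV‖ = 1 := norm_eq_one_of_sq (by
  simp [vecV]; linear_combination sqrt_three_sq / 4)

theorem inner_vecU_vecV : inner ℝ vecU vecV = -1 / 2 := by
  simp [inner_r3, vecU, vecV]; linear_combination -sqrt_three_sq / 4

/-- The conditions on the third and fourth vectors. -/
structure IsGauge (a b : R3) : Prop where
  norm_left : ‖a‖ = 1
  norm_right : ‖b‖ = 1
  inner_left : inner ℝ vecV a = -1 / 2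
  inner_mid : inner ℝ a b = -1 / 2
  inner_right : inner ℝ b vecU = -1 / 2

theorem IsGauge.mem_spinSpace {a b : R3} (h : IsGauge a b) :
    gaugeConfig a b ∈ spinSpace (LoopSite 4) := by
  refine loopConfig_mem_spinSpace (fun i => ?_) (fun i => ?_)
  · change Fin 4 at i
    fin_cases i
    exacts [norm_vecU, norm_vecV, h.norm_left, h.norm_right]
  · change Fin 4 at i
    fin_cases i
    exacts [inner_vecU_vecV, h.inner_left, h.inner_mid, h.inner_right]

/-- The lower bound given by a certificate. -/
theorem le_melinValue_gaugeConfig {B : Fin 2 → Fin 2 → Matrix (Fin 3) (Fin 3) ℝ}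
    (hB : (ofBlocks B)ᵀ * ofBlocks B = 1) {a b : R3} (h : IsGauge a b) (R : SO3) :
    12 + (∑ i, ∑ j, B 0 0 i j * skew vecV i j + ∑ i, ∑ j, B 0 1 i j * skew vecU i j +
      ∑ i, ∑ j, B 1 0 i j * skew a i j + ∑ i, ∑ j, B 1 1 i j * skew b i j) ≤
      melinValue (heisenberg (triangleLoop 4)) (rotate R (gaugeConfig a b)) := by
  refine le_trans (le_of_eq ?_)
    (le_melinValue_of_orthogonal hB h.mem_spinSpace (fun i => triSum_loopConfig _ i) R)
  rw [Fin.sum_univ_two, Fin.sum_univ_two, Fin.sum_univ_two]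
  simp only [add_assoc]
  rfl

/-- The unit vectors with product `-1 / 2` with `vecV`. -/
def vecA (t : ℝ) : R3 :=
  !₂[(1 - 3 * Real.cos t) / 4, -√3 * (1 + Real.cos t) / 4, √3 * Real.sin t / 2]

/-- The unit vectors with product `-1 / 2` with `vecU`. -/
def vecB (t : ℝ) : R3 :=
  !₂[(1 - 3 * Real.cos t) / 4, √3 * (1 + Real.cos t) / 4, √3 * Real.sin t / 2]

/-- The unit vector different from `vecV`, with product `-1 / 2` with `vecU` and `vecA t`. -/
def vecD (t : ℝ) : R3 :=
  !₂[(7 + 9 * Real.cos t) / (2 * (5 + 3 * Real.cos t)),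
    √3 * (1 - Real.cos t) / (2 * (5 + 3 * Real.cos t)),
    -2 * √3 * Real.sin t / (5 + 3 * Real.cos t)]

theorem five_add_pos (t : ℝ) : 0 < 5 + 3 * Real.cos t := by
  have := Real.neg_one_le_cos t
  linarith

theorem isGauge_vecU_vecB (t : ℝ) : IsGauge vecU (vecB t) := by
  have h3 := sqrt_three_sq
  have h1 := Real.sin_sq_add_cos_sq t
  refine ⟨norm_vecU, norm_eq_one_of_sq ?_, ?_, ?_, ?_⟩
  · simp [vecB]; linear_combination (1 / 16 * (1 + Real.cos t) ^ 2 + Real.sin t ^ 2 / 4) * h3 +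
      3 / 4 * h1
  · rw [real_inner_comm, inner_vecU_vecV]
  · simp [inner_r3, vecU, vecB]; linear_combination (-(1 + Real.cos t) / 8) * h3
  · simp [inner_r3, vecU, vecB]; linear_combination (-(1 + Real.cos t) / 8) * h3

theorem isGauge_vecA_vecV (t : ℝ) : IsGauge (vecA t) vecV := by
  have h3 := sqrt_three_sq
  have h1 := Real.sin_sq_add_cos_sq t
  refine ⟨norm_eq_one_of_sq ?_, norm_vecV, ?_, ?_, ?_⟩
  · simp [vecA]; linear_combination (1 / 16 * (1 + Real.cos t) ^ 2 + Real.sin t ^ 2 / 4) * h3 +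
      3 / 4 * h1
  · simp [inner_r3, vecV, vecA]; linear_combination (-(1 + Real.cos t) / 8) * h3
  · simp [inner_r3, vecV, vecA]; linear_combination (-(1 + Real.cos t) / 8) * h3
  · rw [real_inner_comm, inner_vecU_vecV]

theorem isGauge_vecA_vecD (t : ℝ) : IsGauge (vecA t) (vecD t) := by
  have h3 := sqrt_three_sq
  have h1 := Real.sin_sq_add_cos_sq t
  have h5 := (five_add_pos t).ne'
  have h6 : 5 + Real.cos t * 3 ≠ 0 := by rwa [mul_comm]
  refine ⟨(isGauge_vecA_vecV t).norm_left, norm_eq_one_of_sq ?_, (isGauge_vecA_vecV t).inner_left,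
    ?_, ?_⟩
  · simp [vecD]
    field_simp
    linear_combination ((1 - Real.cos t) ^ 2 + 16 * Real.sin t ^ 2) * h3 + 48 * h1
  · simp [inner_r3, vecA, vecD]
    field_simp
    linear_combination (-(1 + Real.cos t) * (1 - Real.cos t) - 8 * Real.sin t ^ 2) * h3 - 24 * h1
  · simp [inner_r3, vecU, vecD]
    field_simp
    linear_combination (-(1 - Real.cos t)) * h3

/-! ### Lower bounds of the Melin value near the planar configurations -/

/-- As s² = (1 - c)(1 + c), the claim amounts to 81(1 - c) ≤ 1 + c, true for c ≥ 40/41; the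
threshold 49/50 is slightly larger. -/
theorem one_sub_le_of_sq_add_sq {c s : ℝ} (h : s ^ 2 + c ^ 2 = 1) (hc : 49 / 50 < c) :
    1 - c ≤ |s| / 9 := by
  have hc1 : c ≤ 1 := by nlinarith
  refine abs_le_of_sq_le_sq' ?_ (by positivity) |>.2
  rw [div_pow, sq_abs]
  nlinarith

theorem one_add_le_of_sq_add_sq {c s : ℝ} (h : s ^ 2 + c ^ 2 = 1) (hc : c < -(49 / 50)) :
    1 + c ≤ |s| / 9 := by
  have := one_sub_le_of_sq_add_sq (c := -c) (s := s) (by rw [neg_sq, h]) (by linarith)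
  linarith

/-- Unlike the sign function, σ is ±1 also at x = 0, as the orthogonality of the certificates
requires. -/
theorem exists_sign (x : ℝ) : ∃ σ : ℝ, σ ^ 2 = 1 ∧ σ * x = |x| := by
  rcases le_total 0 x with h | h
  · exact ⟨1, by norm_num, by rw [abs_of_nonneg h, one_mul]⟩
  · exact ⟨-1, by norm_num, by rw [abs_of_nonpos h]; ring⟩

theorem sqrt_three_bounds : 17 / 10 ≤ √3 ∧ √3 ≤ 9 / 5 :=
  ⟨Real.le_sqrt_of_sq_le (by norm_num), Real.sqrt_le_iff.2 ⟨by norm_num, by norm_num⟩⟩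

/-- The certificate gives 14 + 2√3 at t = 0. With σ the sign of sin t, the height of the moving
vector adds √3|sin t|/2, while its horizontal part loses only a multiple of 1 - cos t. The same
mechanism works in the five other cases; near t = π the sign of -sin t and the quantity 1 + cos t
take over. -/
theorem le_melinValue_UV_moveThree {t : ℝ} (hc : 49 / 50 < Real.cos t) (R : SO3) :
    14 + 2 * √3 ≤ melinValue (heisenberg (triangleLoop 4))
      (rotate R (gaugeConfig vecU (vecB t))) := by
  obtain ⟨σ, hσ, hs⟩ := exists_sign (Real.sin t)
  refine le_trans ?_ (le_melinValue_gaugeConfig (certUV_moveThree_orthogonal hσ)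
    (isGauge_vecU_vecB t) R)
  have h := one_sub_le_of_sq_add_sq (Real.sin_sq_add_cos_sq t) hc
  obtain ⟨hr1, hr2⟩ := sqrt_three_bounds
  have hm := abs_nonneg (Real.sin t)
  simp [certUV_moveThree, sum_certBlock_mul_skew, vecU, vecV, vecB]
  have e1 : √3 * (σ * Real.sin t) = √3 * |Real.sin t| := by rw [hs]
  nlinarith [mul_le_mul_of_nonneg_right hr2 (sub_nonneg.2 (Real.cos_le_one t)),
    mul_le_mul_of_nonneg_right hr1 hm]

theorem le_melinValue_UV_moveTwo {t : ℝ} (hc : 49 / 50 < Real.cos t) (R : SO3) :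
    14 + 2 * √3 ≤ melinValue (heisenberg (triangleLoop 4))
      (rotate R (gaugeConfig (vecA t) vecV)) := by
  obtain ⟨σ, hσ, hs⟩ := exists_sign (Real.sin t)
  refine le_trans ?_ (le_melinValue_gaugeConfig (certUV_moveTwo_orthogonal hσ)
    (isGauge_vecA_vecV t) R)
  have h := one_sub_le_of_sq_add_sq (Real.sin_sq_add_cos_sq t) hc
  obtain ⟨hr1, hr2⟩ := sqrt_three_bounds
  have hm := abs_nonneg (Real.sin t)
  simp [certUV_moveTwo, sum_certBlock_mul_skew, vecU, vecV, vecA]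
  have e1 : √3 * (σ * Real.sin t) = √3 * |Real.sin t| := by rw [hs]
  nlinarith [mul_le_mul_of_nonneg_right hr2 (sub_nonneg.2 (Real.cos_le_one t)),
    mul_le_mul_of_nonneg_right hr1 hm]

theorem le_melinValue_UW_moveThree {t : ℝ} (hc : Real.cos t < -(49 / 50)) (R : SO3) :
    14 + 2 * √3 ≤ melinValue (heisenberg (triangleLoop 4))
      (rotate R (gaugeConfig vecU (vecB t))) := by
  obtain ⟨σ, hσ, hs⟩ := exists_sign (-Real.sin t)
  refine le_trans ?_ (le_melinValue_gaugeConfig (certUW_moveThree_orthogonal sqrt_three_sq hσ)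
    (isGauge_vecU_vecB t) R)
  have h := one_add_le_of_sq_add_sq (Real.sin_sq_add_cos_sq t) hc
  obtain ⟨hr1, hr2⟩ := sqrt_three_bounds
  rw [abs_neg] at hs
  have hm := abs_nonneg (Real.sin t)
  simp [certUW_moveThree, sum_certBlock_mul_skew, vecU, vecV, vecB]
  have e1 : √3 * (σ * -Real.sin t) = √3 * |Real.sin t| := by rw [hs]
  nlinarith [mul_le_mul_of_nonneg_right hr2 (neg_le_iff_add_nonneg.1 (Real.neg_one_le_cos t)),
    mul_le_mul_of_nonneg_right hr1 hm, sqrt_three_sq]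

theorem le_melinValue_WV_moveTwo {t : ℝ} (hc : Real.cos t < -(49 / 50)) (R : SO3) :
    14 + 2 * √3 ≤ melinValue (heisenberg (triangleLoop 4))
      (rotate R (gaugeConfig (vecA t) vecV)) := by
  obtain ⟨σ, hσ, hs⟩ := exists_sign (-Real.sin t)
  refine le_trans ?_ (le_melinValue_gaugeConfig (certWV_moveTwo_orthogonal sqrt_three_sq hσ)
    (isGauge_vecA_vecV t) R)
  have h := one_add_le_of_sq_add_sq (Real.sin_sq_add_cos_sq t) hc
  obtain ⟨hr1, hr2⟩ := sqrt_three_bounds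
  rw [abs_neg] at hs
  have hm := abs_nonneg (Real.sin t)
  simp [certWV_moveTwo, sum_certBlock_mul_skew, vecU, vecV, vecA]
  have e1 : √3 * (σ * -Real.sin t) = √3 * |Real.sin t| := by rw [hs]
  nlinarith [mul_le_mul_of_nonneg_right hr2 (neg_le_iff_add_nonneg.1 (Real.neg_one_le_cos t)),
    mul_le_mul_of_nonneg_right hr1 hm, sqrt_three_sq]

/-- Both free vectors move here, but the certificate reads the height of the third one only, and
gains 3|sin t|/4. -/
theorem le_melinValue_UW_moveBoth {t : ℝ} (hc : 49 / 50 < Real.cos t) (R : SO3) :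
    14 + 2 * √3 ≤ melinValue (heisenberg (triangleLoop 4))
      (rotate R (gaugeConfig (vecA t) (vecD t))) := by
  obtain ⟨σ, hσ, hs⟩ := exists_sign (Real.sin t)
  refine le_trans ?_ (le_melinValue_gaugeConfig (certUW_moveBoth_orthogonal sqrt_three_sq hσ)
    (isGauge_vecA_vecD t) R)
  have h := one_sub_le_of_sq_add_sq (Real.sin_sq_add_cos_sq t) hc
  obtain ⟨hr1, hr2⟩ := sqrt_three_bounds
  have hm := abs_nonneg (Real.sin t)
  simp [certUW_moveBoth, sum_certBlock_mul_skew, vecU, vecV, vecA, vecD]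
  set c := Real.cos t
  set m := |Real.sin t|
  have h5 : 5 + 3 * c ≠ 0 := (five_add_pos t).ne'
  have h6 : 5 + c * 3 ≠ 0 := by rwa [mul_comm]
  -- The rational coordinates of `vecD` are expanded about their values at cos t = 1, so that the
  -- remainder is linear in the small quantity z.
  have d0 : (7 + 9 * c) / (2 * (5 + 3 * c)) = 1 - 3 * ((1 - c) / (2 * (5 + 3 * c))) := by
    field_simp
    ring
  have hy : 0 ≤ 1 - c := sub_nonneg.2 (Real.cos_le_one t)
  have hz : (1 - c) / (2 * (5 + 3 * c)) ≤ (1 - c) / 10 :=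
    div_le_div_of_nonneg_left hy (by norm_num) (by linarith)
  have e1 : √3 ^ 2 * (σ * Real.sin t) = 3 * m := by rw [hs, sqrt_three_sq]
  have d1 : √3 * (1 - c) / (2 * (5 + 3 * c)) = √3 * ((1 - c) / (2 * (5 + 3 * c))) :=
    mul_div_assoc _ _ _
  rw [d0, d1]
  set z := (1 - c) / (2 * (5 + 3 * c))
  have hz0 : 0 ≤ z := div_nonneg hy (by linarith)
  nlinarith [mul_le_mul_of_nonneg_right hr2 hy, mul_le_mul_of_nonneg_right hr2 hz0, sqrt_three_sq]

/-- At this end of the third circle the certificate reads the height of the fourth vector instead,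
and gains 3|sin t|/(5 + 3cos t). -/
theorem le_melinValue_WV_moveBoth {t : ℝ} (hc : Real.cos t < -(49 / 50)) (R : SO3) :
    14 + 2 * √3 ≤ melinValue (heisenberg (triangleLoop 4))
      (rotate R (gaugeConfig (vecA t) (vecD t))) := by
  obtain ⟨σ, hσ, hs⟩ := exists_sign (-Real.sin t)
  refine le_trans ?_ (le_melinValue_gaugeConfig (certWV_moveBoth_orthogonal sqrt_three_sq hσ)
    (isGauge_vecA_vecD t) R)
  have h := one_add_le_of_sq_add_sq (Real.sin_sq_add_cos_sq t) hc
  obtain ⟨hr1, hr2⟩ := sqrt_three_bounds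
  rw [abs_neg] at hs
  have hm := abs_nonneg (Real.sin t)
  simp [certWV_moveBoth, sum_certBlock_mul_skew, vecU, vecV, vecA, vecD]
  set c := Real.cos t
  set m := |Real.sin t|
  have h5 : 5 + 3 * c ≠ 0 := (five_add_pos t).ne'
  have h6 : 5 + c * 3 ≠ 0 := by rwa [mul_comm]
  have hy : 0 ≤ 1 + c := by linarith [Real.neg_one_le_cos t]
  have d0 : (7 + 9 * c) / (2 * (5 + 3 * c)) = -1 / 2 + 6 * ((1 + c) / (5 + 3 * c)) := by
    field_simp
    ring
  have d1 : √3 * (1 - c) / (2 * (5 + 3 * c)) = √3 / 2 - 2 * √3 * ((1 + c) / (5 + 3 * c)) := by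
    field_simp
    ring
  have d2 : -(2 * √3 * Real.sin t) / (5 + 3 * c) * (σ * √3 / 4 - -(σ * √3) / 4) =
      3 * (m / (5 + 3 * c)) := by
    rw [← hs]
    field_simp
    rw [sqrt_three_sq]
    ring
  have hz : (1 + c) / (5 + 3 * c) ≤ (1 + c) / 2 :=
    div_le_div_of_nonneg_left hy (by norm_num) (by linarith)
  have hm' : m / (21 / 10) ≤ m / (5 + 3 * c) :=
    div_le_div_of_nonneg_left hm (by linarith) (by linarith)
  rw [d0, d1, d2]
  set z := (1 + c) / (5 + 3 * c)
  have hz0 : 0 ≤ z := div_nonneg hy (by linarith)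
  nlinarith [mul_le_mul_of_nonneg_right hr2 hy, mul_le_mul_of_nonneg_right hr2 hz0, sqrt_three_sq]

end

noncomputable section

/-! ### Upper bound of the Melin value at the planar configurations -/

theorem inner_unitPerp_cross (u : R3) : inner ℝ (unitPerp u) (cross u (unitPerp u)) = 0 := by
  simp only [inner_r3, cross_zero_apply, cross_one_apply, cross_two_apply]
  ring

theorem eq_sum_frame {u : R3} (hu : ‖u‖ = 1) {ξ : R3} (h : inner ℝ ξ u = 0) :
    inner ℝ ξ (unitPerp u) • unitPerp u +
      inner ℝ ξ (cross u (unitPerp u)) • cross u (unitPerp u) = ξ := by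
  have h0 := inner_unitPerp_sq_add hu (inner ℝ ξ (unitPerp u) • unitPerp u +
      inner ℝ ξ (cross u (unitPerp u)) • cross u (unitPerp u) - ξ)
  have h1 : inner ℝ (cross u (unitPerp u)) (unitPerp u) = 0 := by
    rw [real_inner_comm, inner_unitPerp_cross]
  have h2 : inner ℝ (unitPerp u) u = 0 := by rw [real_inner_comm, inner_unitPerp]
  have h3 : inner ℝ (cross u (unitPerp u)) u = 0 := by rw [real_inner_comm, inner_self_cross]
  simp only [inner_sub_left, inner_add_left, real_inner_smul_left, real_inner_self_eq_norm_sq,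
    norm_unitPerp, norm_cross_unitPerp hu, inner_unitPerp_cross, h, h1, h2, h3] at h0
  rw [← sub_eq_zero, ← norm_eq_zero]
  nlinarith

theorem tangentFrame_I_mul {u : R3} (hu : ‖u‖ = 1) (z : ℂ) :
    tangentFrame u (Complex.I * z) = cross u (tangentFrame u z) := by
  have h : cross u (cross u (unitPerp u)) = -unitPerp u := by
    rw [cross_cross_eq, inner_unitPerp, real_inner_self_eq_norm_sq, hu]
    simp
  have h1 : cross u (tangentFrame u z) = (2 : ℝ) • (z.re • cross u (unitPerp u) +
      z.im • cross u (cross u (unitPerp u))) := by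
    simp [cross, tangentFrame]
  rw [h1, h, tangentFrame, Complex.I_mul_re, Complex.I_mul_im]
  module

/-- The coordinate of the tangent vector `ν × u` in the frame at `u`. -/
def planarCoord (ν u : R3) : ℂ :=
  ⟨inner ℝ (cross ν u) (unitPerp u), inner ℝ (cross ν u) (cross u (unitPerp u))⟩

section Planar

variable {ν u : R3}

theorem inner_cross_self_right (x y : R3) : inner ℝ (cross x y) y = 0 := by
  simp only [inner_r3, cross_zero_apply, cross_one_apply, cross_two_apply]
  ring

theorem norm_sq_planarCoord (hν : ‖ν‖ = 1) (hu : ‖u‖ = 1) (h : inner ℝ ν u = 0) :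
    ‖planarCoord ν u‖ ^ 2 = 1 := by
  rw [planarCoord, Complex.sq_norm, Complex.normSq_mk, ← sq, ← sq, inner_unitPerp_sq_add hu,
    inner_cross_self_right, ← real_inner_self_eq_norm_sq, inner_cross_cross,
    real_inner_self_eq_norm_sq, real_inner_self_eq_norm_sq, hν, hu, h]
  norm_num

theorem tangentFrame_planarCoord (hu : ‖u‖ = 1) :
    tangentFrame u (planarCoord ν u) = (2 : ℝ) • cross ν u := by
  rw [tangentFrame, planarCoord, eq_sum_frame hu (inner_cross_self_right _ _)]

theorem tangentFrame_I_mul_planarCoord (hu : ‖u‖ = 1) (h : inner ℝ ν u = 0) :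
    tangentFrame u (Complex.I * planarCoord ν u) = (2 : ℝ) • ν := by
  have h1 : cross u ((2 : ℝ) • cross ν u) = (2 : ℝ) • cross u (cross ν u) := by
    simp [cross]
  rw [tangentFrame_I_mul hu, tangentFrame_planarCoord hu, h1, cross_cross_eq,
    real_inner_self_eq_norm_sq, hu, real_inner_comm, h]
  simp

end Planar

/-- The sum over the triangles of the squares of the differences in the triangle. -/
def pairForm {n : ℕ} [NeZero n] {A : Type*} [CommRing A] (x : LoopSite n → A) : A :=
  ∑ i : ZMod n, ((x (Sum.inl i) - x (Sum.inl (i + 1))) ^ 2 + (x (Sum.inl i) - x (Sum.inr i)) ^ 2 +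
    (x (Sum.inl (i + 1)) - x (Sum.inr i)) ^ 2)

/-- The sum over the triangles of the squares of the sums in the triangle. -/
def sumForm {n : ℕ} [NeZero n] {A : Type*} [CommRing A] (x : LoopSite n → A) : A :=
  ∑ i : ZMod n, triSum x i ^ 2

theorem pairForm_mul {n : ℕ} [NeZero n] (r : ℝ) (x : LoopSite n → ℤ) :
    pairForm (fun v => r * (x v : ℝ)) = r ^ 2 * (pairForm x : ℤ) := by
  simp only [pairForm]
  push_cast
  rw [Finset.mul_sum]
  exact Finset.sum_congr rfl fun i _ => by ring

theorem sumForm_mul {n : ℕ} [NeZero n] (r : ℝ) (x : LoopSite n → ℤ) :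
    sumForm (fun v => r * (x v : ℝ)) = r ^ 2 * (sumForm x : ℤ) := by
  simp only [sumForm, triSum]
  push_cast
  rw [Finset.mul_sum]
  exact Finset.sum_congr rfl fun i _ => by ring

section PlanarLoop

variable {n : ℕ} [NeZero n] {e : Config (LoopSite n)} {ν : R3}

/-- In-plane motions. Three unit vectors with zero sum have pairwise products -1/2, so the squared
norm of the combination with coefficients x is half the sum of the squared differences of x. The
value is the same for all planar minima. -/
theorem halfHessian_planar (hn : EdgesOfTriangles n) (he : e ∈ spinSpace (LoopSite n))
    (he0 : ∀ i, triSum e i = 0) (hν : ‖ν‖ = 1) (h : ∀ v, inner ℝ ν (e v) = 0)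
    (x : LoopSite n → ℝ) :
    halfHessian (heisenberg (triangleLoop n)) e (fun v => x v • planarCoord ν (e v)) =
      pairForm x := by
  rw [halfHessian_eq hn he he0, pairForm]
  refine Finset.sum_congr rfl fun i _ => ?_
  have h1 : triSum (fun v => tangentFrame (e v) (x v • planarCoord ν (e v))) i =
      (2 : ℝ) • cross ν (triSum (fun v => x v • e v) i) := by
    simp only [triSum, tangentFrame_real_smul, tangentFrame_planarCoord (he _)]
    simp [cross]
    module
  have h2 : ∀ y z : R3, ‖y‖ = 1 → ‖z‖ = 1 → ‖-(y + z)‖ = 1 → inner ℝ y z = -1 / 2 := by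
    intro y z hy hz hyz
    have h3 : ‖-(y + z)‖ ^ 2 = 1 := by rw [hyz, one_pow]
    rw [norm_neg, norm_add_sq_real, hy, hz] at h3
    linarith
  have ha : -(e (Sum.inl i) + e (Sum.inl (i + 1))) = e (Sum.inr i) :=
    neg_eq_of_add_eq_zero_right (he0 i)
  have hb : -(e (Sum.inl i) + e (Sum.inr i)) = e (Sum.inl (i + 1)) :=
    neg_eq_of_add_eq_zero_right (by rw [← he0 i, triSum]; abel)
  have hc : -(e (Sum.inl (i + 1)) + e (Sum.inr i)) = e (Sum.inl i) :=
    neg_eq_of_add_eq_zero_right (by rw [← he0 i, triSum]; abel)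
  have ia := h2 _ _ (he (Sum.inl i)) (he (Sum.inl (i + 1))) (by rw [ha, he])
  have ib := h2 _ _ (he (Sum.inl i)) (he (Sum.inr i)) (by rw [hb, he])
  have ic := h2 _ _ (he (Sum.inl (i + 1))) (he (Sum.inr i)) (by rw [hc, he])
  have h4 : inner ℝ ν (triSum (fun v => x v • e v) i) = 0 := by
    simp only [triSum, inner_add_right, inner_smul_right, h]
    ring
  rw [h1, norm_smul, mul_pow, ← real_inner_self_eq_norm_sq (cross _ _), inner_cross_cross, h4,
    real_inner_self_eq_norm_sq, real_inner_self_eq_norm_sq, hν, triSum, norm_add_sq_real,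
    norm_add_sq_real]
  simp only [inner_add_left, real_inner_smul_left, inner_smul_right, ia, ib, ic, norm_smul, he _,
    Real.norm_eq_abs, mul_one, sq_abs]
  ring

/-- Out-of-plane motions: all velocities are multiples of the normal ν, so their sums are scalar. -/
theorem halfHessian_planar_I (hn : EdgesOfTriangles n) (he : e ∈ spinSpace (LoopSite n))
    (he0 : ∀ i, triSum e i = 0) (hν : ‖ν‖ = 1) (h : ∀ v, inner ℝ ν (e v) = 0)
    (x : LoopSite n → ℝ) :
    halfHessian (heisenberg (triangleLoop n)) e
      (Complex.I • fun v => x v • planarCoord ν (e v)) = 2 * sumForm x := by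
  rw [halfHessian_eq hn he he0, sumForm, Finset.mul_sum]
  refine Finset.sum_congr rfl fun i _ => ?_
  have h1 : triSum (fun v => tangentFrame (e v) ((Complex.I •
      fun v => x v • planarCoord ν (e v)) v)) i = (2 * triSum x i) • ν := by
    simp only [triSum, Pi.smul_apply, smul_comm Complex.I, tangentFrame_real_smul, smul_eq_mul,
      tangentFrame_I_mul_planarCoord (he _) (h _)]
    module
  rw [h1, norm_smul, hν, Real.norm_eq_abs, mul_one, sq_abs]
  ring

theorem exists_halfHessian_eq_sumSq (hn : EdgesOfTriangles n) (he : e ∈ spinSpace (LoopSite n))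
    (he0 : ∀ i, triSum e i = 0) : ∃ c : ZMod n × Fin 3 → LoopSite n → ℂ,
      halfHessian (heisenberg (triangleLoop n)) e = sumSq c := by
  refine ⟨fun k => sumCovector e (loopTriangle n k.1) (rot 1 (EuclideanSpace.single k.2 1)), ?_⟩
  ext z
  rw [halfHessian_eq hn he he0, sumSq, Fintype.sum_prod_type]
  refine Finset.sum_congr rfl fun i _ => ?_
  simp only [herm_sumCovector_re_sq]
  rw [← Finset.sum_div, sum_inner_rot_single_sq, sum_loopTriangle hn]

/-- A real orthogonal basis of modes of the sites becomes a unitary basis of the tangent space, its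
real part in the plane and its imaginary part normal to it. The integer modes are normalised through
N. -/
theorem melinValue_planar_le (hn : EdgesOfTriangles n) (he : e ∈ spinSpace (LoopSite n))
    (he0 : ∀ i, triSum e i = 0) (hν : ‖ν‖ = 1) (h : ∀ v, inner ℝ ν (e v) = 0)
    {X : LoopSite n → LoopSite n → ℤ} {N : LoopSite n → ℤ} (hN : ∀ j, 0 < N j)
    (hX : ∀ j k, ∑ v, X j v * X k v = if j = k then N j else 0) {b : LoopSite n → ℝ}
    (hb : ∀ j, |b j| < 1) : melinValue (heisenberg (triangleLoop n)) e ≤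
      ∑ j, ((pairForm (X j) : ℤ) / N j / (2 * (1 - b j)) +
        2 * (sumForm (X j) : ℤ) / N j / (2 * (1 + b j))) := by
  obtain ⟨c, hc⟩ := exists_halfHessian_eq_sumSq hn he he0
  have hN' : ∀ j, (0 : ℝ) < N j := fun j => Int.cast_pos.2 (hN j)
  set O : Matrix (LoopSite n) (LoopSite n) ℝ := Matrix.of fun j v => (√(N j))⁻¹ * (X j v : ℝ)
    with hO
  have hOO : O * Oᵀ = 1 := by
    ext j k
    rw [Matrix.mul_apply]
    have h1 : ∑ v, O j v * Oᵀ v k = (√(N j))⁻¹ * (√(N k))⁻¹ * (∑ v, X j v * X k v : ℤ) := by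
      push_cast
      rw [Finset.mul_sum]
      refine Finset.sum_congr rfl fun v _ => ?_
      simp only [hO, Matrix.of_apply, Matrix.transpose_apply]
      ring
    rw [h1, hX]
    by_cases hjk : j = k
    · subst hjk
      rw [if_pos rfl, Matrix.one_apply_eq, ← mul_inv, Real.mul_self_sqrt (hN' j).le,
        inv_mul_cancel₀ (hN' j).ne']
    · rw [if_neg hjk, Matrix.one_apply_ne hjk, Int.cast_zero, mul_zero]
  have hOO' : Oᵀ * O = 1 := mul_eq_one_comm.1 hOO
  have hcc : ∀ v, (starRingEnd ℂ) (planarCoord ν (e v)) * planarCoord ν (e v) = 1 := fun v => by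
    rw [← Complex.normSq_eq_conj_mul_self, Complex.normSq_eq_norm_sq,
      norm_sq_planarCoord hν (he v) (h v), Complex.ofReal_one]
  set η : LoopSite n → LoopSite n → ℂ := fun j v => O j v • planarCoord ν (e v) with hη
  have h1 : ∀ j k, herm (η j) (η k) = if j = k then 1 else 0 := fun j k => by
    have : herm (η j) (η k) = ((O * Oᵀ) j k : ℝ) := by
      rw [herm, Matrix.mul_apply, Complex.ofReal_sum]
      refine Finset.sum_congr rfl fun v _ => ?_
      simp only [hη, Complex.real_smul, map_mul, Complex.conj_ofReal, Matrix.transpose_apply]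
      push_cast
      linear_combination (O j v : ℂ) * O k v * hcc v
    rw [this, hOO, Matrix.one_apply]
    split_ifs <;> simp
  have h2 : ∀ z : LoopSite n → ℂ, ∑ j, herm (η j) z • η j = z := fun z => by
    ext v
    rw [Finset.sum_apply]
    have : ∀ w, ∑ j, (O j w : ℂ) * O j v = if w = v then 1 else 0 := fun w => by
      have h3 := congrFun (congrFun hOO' w) v
      rw [Matrix.mul_apply, Matrix.one_apply] at h3
      have h4 : ((∑ j, O j w * O j v : ℝ) : ℂ) = ((if w = v then 1 else 0 : ℝ) : ℂ) :=
        congrArg _ h3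
      push_cast at h4
      rw [h4]
      split_ifs <;> simp
    have h5 : ∑ j, (herm (η j) z • η j) v = ∑ w, (starRingEnd ℂ) (planarCoord ν (e w)) * z w *
        planarCoord ν (e v) * (∑ j, (O j w : ℂ) * O j v) := by
        simp only [herm, Pi.smul_apply, smul_eq_mul, Finset.sum_mul, Finset.mul_sum]
        rw [Finset.sum_comm]
        refine Finset.sum_congr rfl fun w _ => Finset.sum_congr rfl fun j _ => ?_
        simp only [hη, Complex.real_smul, map_mul, Complex.conj_ofReal]
        ring
    rw [h5]
    simp only [this, mul_ite, mul_one, mul_zero, Finset.sum_ite_eq', Finset.mem_univ, if_true]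
    linear_combination z v * hcc v
  have key := melinValueForm_le_of_squeezed h1 h2 hb c
  rw [← hc] at key
  refine le_trans key (le_of_eq ?_)
  refine Finset.sum_congr rfl fun j _ => ?_
  have h5 : (√(N j))⁻¹ ^ 2 = (N j : ℝ)⁻¹ := by rw [inv_pow, Real.sq_sqrt (hN' j).le]
  rw [hη, halfHessian_planar hn he he0 hν h, halfHessian_planar_I hn he he0 hν h]
  change pairForm (fun v => (√(N j))⁻¹ * (X j v : ℝ)) / _ +
    2 * sumForm (fun v => (√(N j))⁻¹ * (X j v : ℝ)) / _ = _
  rw [pairForm_mul, sumForm_mul, h5]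
  ring

end PlanarLoop

/-- An orthogonal basis adapted to the Hessian at the planar configurations. -/
def planarMode : LoopSite 4 → LoopSite 4 → ℤ :=
  Sum.elim
    (![Sum.elim (![2, 2, 2, 2] : Fin 4 → ℤ) (![1, 1, 1, 1] : Fin 4 → ℤ),
      Sum.elim (![1, 1, -1, -1] : Fin 4 → ℤ) (![1, 0, -1, 0] : Fin 4 → ℤ),
      Sum.elim (![0, 0, 0, 0] : Fin 4 → ℤ) (![1, -1, 1, -1] : Fin 4 → ℤ),
      Sum.elim (![-1, 1, 1, -1] : Fin 4 → ℤ) (![0, 1, 0, -1] : Fin 4 → ℤ)] :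
        Fin 4 → LoopSite 4 → ℤ)
    (![Sum.elim (![1, 1, 1, 1] : Fin 4 → ℤ) (![-2, -2, -2, -2] : Fin 4 → ℤ),
      Sum.elim (![1, 1, -1, -1] : Fin 4 → ℤ) (![-2, 0, 2, 0] : Fin 4 → ℤ),
      Sum.elim (![1, -1, 1, -1] : Fin 4 → ℤ) (![0, 0, 0, 0] : Fin 4 → ℤ),
      Sum.elim (![-1, 1, 1, -1] : Fin 4 → ℤ) (![0, -2, 0, 2] : Fin 4 → ℤ)] :
        Fin 4 → LoopSite 4 → ℤ)

/-- The squares of the norms of the basis. -/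
def planarModeSq : LoopSite 4 → ℤ :=
  Sum.elim (![20, 6, 4, 6] : Fin 4 → ℤ) (![20, 12, 4, 12] : Fin 4 → ℤ)

theorem planarMode_orthogonal (j k : LoopSite 4) :
    ∑ v, planarMode j v * planarMode k v = if j = k then planarModeSq j else 0 := by
  revert j k
  decide +kernel

theorem pairForm_planarMode (j : LoopSite 4) : pairForm (planarMode j) =
    (Sum.elim (![8, 12, 8, 12] : Fin 4 → ℤ) (![72, 48, 24, 48] : Fin 4 → ℤ) : LoopSite 4 → ℤ) j := by
  revert j
  decide +kernel

theorem sumForm_planarMode (j : LoopSite 4) : sumForm (planarMode j) =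
    (Sum.elim (![100, 18, 4, 18] : Fin 4 → ℤ) (![0, 0, 0, 0] : Fin 4 → ℤ) : LoopSite 4 → ℤ) j := by
  revert j
  decide +kernel

theorem sum_loopSite_four {E : Type*} [AddCommMonoid E] (f : LoopSite 4 → E) :
    ∑ v, f v = f (Sum.inl (0 : Fin 4)) + f (Sum.inl (1 : Fin 4)) + f (Sum.inl (2 : Fin 4)) +
      f (Sum.inl (3 : Fin 4)) + (f (Sum.inr (0 : Fin 4)) + f (Sum.inr (1 : Fin 4)) +
      f (Sum.inr (2 : Fin 4)) + f (Sum.inr (3 : Fin 4))) := by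
  rw [Fintype.sum_sum_type, sum_zmod_four, sum_zmod_four]
  rfl

theorem melinValue_planar_le_value {e : Config (LoopSite 4)} (he : e ∈ spinSpace (LoopSite 4))
    (he0 : ∀ i, triSum e i = 0) (hp : IsPlanar e) :
    melinValue (heisenberg (triangleLoop 4)) e ≤ 14 + 2 * √3 := by
  obtain ⟨m, hm0, hm⟩ := hp
  have hν : ‖‖m‖⁻¹ • m‖ = 1 := by
    rw [norm_smul, norm_inv, norm_norm, inv_mul_cancel₀ (norm_ne_zero_iff.2 hm0)]
  have h : ∀ v, inner ℝ (‖m‖⁻¹ • m) (e v) = 0 := fun v => by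
    rw [real_inner_smul_left, hm, mul_zero]
  obtain ⟨hr1, hr2⟩ := sqrt_three_bounds
  have key : ∀ b ∈ Set.Ioo (-1 : ℝ) 0, melinValue (heisenberg (triangleLoop 4)) e ≤
      48 / 5 + 2 * √3 + 44 / 5 / (1 - b) := by
    intro b hb
    have hb2 : 1 - b ≠ 0 := by linarith [hb.2]
    -- The modes in the first half have (α, β) = (2/5, 10), (2, 6), (2, 2), (2, 6), and the entries
    -- are the optimal parameters of each; their contributions are 18/5, 2 + √3, 2, 2 + √3. On the
    -- second half `sumForm` vanishes, so the optimal value is a limit and b is kept free.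
    set β : LoopSite 4 → ℝ := Sum.elim (![2 / 3, 2 - √3, 0, 2 - √3] : Fin 4 → ℝ) (fun _ => b)
    refine le_trans (melinValue_planar_le edgesOfTriangles_four he he0 hν h (N := planarModeSq)
      (X := planarMode) (by decide) planarMode_orthogonal (b := β) ?_) (le_of_eq ?_)
    · rintro (i | i)
      · change Fin 4 at i
        fin_cases i
        · change |(2 / 3 : ℝ)| < 1
          norm_num [abs_lt]
        · change |2 - √3| < 1
          exact abs_lt.2 ⟨by linarith, by linarith⟩
        · change |(0 : ℝ)| < 1
          norm_num
        · change |2 - √3| < 1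
          exact abs_lt.2 ⟨by linarith, by linarith⟩
      · change |b| < 1
        exact abs_lt.2 ⟨hb.1, by linarith [hb.2]⟩
    · rw [sum_loopSite_four]
      simp only [pairForm_planarMode, sumForm_planarMode, planarModeSq, β]
      change ((8 : ℤ) : ℝ) / (20 : ℤ) / (2 * (1 - 2 / 3)) +
          2 * ((100 : ℤ) : ℝ) / (20 : ℤ) / (2 * (1 + 2 / 3)) +
        (((12 : ℤ) : ℝ) / (6 : ℤ) / (2 * (1 - (2 - √3))) +
          2 * ((18 : ℤ) : ℝ) / (6 : ℤ) / (2 * (1 + (2 - √3)))) +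
        (((8 : ℤ) : ℝ) / (4 : ℤ) / (2 * (1 - 0)) + 2 * ((4 : ℤ) : ℝ) / (4 : ℤ) / (2 * (1 + 0))) +
        (((12 : ℤ) : ℝ) / (6 : ℤ) / (2 * (1 - (2 - √3))) +
          2 * ((18 : ℤ) : ℝ) / (6 : ℤ) / (2 * (1 + (2 - √3)))) +
        (((72 : ℤ) : ℝ) / (20 : ℤ) / (2 * (1 - b)) + 2 * ((0 : ℤ) : ℝ) / (20 : ℤ) / (2 * (1 + b)) +
        (((48 : ℤ) : ℝ) / (12 : ℤ) / (2 * (1 - b)) + 2 * ((0 : ℤ) : ℝ) / (12 : ℤ) / (2 * (1 + b))) +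
        (((24 : ℤ) : ℝ) / (4 : ℤ) / (2 * (1 - b)) + 2 * ((0 : ℤ) : ℝ) / (4 : ℤ) / (2 * (1 + b))) +
        (((48 : ℤ) : ℝ) / (12 : ℤ) / (2 * (1 - b)) +
          2 * ((0 : ℤ) : ℝ) / (12 : ℤ) / (2 * (1 + b)))) = _
      push_cast
      have h1 : 12 / 6 / (2 * (1 - (2 - √3))) = (1 + √3) / 2 := by
        rw [div_eq_iff (by linarith)]
        linear_combination -sqrt_three_sq
      have h2 : 2 * 18 / 6 / (2 * (1 + (2 - √3))) = (3 + √3) / 2 := by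
        rw [div_eq_iff (by linarith)]
        linear_combination sqrt_three_sq
      rw [h1, h2]
      field_simp
      ring
  -- The excluded endpoint b = -1 would be an infinitely squeezed state; in the limit the last four
  -- modes contribute 22/5.
  have hlim : Filter.Tendsto (fun b : ℝ => 48 / 5 + 2 * √3 + 44 / 5 / (1 - b))
      (nhdsWithin (-1) (Set.Ioi (-1))) (nhds (48 / 5 + 2 * √3 + 44 / 5 / (1 - -1))) := by
    have : ContinuousAt (fun b : ℝ => 48 / 5 + 2 * √3 + 44 / 5 / (1 - b)) (-1) :=
      continuousAt_const.add (continuousAt_const.div (by fun_prop) (by norm_num))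
    exact this.tendsto.mono_left nhdsWithin_le_nhds
  have hge := ge_of_tendsto hlim (by
    filter_upwards [Ioo_mem_nhdsGT (show (-1 : ℝ) < 0 by norm_num)] with b hb using key b hb)
  linarith

end

noncomputable section

/-! ### The three circles -/

theorem vecA_zero (t : ℝ) : vecA t 0 = (1 - 3 * Real.cos t) / 4 := by simp [vecA]
theorem vecA_one (t : ℝ) : vecA t 1 = -√3 * (1 + Real.cos t) / 4 := by simp [vecA]
theorem vecA_two (t : ℝ) : vecA t 2 = √3 * Real.sin t / 2 := by simp [vecA]
theorem vecB_zero (t : ℝ) : vecB t 0 = (1 - 3 * Real.cos t) / 4 := by simp [vecB]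
theorem vecB_one (t : ℝ) : vecB t 1 = √3 * (1 + Real.cos t) / 4 := by simp [vecB]
theorem vecB_two (t : ℝ) : vecB t 2 = √3 * Real.sin t / 2 := by simp [vecB]
theorem vecD_zero (t : ℝ) : vecD t 0 = (7 + 9 * Real.cos t) / (2 * (5 + 3 * Real.cos t)) := by
  simp [vecD]
theorem vecD_one (t : ℝ) : vecD t 1 = √3 * (1 - Real.cos t) / (2 * (5 + 3 * Real.cos t)) := by
  simp [vecD]
theorem vecD_two (t : ℝ) : vecD t 2 = -2 * √3 * Real.sin t / (5 + 3 * Real.cos t) := by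
  simp [vecD]

theorem contDiff_r3 {f : ℝ → R3} (h0 : ContDiff ℝ ∞ fun t => f t 0)
    (h1 : ContDiff ℝ ∞ fun t => f t 1) (h2 : ContDiff ℝ ∞ fun t => f t 2) : ContDiff ℝ ∞ f := by
  refine contDiff_euclidean.2 fun i => ?_
  fin_cases i
  exacts [h0, h1, h2]

theorem contDiff_vecA : ContDiff ℝ ∞ vecA := by
  refine contDiff_r3 ?_ ?_ ?_
  · simp only [vecA_zero]; fun_prop
  · simp only [vecA_one]; fun_prop
  · simp only [vecA_two]; fun_prop

theorem contDiff_vecB : ContDiff ℝ ∞ vecB := by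
  refine contDiff_r3 ?_ ?_ ?_
  · simp only [vecB_zero]; fun_prop
  · simp only [vecB_one]; fun_prop
  · simp only [vecB_two]; fun_prop

theorem contDiff_vecD : ContDiff ℝ ∞ vecD := by
  have h : ∀ t, 5 + 3 * Real.cos t ≠ 0 := fun t => (five_add_pos t).ne'
  refine contDiff_r3 ?_ ?_ ?_
  · simp only [vecD_zero]
    exact ContDiff.div (by fun_prop) (by fun_prop) fun t => mul_ne_zero two_ne_zero (h t)
  · simp only [vecD_one]
    exact ContDiff.div (by fun_prop) (by fun_prop) fun t => mul_ne_zero two_ne_zero (h t)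
  · simp only [vecD_two]
    exact ContDiff.div (by fun_prop) (by fun_prop) h

theorem contDiff_gaugeConfig {a b : ℝ → R3} (ha : ContDiff ℝ ∞ a) (hb : ContDiff ℝ ∞ b) :
    ContDiff ℝ ∞ fun t => gaugeConfig (a t) (b t) := by
  refine contDiff_pi.2 fun v => ?_
  rcases v with i | i
  · change Fin 4 at i
    fin_cases i
    exacts [contDiff_const, contDiff_const, ha, hb]
  · change Fin 4 at i
    fin_cases i
    exacts [contDiff_const (c := -(vecU + vecV)), ((contDiff_const (c := vecV)).add ha).neg,
      (ha.add hb).neg, (hb.add (contDiff_const (c := vecU))).neg]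

/-- The variation of the configuration when the third and fourth vectors vary. -/
def gaugeTangent (a b : R3) : Config (LoopSite 4) :=
  loopConfig (n := 4) (![0, 0, a, b] : Fin 4 → R3)

theorem gaugeTangent_eq_zero {a b : R3} (h : gaugeTangent a b = 0) : a = 0 ∧ b = 0 :=
  ⟨congrFun h (Sum.inl (2 : Fin 4)), congrFun h (Sum.inl (3 : Fin 4))⟩

theorem smul_add_smul_gaugeTangent (r s : ℝ) (a b a' b' : R3) :
    r • gaugeTangent a b + s • gaugeTangent a' b' =
      gaugeTangent (r • a + s • a') (r • b + s • b') := by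
  have h0 : r • (0 : R3) + s • (0 : R3) = 0 := by simp
  have h1 : ∀ x y x' y' : R3, r • -(x + y) + s • -(x' + y') =
    -((r • x + s • x') + (r • y + s • y')) := fun x y x' y' => by module
  ext1 v
  rcases v with i | i
  · change Fin 4 at i
    fin_cases i
    exacts [h0, h0, rfl, rfl]
  · change Fin 4 at i
    fin_cases i
    · refine (h1 0 0 0 0).trans ?_
      rw [h0]
      rfl
    · refine (h1 0 a 0 a').trans ?_
      rw [h0]
      rfl
    · exact h1 a b a' b'
    · refine (h1 b 0 b' 0).trans ?_
      rw [h0]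
      rfl

theorem hasDerivAt_gaugeConfig {a b : ℝ → R3} {t : ℝ} (ha : DifferentiableAt ℝ a t)
    (hb : DifferentiableAt ℝ b t) :
    HasDerivAt (fun t => gaugeConfig (a t) (b t))
      (gaugeTangent (deriv a t) (deriv b t)) t := by
  have h0 : ∀ x : R3, HasDerivAt (fun _ : ℝ => x) 0 t := fun x => hasDerivAt_const t x
  refine hasDerivAt_pi.2 fun v => ?_
  rcases v with i | i
  · change Fin 4 at i
    fin_cases i
    exacts [h0 _, h0 _, ha.hasDerivAt, hb.hasDerivAt]
  · change Fin 4 at i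
    fin_cases i
    exacts [((h0 _).add (h0 _)).neg, ((h0 _).add ha.hasDerivAt).neg,
      (ha.hasDerivAt.add hb.hasDerivAt).neg, (hb.hasDerivAt.add (h0 _)).neg]

theorem hasDerivAt_coord {f : ℝ → R3} {t : ℝ} (hf : DifferentiableAt ℝ f t) (i : Fin 3) :
    HasDerivAt (fun t => f t i) (deriv f t i) t :=
  ((EuclideanSpace.proj i : R3 →L[ℝ] ℝ).hasFDerivAt.comp_hasDerivAt t hf.hasDerivAt)

theorem deriv_vecA_zero (t : ℝ) : deriv vecA t 0 = 3 * Real.sin t / 4 := by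
  have h := hasDerivAt_coord (contDiff_vecA.differentiable (by simp) t) 0
  simp only [vecA_zero] at h
  refine h.unique ?_
  refine ((((Real.hasDerivAt_cos t).const_mul 3).const_sub 1).div_const 4).congr_deriv ?_
  ring

theorem deriv_vecA_two (t : ℝ) : deriv vecA t 2 = √3 * Real.cos t / 2 := by
  have h := hasDerivAt_coord (contDiff_vecA.differentiable (by simp) t) 2
  simp only [vecA_two] at h
  exact h.unique (((Real.hasDerivAt_sin t).const_mul √3).div_const 2)

theorem deriv_vecB_zero (t : ℝ) : deriv vecB t 0 = 3 * Real.sin t / 4 := by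
  have h := hasDerivAt_coord (contDiff_vecB.differentiable (by simp) t) 0
  simp only [vecB_zero] at h
  refine h.unique ?_
  refine ((((Real.hasDerivAt_cos t).const_mul 3).const_sub 1).div_const 4).congr_deriv ?_
  ring

theorem deriv_vecB_two (t : ℝ) : deriv vecB t 2 = √3 * Real.cos t / 2 := by
  have h := hasDerivAt_coord (contDiff_vecB.differentiable (by simp) t) 2
  simp only [vecB_two] at h
  exact h.unique (((Real.hasDerivAt_sin t).const_mul √3).div_const 2)

/-- At the common point of the second and third circles the third vector has the same velocity on
both, so transversality hinges on the fourth vector moving on the third circle. -/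
theorem deriv_vecD_two_pi : deriv vecD Real.pi 2 = √3 := by
  have h := hasDerivAt_coord (contDiff_vecD.differentiable (by simp) Real.pi) 2
  simp only [vecD_two] at h
  refine h.unique ?_
  refine (((Real.hasDerivAt_sin Real.pi).const_mul (-2 * √3)).div
    (((Real.hasDerivAt_cos Real.pi).const_mul 3).const_add 5) (five_add_pos _).ne').congr_deriv ?_
  rw [Real.sin_pi, Real.cos_pi]
  ring

theorem sqrt_three_ne_zero : √3 ≠ (0 : ℝ) := (Real.sqrt_pos.2 (by norm_num)).ne'

theorem deriv_vecA_ne_zero (t : ℝ) : deriv vecA t ≠ 0 := by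
  intro h
  have h0 := deriv_vecA_zero t
  have h2 := deriv_vecA_two t
  rw [h, PiLp.zero_apply] at h0 h2
  have h3 : Real.cos t = 0 := by
    have : √3 * Real.cos t = 0 := by linarith
    exact (mul_eq_zero.1 this).resolve_left sqrt_three_ne_zero
  have := Real.sin_sq_add_cos_sq t
  rw [h3, show Real.sin t = 0 by linarith] at this
  norm_num at this

theorem deriv_vecB_ne_zero (t : ℝ) : deriv vecB t ≠ 0 := by
  intro h
  have h0 := deriv_vecB_zero t
  have h2 := deriv_vecB_two t
  rw [h, PiLp.zero_apply] at h0 h2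
  have h3 : Real.cos t = 0 := by
    have : √3 * Real.cos t = 0 := by linarith
    exact (mul_eq_zero.1 this).resolve_left sqrt_three_ne_zero
  have := Real.sin_sq_add_cos_sq t
  rw [h3, show Real.sin t = 0 by linarith] at this
  norm_num at this

/-- The three circles. -/
def gaugeCircle : Fin 3 → ℝ → Config (LoopSite 4) :=
  ![fun t => gaugeConfig vecU (vecB t), fun t => gaugeConfig (vecA t) vecV,
    fun t => gaugeConfig (vecA t) (vecD t)]

theorem gaugeConfig_inj {a b a' b' : R3} :
    gaugeConfig a b = gaugeConfig a' b' ↔ a = a' ∧ b = b' := by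
  constructor
  · intro h
    exact ⟨congrFun h (Sum.inl (2 : Fin 4)), congrFun h (Sum.inl (3 : Fin 4))⟩
  · rintro ⟨rfl, rfl⟩
    rfl

theorem cos_sin_eq_iff {s t : ℝ} : (Real.cos s = Real.cos t ∧ Real.sin s = Real.sin t) ↔
    ∃ k : ℤ, s = t + k * (2 * Real.pi) := by
  constructor
  · rintro ⟨h1, h2⟩
    obtain ⟨k, hk⟩ := Real.Angle.angle_eq_iff_two_pi_dvd_sub.1 (Real.Angle.cos_sin_inj h1 h2)
    exact ⟨k, by linarith⟩
  · rintro ⟨k, rfl⟩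
    exact ⟨Real.cos_add_int_mul_two_pi t k, Real.sin_add_int_mul_two_pi t k⟩

theorem vecA_inj {s t : ℝ} : vecA s = vecA t ↔ ∃ k : ℤ, s = t + k * (2 * Real.pi) := by
  rw [← cos_sin_eq_iff]
  constructor
  · intro h
    have h0 : vecA s 0 = vecA t 0 := by rw [h]
    have h2 : vecA s 2 = vecA t 2 := by rw [h]
    rw [vecA_zero, vecA_zero] at h0
    rw [vecA_two, vecA_two] at h2
    exact ⟨by linarith, mul_left_cancel₀ sqrt_three_ne_zero (by linarith)⟩
  · rintro ⟨h1, h2⟩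
    rw [vecA, vecA, h1, h2]

theorem vecB_inj {s t : ℝ} : vecB s = vecB t ↔ ∃ k : ℤ, s = t + k * (2 * Real.pi) := by
  rw [← cos_sin_eq_iff]
  constructor
  · intro h
    have h0 : vecB s 0 = vecB t 0 := by rw [h]
    have h2 : vecB s 2 = vecB t 2 := by rw [h]
    rw [vecB_zero, vecB_zero] at h0
    rw [vecB_two, vecB_two] at h2
    exact ⟨by linarith, mul_left_cancel₀ sqrt_three_ne_zero (by linarith)⟩
  · rintro ⟨h1, h2⟩
    rw [vecB, vecB, h1, h2]

theorem vecD_eq_of_vecA_eq {s t : ℝ} (h : vecA s = vecA t) : vecD s = vecD t := by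
  obtain ⟨h1, h2⟩ := cos_sin_eq_iff.2 (vecA_inj.1 h)
  rw [vecD, vecD, h1, h2]

theorem differentiable_vec :
    Differentiable ℝ vecA ∧ Differentiable ℝ vecB ∧ Differentiable ℝ vecD :=
  ⟨contDiff_vecA.differentiable (by simp), contDiff_vecB.differentiable (by simp),
    contDiff_vecD.differentiable (by simp)⟩

theorem deriv_gaugeCircle (i : Fin 3) (t : ℝ) : deriv (gaugeCircle i) t =
    (![gaugeTangent 0 (deriv vecB t), gaugeTangent (deriv vecA t) 0,
      gaugeTangent (deriv vecA t) (deriv vecD t)] : Fin 3 → Config (LoopSite 4)) i := by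
  obtain ⟨hA, hB, hD⟩ := differentiable_vec
  fin_cases i
  · refine (hasDerivAt_gaugeConfig (differentiableAt_const vecU) (hB t)).deriv.trans ?_
    rw [deriv_const]
    rfl
  · refine (hasDerivAt_gaugeConfig (hA t) (differentiableAt_const vecV)).deriv.trans ?_
    rw [deriv_const]
    rfl
  · exact (hasDerivAt_gaugeConfig (hA t) (hD t)).deriv

theorem deriv_gaugeCircle_ne_zero (i : Fin 3) (t : ℝ) : deriv (gaugeCircle i) t ≠ 0 := by
  rw [deriv_gaugeCircle]
  intro h
  fin_cases i
  · exact deriv_vecB_ne_zero t (gaugeTangent_eq_zero h).2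
  · exact deriv_vecA_ne_zero t (gaugeTangent_eq_zero h).1
  · exact deriv_vecA_ne_zero t (gaugeTangent_eq_zero h).1

theorem isEmbeddedCircle_gaugeCircle (i : Fin 3) : IsEmbeddedCircle (gaugeCircle i) := by
  refine ⟨?_, deriv_gaugeCircle_ne_zero i, fun s t => ?_⟩
  · fin_cases i
    exacts [contDiff_gaugeConfig contDiff_const contDiff_vecB,
      contDiff_gaugeConfig contDiff_vecA contDiff_const,
      contDiff_gaugeConfig contDiff_vecA contDiff_vecD]
  · fin_cases i
    · exact gaugeConfig_inj.trans ((and_iff_right rfl).trans vecB_inj)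
    · exact gaugeConfig_inj.trans ((and_iff_left rfl).trans vecA_inj)
    · exact gaugeConfig_inj.trans ((and_iff_left_of_imp vecD_eq_of_vecA_eq).trans vecA_inj)

/-! ### Transversality -/

/-- An infinitesimal rotation that fixes the first two vectors is trivial. -/
theorem gaugeTangent_eq_zero_of_mem {a b x y : R3}
    (h : gaugeTangent x y ∈ orbitTangent (gaugeConfig a b)) : gaugeTangent x y = 0 := by
  obtain ⟨r, hr⟩ := h
  have h0 : cross r vecU = 0 := congrFun hr (Sum.inl (0 : Fin 4))
  have h1 : cross r vecV = 0 := congrFun hr (Sum.inl (1 : Fin 4))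
  rw [← hr]
  have h3 := sqrt_three_ne_zero
  have e0 : cross r vecU 0 = 0 := by rw [h0, PiLp.zero_apply]
  have e1 : cross r vecU 1 = 0 := by rw [h0, PiLp.zero_apply]
  have e2 : cross r vecU 2 = 0 := by rw [h0, PiLp.zero_apply]
  have e3 : cross r vecV 2 = 0 := by rw [h1, PiLp.zero_apply]
  rw [cross_zero_apply] at e0
  rw [cross_one_apply] at e1
  rw [cross_two_apply] at e2 e3
  simp [vecU, vecV] at e0 e1 e2 e3
  have hr : r = 0 := by
    refine r3_ext ?_ ?_ ?_
    · have : r 0 * √3 = 0 := by linarith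
      exact (mul_eq_zero.1 this).resolve_right h3
    · have : r 1 = 0 := by linarith
      exact this
    · simpa using e1
  ext1 v
  rw [hr]
  simp [cross]

theorem deriv_gaugeCircle_notMem (i : Fin 3) (t : ℝ) :
    deriv (gaugeCircle i) t ∉ orbitTangent (gaugeCircle i t) := by
  intro h
  refine deriv_gaugeCircle_ne_zero i t ?_
  rw [deriv_gaugeCircle] at h ⊢
  fin_cases i <;> exact gaugeTangent_eq_zero_of_mem h

/-- The curves meet at exactly one point, transversally also modulo rotations. -/
def MeetTransversally (f g : ℝ → Config (LoopSite 4)) : Prop :=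
  ∃ s t, f s = g t ∧ Set.range f ∩ Set.range g = {f s} ∧
    ∀ a b : ℝ, a • deriv f s + b • deriv g t ∈ orbitTangent (f s) → a = 0 ∧ b = 0

theorem MeetTransversally.symm {f g : ℝ → Config (LoopSite 4)} (h : MeetTransversally f g) :
    MeetTransversally g f := by
  obtain ⟨s, t, h1, h2, h3⟩ := h
  refine ⟨t, s, h1.symm, by rw [Set.inter_comm, h2, h1], fun a b hab => ?_⟩
  rw [← h1, add_comm] at hab
  exact (h3 b a hab).symm

theorem vecA_eq_vecU {t : ℝ} (h : Real.cos t = 1) : vecA t = vecU ∧ vecD t = vecW := by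
  have h1 : Real.sin t = 0 := by
    have := Real.sin_sq_add_cos_sq t
    rw [h] at this
    exact pow_eq_zero_iff two_ne_zero |>.1 (by linarith)
  constructor <;> refine r3_ext ?_ ?_ ?_ <;>
    simp [vecA, vecU, vecD, vecW, h, h1] <;> norm_num
  ring

theorem vecB_eq_vecV {t : ℝ} (h : Real.cos t = 1) : vecB t = vecV := by
  have h1 : Real.sin t = 0 := by
    have := Real.sin_sq_add_cos_sq t
    rw [h] at this
    exact pow_eq_zero_iff two_ne_zero |>.1 (by linarith)
  refine r3_ext ?_ ?_ ?_ <;> simp [vecB, vecV, h, h1] <;> norm_num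
  ring

theorem vecA_eq_vecW {t : ℝ} (h : Real.cos t = -1) :
    vecA t = vecW ∧ vecB t = vecW ∧ vecD t = vecV := by
  have h1 : Real.sin t = 0 := by
    have := Real.sin_sq_add_cos_sq t
    rw [h] at this
    exact pow_eq_zero_iff two_ne_zero |>.1 (by linarith)
  refine ⟨?_, ?_, ?_⟩ <;> refine r3_ext ?_ ?_ ?_ <;>
    simp [vecA, vecB, vecW, vecD, vecV, h, h1] <;> norm_num
  ring

theorem cos_eq_one_of_vecA_eq {t : ℝ} (h : vecA t = vecU) : Real.cos t = 1 := by
  have h0 : vecA t 0 = vecU 0 := by rw [h]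
  rw [vecA_zero] at h0
  simp [vecU] at h0
  linarith

theorem cos_eq_neg_one_of_vecD_eq {t : ℝ} (h : vecD t = vecV) : Real.cos t = -1 := by
  have h0 : vecD t 0 = vecV 0 := by rw [h]
  have h5 := five_add_pos t
  rw [vecD_zero, div_eq_iff (by linarith)] at h0
  simp [vecV] at h0
  linarith

theorem eq_zero_of_smul {x : R3} {a : ℝ} (h : a • x = 0) (hx : x ≠ 0) : a = 0 :=
  (smul_eq_zero.1 h).resolve_right hx

theorem meetTransversally_zero_one : MeetTransversally (gaugeCircle 0) (gaugeCircle 1) := by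
  have e1 : gaugeCircle 0 0 = gaugeConfig vecU vecV := by
    simp [gaugeCircle, vecB_eq_vecV Real.cos_zero]
  have e2 : gaugeCircle 1 0 = gaugeConfig vecU vecV := by
    simp [gaugeCircle, vecA_eq_vecU Real.cos_zero]
  refine ⟨0, 0, by rw [e1, e2], ?_, fun a b hab => ?_⟩
  · refine Set.Subset.antisymm ?_ (Set.singleton_subset_iff.2 ⟨⟨0, rfl⟩, ⟨0, by rw [e1, e2]⟩⟩)
    rintro _ ⟨⟨s, rfl⟩, ⟨t, ht⟩⟩
    have h := gaugeConfig_inj.1 (show gaugeConfig (vecA t) vecV = gaugeConfig vecU (vecB s) from ht)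
    rw [e1]
    exact gaugeConfig_inj.2 ⟨rfl, h.2.symm⟩
  · rw [e1, deriv_gaugeCircle, deriv_gaugeCircle] at hab
    change a • gaugeTangent 0 (deriv vecB 0) + b • gaugeTangent (deriv vecA 0) 0 ∈ _ at hab
    rw [smul_add_smul_gaugeTangent, smul_zero, smul_zero, zero_add, add_zero] at hab
    obtain ⟨h1, h2⟩ := gaugeTangent_eq_zero (gaugeTangent_eq_zero_of_mem hab)
    exact ⟨eq_zero_of_smul h2 (deriv_vecB_ne_zero 0), eq_zero_of_smul h1 (deriv_vecA_ne_zero 0)⟩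

theorem meetTransversally_zero_two : MeetTransversally (gaugeCircle 0) (gaugeCircle 2) := by
  have e1 : gaugeCircle 0 Real.pi = gaugeConfig vecU vecW := by
    simp [gaugeCircle, vecA_eq_vecW Real.cos_pi]
  have e2 : gaugeCircle 2 0 = gaugeConfig vecU vecW := by
    simp [gaugeCircle, vecA_eq_vecU Real.cos_zero]
  refine ⟨Real.pi, 0, by rw [e1, e2], ?_, fun a b hab => ?_⟩
  · refine Set.Subset.antisymm ?_ (Set.singleton_subset_iff.2 ⟨⟨_, rfl⟩, ⟨0, by rw [e1, e2]⟩⟩)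
    rintro _ ⟨⟨s, rfl⟩, ⟨t, ht⟩⟩
    have h := gaugeConfig_inj.1
      (show gaugeConfig (vecA t) (vecD t) = gaugeConfig vecU (vecB s) from ht)
    rw [e1]
    exact gaugeConfig_inj.2 ⟨rfl, by rw [← h.2, (vecA_eq_vecU (cos_eq_one_of_vecA_eq h.1)).2]⟩
  · rw [e1, deriv_gaugeCircle, deriv_gaugeCircle] at hab
    change a • gaugeTangent 0 (deriv vecB Real.pi) +
      b • gaugeTangent (deriv vecA 0) (deriv vecD 0) ∈ _ at hab
    rw [smul_add_smul_gaugeTangent, smul_zero, zero_add] at hab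
    obtain ⟨h1, h2⟩ := gaugeTangent_eq_zero (gaugeTangent_eq_zero_of_mem hab)
    have hb := eq_zero_of_smul h1 (deriv_vecA_ne_zero 0)
    rw [hb, zero_smul, add_zero] at h2
    exact ⟨eq_zero_of_smul h2 (deriv_vecB_ne_zero _), hb⟩

/-- The velocities have the form (A', 0) and (A', D') with D' ≠ 0. Working with the first two
vectors fixed makes independence modulo rotations the same as independence. -/
theorem meetTransversally_one_two : MeetTransversally (gaugeCircle 1) (gaugeCircle 2) := by
  have e1 : gaugeCircle 1 Real.pi = gaugeConfig vecW vecV := by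
    simp [gaugeCircle, vecA_eq_vecW Real.cos_pi]
  have e2 : gaugeCircle 2 Real.pi = gaugeConfig vecW vecV := by
    simp [gaugeCircle, vecA_eq_vecW Real.cos_pi]
  refine ⟨Real.pi, Real.pi, by rw [e1, e2], ?_, fun a b hab => ?_⟩
  · refine Set.Subset.antisymm ?_ (Set.singleton_subset_iff.2 ⟨⟨_, rfl⟩, ⟨_, by rw [e1, e2]⟩⟩)
    rintro _ ⟨⟨s, rfl⟩, ⟨t, ht⟩⟩
    have h := gaugeConfig_inj.1
      (show gaugeConfig (vecA t) (vecD t) = gaugeConfig (vecA s) vecV from ht)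
    rw [e1]
    exact gaugeConfig_inj.2
      ⟨by rw [← h.1, (vecA_eq_vecW (cos_eq_neg_one_of_vecD_eq h.2)).1], rfl⟩
  · rw [e1, deriv_gaugeCircle, deriv_gaugeCircle] at hab
    change a • gaugeTangent (deriv vecA Real.pi) 0 +
      b • gaugeTangent (deriv vecA Real.pi) (deriv vecD Real.pi) ∈ _ at hab
    rw [smul_add_smul_gaugeTangent, smul_zero, zero_add] at hab
    obtain ⟨h1, h2⟩ := gaugeTangent_eq_zero (gaugeTangent_eq_zero_of_mem hab)
    have hb := eq_zero_of_smul h2 (fun h => sqrt_three_ne_zero (by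
      rw [← deriv_vecD_two_pi, h, PiLp.zero_apply]))
    rw [hb, zero_smul, add_zero] at h1
    exact ⟨eq_zero_of_smul h1 (deriv_vecA_ne_zero _), hb⟩

theorem meetTransversally_gaugeCircle {i j : Fin 3} (h : i ≠ j) :
    MeetTransversally (gaugeCircle i) (gaugeCircle j) := by
  fin_cases i <;> fin_cases j
  exacts [(h rfl).elim, meetTransversally_zero_one, meetTransversally_zero_two,
    meetTransversally_zero_one.symm, (h rfl).elim, meetTransversally_one_two,
    meetTransversally_zero_two.symm, meetTransversally_one_two.symm, (h rfl).elim]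

end

noncomputable section

/-! ### The configurations whose first two vectors are fixed -/

theorem exists_cos_sin {c s : ℝ} (h : c ^ 2 + s ^ 2 = 1) :
    ∃ t, Real.cos t = c ∧ Real.sin t = s := by
  have h1 : ‖(⟨c, s⟩ : ℂ)‖ = 1 := by
    have : ‖(⟨c, s⟩ : ℂ)‖ ^ 2 = 1 := by
      rw [Complex.sq_norm, Complex.normSq_mk]
      linarith
    exact (pow_eq_one_iff_of_nonneg (norm_nonneg _) two_ne_zero).1 this
  have h0 : (⟨c, s⟩ : ℂ) ≠ 0 := norm_ne_zero_iff.1 (by rw [h1]; exact one_ne_zero)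
  exact ⟨Complex.arg ⟨c, s⟩, by rw [Complex.cos_arg h0, h1, div_one],
    by rw [Complex.sin_arg, h1, div_one]⟩

theorem exists_eq_vecA {a : R3} (h1 : ‖a‖ = 1) (h2 : inner ℝ vecV a = -1 / 2) :
    ∃ t, a = vecA t := by
  have h3 := sqrt_three_sq
  have e1 : a 0 ^ 2 + a 1 ^ 2 + a 2 ^ 2 = 1 := by rw [← norm_sq_r3, h1, one_pow]
  rw [inner_r3] at h2
  simp [vecV] at h2
  have e2 : a 1 = √3 * (a 0 - 1) / 3 := by linear_combination 2 * √3 / 3 * h2 - a 1 / 3 * h3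
  obtain ⟨t, hc, hs⟩ := exists_cos_sin (c := (1 - 4 * a 0) / 3) (s := 2 * √3 * a 2 / 3) (by
    rw [e2] at e1
    linear_combination 4 / 3 * e1 + (4 * a 2 ^ 2 / 9 - 4 / 27 * (a 0 - 1) ^ 2) * h3)
  refine ⟨t, r3_ext ?_ ?_ ?_⟩
  · rw [vecA_zero, hc]; ring
  · rw [vecA_one, hc, e2]; ring
  · rw [vecA_two, hs]; linear_combination -a 2 / 3 * h3

theorem exists_eq_vecB {a : R3} (h1 : ‖a‖ = 1) (h2 : inner ℝ a vecU = -1 / 2) :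
    ∃ t, a = vecB t := by
  have h3 := sqrt_three_sq
  have e1 : a 0 ^ 2 + a 1 ^ 2 + a 2 ^ 2 = 1 := by rw [← norm_sq_r3, h1, one_pow]
  rw [inner_r3] at h2
  simp [vecU] at h2
  have e2 : a 1 = -√3 * (a 0 - 1) / 3 := by linear_combination -2 * √3 / 3 * h2 - a 1 / 3 * h3
  obtain ⟨t, hc, hs⟩ := exists_cos_sin (c := (1 - 4 * a 0) / 3) (s := 2 * √3 * a 2 / 3) (by
    rw [e2] at e1
    linear_combination 4 / 3 * e1 + (4 * a 2 ^ 2 / 9 - 4 / 27 * (a 0 - 1) ^ 2) * h3)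
  refine ⟨t, r3_ext ?_ ?_ ?_⟩
  · rw [vecB_zero, hc]; ring
  · rw [vecB_one, hc, e2]; ring
  · rw [vecB_two, hs]; linear_combination -a 2 / 3 * h3

/-- The vectors a and b run over two circles and satisfy one equation between them. The degenerate
solutions a = u and b = v split off, and away from them b is a function of a. -/
theorem IsGauge.cases {a b : R3} (h : IsGauge a b) :
    (∃ t, a = vecU ∧ b = vecB t) ∨ (∃ t, a = vecA t ∧ b = vecV) ∨
      ∃ t, a = vecA t ∧ b = vecD t := by
  obtain ⟨t, rfl⟩ := exists_eq_vecA h.norm_left h.inner_left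
  obtain ⟨T, rfl⟩ := exists_eq_vecB h.norm_right h.inner_right
  have h3 := sqrt_three_sq
  have h1 := Real.sin_sq_add_cos_sq t
  have h2 := Real.sin_sq_add_cos_sq T
  have h5 := five_add_pos t
  have e := h.inner_mid
  rw [inner_r3, vecA_zero, vecA_one, vecA_two, vecB_zero, vecB_one, vecB_two] at e
  by_cases hc : Real.cos t = 1
  · exact Or.inl ⟨T, (vecA_eq_vecU hc).1, rfl⟩
  by_cases hC : Real.cos T = 1
  · exact Or.inr (Or.inl ⟨t, rfl, vecB_eq_vecV hC⟩)
  refine Or.inr (Or.inr ⟨t, rfl, ?_⟩)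
  set c := Real.cos t
  set s := Real.sin t
  set C := Real.cos T
  set S := Real.sin T
  have hc' : 1 - c ≠ 0 := sub_ne_zero.2 (Ne.symm hc)
  have hC' : 1 - C ≠ 0 := sub_ne_zero.2 (Ne.symm hC)
  -- In half angles this says tan(t/2)·tan(T/2) = -2, which determines T from t; the next steps
  -- compute its cosine and sine without dividing by s.
  have e1 : (1 - c) * (1 - C) = -2 * s * S := by
    linear_combination 8 / 3 * e + (-2 / 3 * (s * S) + 1 / 6 * (1 + c) * (1 + C)) * h3
  have hS : S ≠ 0 := fun hS => by
    rw [hS, mul_zero] at e1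
    exact (mul_ne_zero hc' hC') e1
  have e2 : S * (1 - c) = -2 * s * (1 + C) := by
    refine mul_right_cancel₀ hS ?_
    linear_combination (1 - c) * h2 + (1 + C) * e1
  have e3 : C * (5 + 3 * c) = -(3 + 5 * c) := by
    refine mul_left_cancel₀ hc' ?_
    linear_combination (-(1 - c)) * e1 + 2 * s * e2 - 4 * (1 + C) * h1
  have e4 : S * (5 + 3 * c) = -4 * s := by
    refine mul_left_cancel₀ hc' ?_
    linear_combination (5 + 3 * c) * e2 - 2 * s * e3
  have hC3 : C = -(3 + 5 * c) / (5 + 3 * c) := by rw [eq_div_iff h5.ne', e3]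
  have hS4 : S = -4 * s / (5 + 3 * c) := by rw [eq_div_iff h5.ne', e4]
  have h6 : 5 + c * 3 ≠ 0 := by rw [mul_comm]; exact h5.ne'
  refine r3_ext ?_ ?_ ?_
  · rw [vecB_zero, vecD_zero]
    change (1 - 3 * C) / 4 = (7 + 9 * c) / (2 * (5 + 3 * c))
    rw [hC3]
    field_simp
    ring
  · rw [vecB_one, vecD_one]
    change √3 * (1 + C) / 4 = √3 * (1 - c) / (2 * (5 + 3 * c))
    rw [hC3]
    field_simp
    ring
  · rw [vecB_two, vecD_two]
    change √3 * S / 2 = -2 * √3 * s / (5 + 3 * c)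
    rw [hS4]
    field_simp
    ring

theorem triSum_gaugeConfig (a b : R3) (i : ZMod 4) : triSum (gaugeConfig a b) i = 0 :=
  triSum_loopConfig _ i

theorem mem_iUnion_range_gaugeCircle {x : Config (LoopSite 4)} :
    x ∈ ⋃ i, Set.range (gaugeCircle i) ↔ ∃ a b, IsGauge a b ∧ x = gaugeConfig a b := by
  rw [Set.mem_iUnion]
  constructor
  · rintro ⟨i, t, rfl⟩
    fin_cases i
    exacts [⟨_, _, isGauge_vecU_vecB t, rfl⟩, ⟨_, _, isGauge_vecA_vecV t, rfl⟩,
      ⟨_, _, isGauge_vecA_vecD t, rfl⟩]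
  · rintro ⟨a, b, h, rfl⟩
    rcases h.cases with ⟨t, rfl, rfl⟩ | ⟨t, rfl, rfl⟩ | ⟨t, rfl, rfl⟩
    exacts [⟨0, t, rfl⟩, ⟨1, t, rfl⟩, ⟨2, t, rfl⟩]

/-! ### The minimal set is a product -/

theorem mem_minimalSet_four_iff (e : Config (LoopSite 4)) :
    e ∈ minimalSet (heisenberg (triangleLoop 4)) ↔
      e ∈ spinSpace (LoopSite 4) ∧ ∀ i, triSum e i = 0 :=
  mem_minimalSet_iff edgesOfTriangles_four (isGauge_vecU_vecB 0).mem_spinSpace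
    (triSum_loopConfig _) e

theorem exists_rot {f g : R3} (hf : ‖f‖ = 1) (hg : ‖g‖ = 1) (hfg : inner ℝ f g = 0) :
    ∃ R : SO3, ∀ x : R3, rot R x = x 0 • f + x 1 • g + x 2 • cross f g := by
  have hf' : f 0 ^ 2 + f 1 ^ 2 + f 2 ^ 2 = 1 := by rw [← norm_sq_r3, hf, one_pow]
  have hg' : g 0 ^ 2 + g 1 ^ 2 + g 2 ^ 2 = 1 := by rw [← norm_sq_r3, hg, one_pow]
  have hc : inner ℝ (cross f g) (cross f g) = 1 := by
    rw [inner_cross_cross, real_inner_self_eq_norm_sq, real_inner_self_eq_norm_sq, hf, hg, hfg]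
    norm_num
  have hfc : inner ℝ f (cross f g) = 0 := inner_self_cross f g
  have hgc : inner ℝ g (cross f g) = 0 := by rw [real_inner_comm, inner_cross_self_right]
  rw [inner_r3] at hfg hc hfc hgc
  set k := cross f g with hk
  have k0 : k 0 = f 1 * g 2 - f 2 * g 1 := cross_zero_apply f g
  have k1 : k 1 = f 2 * g 0 - f 0 * g 2 := cross_one_apply f g
  have k2 : k 2 = f 0 * g 1 - f 1 * g 0 := cross_two_apply f g
  set M : Matrix (Fin 3) (Fin 3) ℝ := !![f 0, g 0, k 0; f 1, g 1, k 1; f 2, g 2, k 2] with hM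
  have hMO : M ∈ Matrix.orthogonalGroup (Fin 3) ℝ := by
    rw [Matrix.mem_orthogonalGroup_iff']
    ext i j
    fin_cases i <;> fin_cases j <;>
      simp [hM, Matrix.mul_apply, Fin.sum_univ_three] <;> linarith
  have hdet : M.det = 1 := by
    rw [Matrix.det_fin_three]
    simp [hM]
    linear_combination hc - k 0 * k0 - k 1 * k1 - k 2 * k2
  refine ⟨⟨M, Matrix.mem_specialOrthogonalGroup_iff.2 ⟨hMO, hdet⟩⟩, fun x => ?_⟩
  refine r3_ext ?_ ?_ ?_ <;> rw [rot_apply] <;> simp [hM] <;> ring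

theorem exists_rotate_eq {e : Config (LoopSite 4)} (he : e ∈ spinSpace (LoopSite 4))
    (he0 : ∀ i, triSum e i = 0) :
    ∃ (R : SO3) (a b : R3), IsGauge a b ∧ rotate R (gaugeConfig a b) = e := by
  have h3 := sqrt_three_sq
  have hin := inner_succ he he0
  set x : R3 := e (Sum.inl (0 : Fin 4)) with hx
  set y : R3 := e (Sum.inl (1 : Fin 4)) with hy
  have nx : ‖x‖ = 1 := he _
  have ny : ‖y‖ = 1 := he _
  have hxy : inner ℝ x y = -1 / 2 := hin (0 : Fin 4)
  have hyx : inner ℝ y x = -1 / 2 := by rw [real_inner_comm, hxy]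
  -- In the standard frame the first axis is -(u + v) and the second is (v - u)/√3; their analogues
  -- for x and y are the images of these axes under the desired rotation.
  obtain ⟨R, hR⟩ := exists_rot (f := -(x + y)) (g := (√3 / 3) • (y - x))
    (norm_neg_add_eq_one nx ny hxy) (by
      have : ‖(√3 / 3) • (y - x)‖ ^ 2 = 1 := by
        rw [norm_smul, mul_pow, norm_sub_sq_real, nx, ny, hyx, Real.norm_eq_abs, sq_abs, div_pow,
          h3]
        norm_num
      exact (pow_eq_one_iff_of_nonneg (norm_nonneg _) two_ne_zero).1 this) (by
      simp only [inner_neg_left, inner_smul_right, inner_add_left, inner_sub_right,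
        real_inner_self_eq_norm_sq, nx, ny, hxy, hyx]
      ring)
  have h4 : √3 / 2 * (√3 / 3) = 1 / 2 := by linear_combination h3 / 6
  have hRU : rot R vecU = x := by
    have h5 : -√3 / 2 * (√3 / 3) = -1 / 2 := by linear_combination -h4
    rw [hR, show vecU 0 = -1 / 2 by simp [vecU], show vecU 1 = -√3 / 2 by simp [vecU],
      show vecU 2 = 0 by simp [vecU], smul_smul, h5]
    module
  have hRV : rot R vecV = y := by
    rw [hR, show vecV 0 = -1 / 2 by simp [vecV], show vecV 1 = √3 / 2 by simp [vecV],
      show vecV 2 = 0 by simp [vecV], smul_smul, h4]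
    module
  set a := rot R⁻¹ (e (Sum.inl (2 : Fin 4))) with ha
  set b := rot R⁻¹ (e (Sum.inl (3 : Fin 4))) with hb
  have hRa : rot R a = e (Sum.inl (2 : Fin 4)) := rot_rot_inv _ _
  have hRb : rot R b = e (Sum.inl (3 : Fin 4)) := rot_rot_inv _ _
  refine ⟨R, a, b, ⟨?_, ?_, ?_, ?_, ?_⟩, ?_⟩
  · rw [ha, norm_rot, he]
  · rw [hb, norm_rot, he]
  · rw [← inner_rot R, hRV, hRa]
    exact hin (1 : Fin 4)
  · rw [← inner_rot R, hRa, hRb]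
    exact hin (2 : Fin 4)
  · rw [← inner_rot R, hRU, hRb]
    exact hin (3 : Fin 4)
  · have h : ∀ i, triSum (rotate R (gaugeConfig a b)) i = 0 := fun i => by
      rw [triSum_rotate, triSum_gaugeConfig, map_zero]
    rw [eq_loopConfig h, eq_loopConfig he0]
    congr 1
    ext1 i
    change Fin 4 at i
    fin_cases i
    exacts [hRU, hRV, hRa, hRb]

/-- The vectors u and v span the first two axes, and the cross product, which rotations preserve,
gives the third. -/
theorem rot_ext {R S : SO3} (hU : rot R vecU = rot S vecU) (hV : rot R vecV = rot S vecV) :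
    R = S := by
  have h3 := sqrt_three_ne_zero
  have e0 : (EuclideanSpace.single 0 1 : R3) = -(vecU + vecV) := by
    refine r3_ext ?_ ?_ ?_ <;> simp [vecU, vecV] <;> ring
  have e1 : (EuclideanSpace.single 1 1 : R3) = (√3)⁻¹ • (vecV - vecU) := by
    refine r3_ext ?_ ?_ ?_ <;> simp [vecU, vecV] <;> (field_simp; ring)
  have e2 : (EuclideanSpace.single 2 1 : R3) = cross (EuclideanSpace.single 0 1)
      (EuclideanSpace.single 1 1) := by
    refine r3_ext ?_ ?_ ?_ <;>
      simp only [cross_zero_apply, cross_one_apply, cross_two_apply] <;> simp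
  have f0 : rot R (EuclideanSpace.single 0 1) = rot S (EuclideanSpace.single 0 1) := by
    rw [e0, map_neg, map_neg, map_add, map_add, hU, hV]
  have f1 : rot R (EuclideanSpace.single 1 1) = rot S (EuclideanSpace.single 1 1) := by
    rw [e1, map_smul, map_smul, map_sub, map_sub, hU, hV]
  have f2 : rot R (EuclideanSpace.single 2 1) = rot S (EuclideanSpace.single 2 1) := by
    rw [e2, ← cross_rot, ← cross_rot, f0, f1]
  refine Subtype.ext (Matrix.ext fun i j => ?_)
  have h : ∀ (T : SO3) (j : Fin 3), rot T (EuclideanSpace.single j 1) i =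
      (T : Matrix (Fin 3) (Fin 3) ℝ) i j := fun T j => by
    rw [rot_apply]
    fin_cases j <;> simp
  rw [← h R, ← h S]
  fin_cases j
  exacts [congrArg (fun x : R3 => x i) f0, congrArg (fun x : R3 => x i) f1,
    congrArg (fun x : R3 => x i) f2]

theorem rot_injective (R : SO3) : Function.Injective (rot R) := fun x y h => by
  rw [← rot_inv_rot R x, h, rot_inv_rot]

theorem rotate_gaugeConfig_inj {R S : SO3} {a b c d : R3}
    (h : rotate R (gaugeConfig a b) = rotate S (gaugeConfig c d)) :
    R = S ∧ gaugeConfig a b = gaugeConfig c d := by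
  have hRS : R = S := rot_ext (congrFun h (Sum.inl (0 : Fin 4))) (congrFun h (Sum.inl (1 : Fin 4)))
  subst hRS
  exact ⟨rfl, funext fun v => rot_injective R (congrFun h v)⟩

theorem continuous_rotate {V : Type*} : Continuous fun p : SO3 × Config V => rotate p.1 p.2 := by
  refine continuous_pi fun v => (PiLp.continuous_toLp 2 _).comp ?_
  refine Continuous.matrix_mulVec (continuous_subtype_val.comp continuous_fst) ?_
  exact (PiLp.continuous_ofLp 2 _).comp ((continuous_apply v).comp continuous_snd)

instance compactSpace_SO3 : CompactSpace SO3 := by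
  refine isCompact_iff_compactSpace.1 ?_
  have hb : IsCompact (Set.univ.pi fun _ : Fin 3 => Set.univ.pi fun _ : Fin 3 =>
      Set.Icc (-1 : ℝ) 1) := isCompact_univ_pi fun _ => isCompact_univ_pi fun _ => isCompact_Icc
  refine hb.of_isClosed_subset ?_ ?_
  · have : (Matrix.specialOrthogonalGroup (Fin 3) ℝ : Set (Matrix (Fin 3) (Fin 3) ℝ)) =
        {A | star A * A = 1} ∩ {A | A.det = 1} := by
      ext A
      rw [SetLike.mem_coe, Matrix.mem_specialOrthogonalGroup_iff, Matrix.mem_orthogonalGroup_iff']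
      rfl
    rw [this]
    exact (isClosed_eq (by fun_prop) continuous_const).inter
      (isClosed_eq (by fun_prop) continuous_const)
  · intro A hA i _ j _
    have := entry_norm_bound_of_unitary (Matrix.mem_specialOrthogonalGroup_iff.1 hA).1 i j
    rwa [Real.norm_eq_abs, abs_le] at this

theorem isCompact_iUnion_range_gaugeCircle : IsCompact (⋃ i, Set.range (gaugeCircle i)) := by
  refine isCompact_iUnion fun i => ?_
  have h := isEmbeddedCircle_gaugeCircle i
  refine Function.Periodic.compact_of_continuous (c := 2 * Real.pi) (fun t => ?_)
    Real.two_pi_pos.ne' h.smooth.continuous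
  exact (h.inj _ _).2 ⟨1, by simp⟩

/-- The map from the product to the minimal set. -/
def productMap (p : SO3 × (⋃ i, Set.range (gaugeCircle i) : Set (Config (LoopSite 4)))) :
    (minimalSet (heisenberg (triangleLoop 4)) : Set (Config (LoopSite 4))) :=
  ⟨rotate p.1 p.2, by
    obtain ⟨a, b, h, hx⟩ := mem_iUnion_range_gaugeCircle.1 p.2.2
    rw [mem_minimalSet_four_iff, hx]
    exact ⟨rotate_mem_spinSpace _ h.mem_spinSpace, fun i => by
      rw [triSum_rotate, triSum_gaugeConfig, map_zero]⟩⟩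

theorem productMap_bijective : Function.Bijective productMap := by
  constructor
  · rintro ⟨R, x, hx⟩ ⟨S, y, hy⟩ h
    obtain ⟨a, b, _, rfl⟩ := mem_iUnion_range_gaugeCircle.1 hx
    obtain ⟨c, d, _, rfl⟩ := mem_iUnion_range_gaugeCircle.1 hy
    obtain ⟨h1, h2⟩ := rotate_gaugeConfig_inj (Subtype.ext_iff.1 h)
    exact Prod.ext h1 (Subtype.ext h2)
  · rintro ⟨e, he⟩
    rw [mem_minimalSet_four_iff] at he
    obtain ⟨R, a, b, h, hR⟩ := exists_rotate_eq he.1 he.2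
    exact ⟨(R, ⟨gaugeConfig a b, mem_iUnion_range_gaugeCircle.2 ⟨a, b, h, rfl⟩⟩), Subtype.ext hR⟩

/-- The homeomorphism from the product to the minimal set. -/
def productHomeo : (SO3 × (⋃ i, Set.range (gaugeCircle i) : Set (Config (LoopSite 4)))) ≃ₜ
    (minimalSet (heisenberg (triangleLoop 4)) : Set (Config (LoopSite 4))) :=
  haveI : CompactSpace (⋃ i, Set.range (gaugeCircle i) : Set (Config (LoopSite 4))) :=
    isCompact_iff_compactSpace.1 isCompact_iUnion_range_gaugeCircle
  Continuous.homeoOfEquivCompactToT2 (f := Equiv.ofBijective productMap productMap_bijective)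
    (Continuous.subtype_mk (continuous_rotate.comp
      (continuous_fst.prodMk (continuous_subtype_val.comp continuous_snd))) _)

theorem coe_productHomeo (R : SO3)
    (x : (⋃ i, Set.range (gaugeCircle i) : Set (Config (LoopSite 4)))) :
    (productHomeo (R, x) : Config (LoopSite 4)) = rotate R x := rfl

end

noncomputable section

/-! ### Planar configurations are local minima of the Melin value -/

theorem inner_vecA_vecU (t : ℝ) : inner ℝ (vecA t) vecU = (1 + 3 * Real.cos t) / 4 := by
  rw [inner_r3, vecA_zero, vecA_one, vecA_two]
  simp [vecU]
  linear_combination (1 + Real.cos t) / 8 * sqrt_three_sq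

theorem inner_vecB_vecV (t : ℝ) : inner ℝ (vecB t) vecV = (1 + 3 * Real.cos t) / 4 := by
  rw [inner_r3, vecB_zero, vecB_one, vecB_two]
  simp [vecV]
  linear_combination (1 + Real.cos t) / 8 * sqrt_three_sq

theorem inner_vecW (x : R3) : inner ℝ x vecW = x 0 := by
  rw [inner_r3]
  simp [vecW]

theorem inner_vecD_vecV (t : ℝ) :
    inner ℝ (vecD t) vecV = -(1 + 3 * Real.cos t) / (5 + 3 * Real.cos t) := by
  have h5 := (five_add_pos t).ne'
  have h6 : 5 + Real.cos t * 3 ≠ 0 := by rwa [mul_comm]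
  rw [inner_r3, vecD_zero, vecD_one, vecD_two]
  simp [vecV]
  field_simp
  linear_combination (1 - Real.cos t) * sqrt_three_sq

/-- The product (1 + 3cos t)/4 exceeding 99/100 gives cos t > 49/50, the range of the certificates.
Only two of the three circles pass near a given planar point. -/
theorem le_melinValue_near_UV {a b : R3} (h : IsGauge a b) (ha : 99 / 100 < inner ℝ a vecU)
    (hb : 99 / 100 < inner ℝ b vecV) (R : SO3) : 14 + 2 * √3 ≤
      melinValue (heisenberg (triangleLoop 4)) (rotate R (gaugeConfig a b)) := by
  rcases h.cases with ⟨t, rfl, rfl⟩ | ⟨t, rfl, rfl⟩ | ⟨t, rfl, rfl⟩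
  · rw [inner_vecB_vecV] at hb
    exact le_melinValue_UV_moveThree (by linarith) R
  · rw [inner_vecA_vecU] at ha
    exact le_melinValue_UV_moveTwo (by linarith) R
  · rw [inner_vecA_vecU] at ha
    -- When the third vector is near u, the third circle has its fourth vector near w, far from v.
    rw [inner_vecD_vecV, lt_div_iff₀ (five_add_pos t)] at hb
    linarith

theorem le_melinValue_near_UW {a b : R3} (h : IsGauge a b) (ha : 99 / 100 < inner ℝ a vecU)
    (hb : 99 / 100 < inner ℝ b vecW) (R : SO3) : 14 + 2 * √3 ≤
      melinValue (heisenberg (triangleLoop 4)) (rotate R (gaugeConfig a b)) := by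
  rcases h.cases with ⟨t, rfl, rfl⟩ | ⟨t, rfl, rfl⟩ | ⟨t, rfl, rfl⟩
  · rw [inner_vecW, vecB_zero] at hb
    exact le_melinValue_UW_moveThree (by linarith) R
  · rw [inner_vecW] at hb
    simp [vecV] at hb
    linarith
  · rw [inner_vecA_vecU] at ha
    exact le_melinValue_UW_moveBoth (by linarith) R

theorem le_melinValue_near_WV {a b : R3} (h : IsGauge a b) (ha : 99 / 100 < inner ℝ a vecW)
    (hb : 99 / 100 < inner ℝ b vecV) (R : SO3) : 14 + 2 * √3 ≤
      melinValue (heisenberg (triangleLoop 4)) (rotate R (gaugeConfig a b)) := by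
  rw [inner_vecW] at ha
  rcases h.cases with ⟨t, rfl, rfl⟩ | ⟨t, rfl, rfl⟩ | ⟨t, rfl, rfl⟩
  · simp [vecU] at ha
    linarith
  · rw [vecA_zero] at ha
    exact le_melinValue_WV_moveTwo (by linarith) R
  · rw [vecA_zero] at ha
    exact le_melinValue_WV_moveBoth (by linarith) R

theorem cos_eq_of_sin_eq_zero {t : ℝ} (h : √3 * Real.sin t = 0) :
    Real.cos t = 1 ∨ Real.cos t = -1 := by
  have h1 := (mul_eq_zero.1 h).resolve_left sqrt_three_ne_zero
  exact (Real.sin_eq_zero_iff_cos_eq.1 h1)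

/-- A plane containing u and v is horizontal, so planarity means that the heights vanish, and sin t
= 0 leaves two points on each circle, each of them common to two circles. -/
theorem IsGauge.eq_of_isPlanar {a b : R3} (h : IsGauge a b) (hp : IsPlanar (gaugeConfig a b)) :
    (a = vecU ∧ b = vecV) ∨ (a = vecU ∧ b = vecW) ∨ (a = vecW ∧ b = vecV) := by
  obtain ⟨m, hm, hp⟩ := hp
  have hU : inner ℝ m vecU = 0 := hp (Sum.inl (0 : Fin 4))
  have hV : inner ℝ m vecV = 0 := hp (Sum.inl (1 : Fin 4))
  have ha : inner ℝ m a = 0 := hp (Sum.inl (2 : Fin 4))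
  have hb : inner ℝ m b = 0 := hp (Sum.inl (3 : Fin 4))
  rw [inner_r3] at hU hV ha hb
  simp [vecU, vecV] at hU hV
  have h0 : m 0 = 0 := by linarith
  have h1 : m 1 = 0 := by
    have : m 1 * √3 = 0 := by linarith
    exact (mul_eq_zero.1 this).resolve_right sqrt_three_ne_zero
  have h2 : m 2 ≠ 0 := fun h2 => hm (r3_ext h0 h1 h2)
  rw [h0, h1, zero_mul, zero_mul, zero_add, zero_add] at ha hb
  replace ha := (mul_eq_zero.1 ha).resolve_left h2
  replace hb := (mul_eq_zero.1 hb).resolve_left h2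
  rcases h.cases with ⟨t, rfl, rfl⟩ | ⟨t, rfl, rfl⟩ | ⟨t, rfl, rfl⟩
  · rw [vecB_two] at hb
    rcases cos_eq_of_sin_eq_zero (by linarith) with hc | hc
    · exact Or.inl ⟨rfl, vecB_eq_vecV hc⟩
    · exact Or.inr (Or.inl ⟨rfl, (vecA_eq_vecW hc).2.1⟩)
  · rw [vecA_two] at ha
    rcases cos_eq_of_sin_eq_zero (by linarith) with hc | hc
    · exact Or.inl ⟨(vecA_eq_vecU hc).1, rfl⟩
    · exact Or.inr (Or.inr ⟨(vecA_eq_vecW hc).1, rfl⟩)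
  · rw [vecA_two] at ha
    rcases cos_eq_of_sin_eq_zero (by linarith) with hc | hc
    · exact Or.inr (Or.inl (vecA_eq_vecU hc))
    · exact Or.inr (Or.inr ⟨(vecA_eq_vecW hc).1, (vecA_eq_vecW hc).2.2⟩)

theorem isPlanar_of_rotate {V : Type*} {R : SO3} {e : Config V} (h : IsPlanar (rotate R e)) :
    IsPlanar e := by
  obtain ⟨m, hm, h⟩ := h
  refine ⟨rot R⁻¹ m, fun h0 => hm ?_, fun v => ?_⟩
  · rw [← rot_rot_inv R m, h0, map_zero]
  · rw [← inner_rot R, rot_rot_inv]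
    exact h v

/-- Near a planar gauge configuration, the Melin value is bounded below on all the orbits. -/
theorem IsGauge.eventually_le_melinValue {a₀ b₀ : R3} (h : IsGauge a₀ b₀)
    (hp : IsPlanar (gaugeConfig a₀ b₀)) : ∀ᶠ x in nhds (gaugeConfig a₀ b₀), ∀ a b, IsGauge a b →
      x = gaugeConfig a b → ∀ R : SO3, 14 + 2 * √3 ≤
        melinValue (heisenberg (triangleLoop 4)) (rotate R x) := by
  have hn : ∀ (i : ZMod 4) (y : R3), ‖y‖ = 1 → gaugeConfig a₀ b₀ (Sum.inl i) = y →
      ∀ᶠ x : Config (LoopSite 4) in nhds (gaugeConfig a₀ b₀),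
        99 / 100 < inner ℝ (x (Sum.inl i)) y := by
    intro i y hy h0
    have hc : Continuous fun x : Config (LoopSite 4) => inner ℝ (x (Sum.inl i)) y := by fun_prop
    refine hc.continuousAt.eventually_const_lt ?_
    change 99 / 100 < inner ℝ (gaugeConfig a₀ b₀ (Sum.inl i)) y
    rw [show gaugeConfig a₀ b₀ (Sum.inl i) = y from h0, real_inner_self_eq_norm_sq, hy]
    norm_num
  filter_upwards [hn (2 : Fin 4) a₀ h.norm_left rfl, hn (3 : Fin 4) b₀ h.norm_right rfl] with x h2 h3 a b hab hx R
  subst hx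
  rcases h.eq_of_isPlanar hp with ⟨rfl, rfl⟩ | ⟨rfl, rfl⟩ | ⟨rfl, rfl⟩
  exacts [le_melinValue_near_UV hab h2 h3 R, le_melinValue_near_UW hab h2 h3 R,
    le_melinValue_near_WV hab h2 h3 R]

theorem isLocalMinOn_melinValue {e : Config (LoopSite 4)}
    (he : e ∈ minimalSet (heisenberg (triangleLoop 4))) (hp : IsPlanar e) :
    IsLocalMinOn (melinValue (heisenberg (triangleLoop 4)))
      (minimalSet (heisenberg (triangleLoop 4))) e := by
  have he' := (mem_minimalSet_four_iff e).1 he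
  have hle := melinValue_planar_le_value he'.1 he'.2 hp
  obtain ⟨⟨R, x, hx⟩, hRx⟩ := productHomeo.surjective ⟨e, he⟩
  obtain ⟨a, b, h, rfl⟩ := mem_iUnion_range_gaugeCircle.1 hx
  have hRe : rotate R (gaugeConfig a b) = e := congrArg Subtype.val hRx
  have hev := h.eventually_le_melinValue (isPlanar_of_rotate (R := R) (by rwa [hRe]))
  have hsymm : productHomeo.symm ⟨e, he⟩ = (R, ⟨gaugeConfig a b, hx⟩) := by
    rw [← hRx, Homeomorph.symm_apply_apply]
  -- Nearby minimal configurations have nearby representatives on the circles, and the lower bound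
  -- there is uniform in the rotation; invariance of the Melin value under rotations is not needed.
  have hcont : Continuous fun y => ((productHomeo.symm y).2 : Config (LoopSite 4)) :=
    continuous_subtype_val.comp (continuous_snd.comp productHomeo.symm.continuous)
  have hev' : ∀ᶠ y : minimalSet (heisenberg (triangleLoop 4)) in nhds ⟨e, he⟩,
      14 + 2 * √3 ≤ melinValue (heisenberg (triangleLoop 4)) y := by
    have ht := hcont.tendsto ⟨e, he⟩
    rw [hsymm] at ht
    filter_upwards [ht.eventually hev] with y hy
    obtain ⟨c, d, hcd, hy'⟩ := mem_iUnion_range_gaugeCircle.1 (productHomeo.symm y).2.2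
    have h1 := hy c d hcd hy' (productHomeo.symm y).1
    rwa [← coe_productHomeo, Prod.mk.eta, Homeomorph.apply_symm_apply] at h1
  rw [IsLocalMinOn, IsMinFilter, nhdsWithin_eq_map_subtype_coe he, Filter.eventually_map]
  filter_upwards [hev'] with y hy using hle.trans hy

end

noncomputable section

/-! ### Velocities of curves in a submanifold -/

section Submanifold

variable {E : Type*} [NormedAddCommGroup E] [NormedSpace ℝ E]

theorem HasDerivAt.mem_submodule [FiniteDimensional ℝ E] {S : Submodule ℝ E} {c : ℝ → E} {ξ : E}
    (hc : HasDerivAt c ξ 0) (h : ∀ᶠ t in nhds 0, c t ∈ S) : ξ ∈ S := by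
  refine (Submodule.closed_of_finiteDimensional S).mem_of_tendsto hc.tendsto_slope_zero ?_
  filter_upwards [nhdsWithin_le_nhds h] with t ht
  rw [zero_add]
  exact S.smul_mem _ (S.sub_mem ht h.self_of_nhds)

/-- The velocities at a point of the curves in a submanifold form a vector space. -/
theorem IsSmoothSubmanifold.exists_curve_add [FiniteDimensional ℝ E] {Z : Set E}
    (hZ : IsSmoothSubmanifold Z) {x ξ₁ ξ₂ : E} {c₁ c₂ : ℝ → E} (h₁ : ∀ t, c₁ t ∈ Z)
    (h₂ : ∀ t, c₂ t ∈ Z) (hx₁ : c₁ 0 = x) (hx₂ : c₂ 0 = x) (hc₁ : HasDerivAt c₁ ξ₁ 0)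
    (hc₂ : HasDerivAt c₂ ξ₂ 0) : ∃ c : ℝ → E, c 0 = x ∧ (∀ᶠ t in nhds 0, c t ∈ Z) ∧
      HasDerivAt c (ξ₁ + ξ₂) 0 := by
  obtain ⟨φ, S, hx, hφ, hψ, hS⟩ := hZ x (hx₁ ▸ h₁ 0)
  have hφx : HasFDerivAt φ (fderiv ℝ φ x) x :=
    ((hφ.contDiffAt (φ.open_source.mem_nhds hx)).differentiableAt (by simp)).hasFDerivAt
  have hψx : HasFDerivAt φ.symm (fderiv ℝ φ.symm (φ x)) (φ x) :=
    ((hψ.contDiffAt (φ.open_target.mem_nhds (φ.map_source hx))).differentiableAt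
      (by simp)).hasFDerivAt
  have hmem : ∀ y ∈ φ.source, y ∈ Z → φ y ∈ S := fun y hy hyZ =>
    (hS.subset ⟨y, ⟨hy, hyZ⟩, rfl⟩).2
  have hdS : ∀ (c : ℝ → E) (ξ : E), (∀ t, c t ∈ Z) → c 0 = x → HasDerivAt c ξ 0 →
      fderiv ℝ φ x ξ ∈ S := by
    intro c ξ h h0 hc
    subst h0
    refine (hφx.comp_hasDerivAt (0 : ℝ) hc).mem_submodule ?_
    filter_upwards [hc.continuousAt.eventually (φ.open_source.mem_nhds hx)] with t ht
    exact hmem _ ht (h t)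
  set η := fderiv ℝ φ x (ξ₁ + ξ₂) with hη
  -- Read in the chart, both velocities lie in the linear subspace S, hence so does their sum;
  -- pulling back the straight line in this direction gives the curve.
  have hηS : η ∈ S := by
    rw [hη, map_add]
    exact S.add_mem (hdS c₁ ξ₁ h₁ hx₁ hc₁) (hdS c₂ ξ₂ h₂ hx₂ hc₂)
  have hline : HasDerivAt (fun t : ℝ => φ x + t • η) η 0 := by
    simpa using ((hasDerivAt_id (0 : ℝ)).smul_const η).const_add (φ x)
  have hψη : fderiv ℝ φ.symm (φ x) η = ξ₁ + ξ₂ := by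
    have h1 : HasFDerivAt (φ.symm ∘ φ) ((fderiv ℝ φ.symm (φ x)).comp (fderiv ℝ φ x)) x :=
      hψx.comp x hφx
    have h2 : HasFDerivAt (φ.symm ∘ φ) (ContinuousLinearMap.id ℝ E) x := by
      refine (hasFDerivAt_id x).congr_of_eventuallyEq ?_
      filter_upwards [φ.open_source.mem_nhds hx] with y hy using φ.left_inv hy
    exact congrArg (fun L : E →L[ℝ] E => L (ξ₁ + ξ₂)) (h1.unique h2)
  refine ⟨fun t => φ.symm (φ x + t • η), ?_, ?_, ?_⟩
  · simp [φ.left_inv hx]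
  · have h1 : (fun t : ℝ => φ x + t • η) 0 ∈ φ.target := by simpa using φ.map_source hx
    filter_upwards [hline.continuousAt.eventually (φ.open_target.mem_nhds h1)] with t ht
    obtain ⟨y, ⟨hy, hyZ⟩, hyt⟩ := hS.superset
      ⟨ht, S.add_mem (hmem x hx (hx₁ ▸ h₁ 0)) (S.smul_mem t hηS)⟩
    rw [← hyt, φ.left_inv hy]
    exact hyZ
  · rw [← hψη]
    refine HasFDerivAt.comp_hasDerivAt (0 : ℝ) ?_ hline
    simpa using hψx

end Submanifold

/-! ### The loop of six triangles -/

theorem hasDerivAt_loopConfig {n : ℕ} {a : ℝ → ZMod n → R3} {a' : ZMod n → R3} {t : ℝ}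
    (h : ∀ i, HasDerivAt (fun t => a t i) (a' i) t) :
    HasDerivAt (fun t => loopConfig (a t)) (loopConfig a') t := by
  refine hasDerivAt_pi.2 fun v => ?_
  rcases v with i | i
  exacts [h i, ((h i).add (h (i + 1))).neg]

/-- The alternating sum of the scalar products of the consecutive inner vectors. -/
def alternatingForm (e : Config (LoopSite 6)) : ℝ :=
  inner ℝ (e (Sum.inl 0)) (e (Sum.inl 1)) - inner ℝ (e (Sum.inl 1)) (e (Sum.inl 2)) +
    inner ℝ (e (Sum.inl 2)) (e (Sum.inl 3)) - inner ℝ (e (Sum.inl 3)) (e (Sum.inl 4)) +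
    inner ℝ (e (Sum.inl 4)) (e (Sum.inl 5)) - inner ℝ (e (Sum.inl 5)) (e (Sum.inl 0))

/-- The configuration of the loop of six triangles where the vectors at the inner sites are
`a, b, u, v, u, v`. -/
def sixConfig (a b : R3) : Config (LoopSite 6) :=
  loopConfig (n := 6) (![a, b, vecU, vecV, vecU, vecV] : Fin 6 → R3)

theorem sixConfig_mem_spinSpace {a b : R3} (ha : ‖a‖ = 1) (hb : ‖b‖ = 1)
    (hva : inner ℝ vecV a = -1 / 2) (hab : inner ℝ a b = -1 / 2) (hbu : inner ℝ b vecU = -1 / 2) :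
    sixConfig a b ∈ spinSpace (LoopSite 6) := by
  have hUV := inner_vecU_vecV
  have hVU : inner ℝ vecV vecU = -1 / 2 := by rw [real_inner_comm, hUV]
  refine loopConfig_mem_spinSpace (fun i => ?_) (fun i => ?_)
  · change Fin 6 at i
    fin_cases i
    exacts [ha, hb, norm_vecU, norm_vecV, norm_vecU, norm_vecV]
  · change Fin 6 at i
    fin_cases i
    exacts [hab, hbu, hUV, hVU, hUV, hva]

theorem mem_minimalSet_six_iff (e : Config (LoopSite 6)) :
    e ∈ minimalSet (heisenberg (triangleLoop 6)) ↔
      e ∈ spinSpace (LoopSite 6) ∧ ∀ i, triSum e i = 0 :=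
  mem_minimalSet_iff edgesOfTriangles_six
    (sixConfig_mem_spinSpace norm_vecU norm_vecV (by rw [real_inner_comm, inner_vecU_vecV])
      inner_vecU_vecV (by rw [real_inner_comm, inner_vecU_vecV])) (triSum_loopConfig _) e

theorem alternatingForm_eq_zero {e : Config (LoopSite 6)}
    (he : e ∈ minimalSet (heisenberg (triangleLoop 6))) : alternatingForm e = 0 := by
  rw [mem_minimalSet_six_iff] at he
  have h := inner_succ he.1 he.2
  have h0 : inner ℝ (e (Sum.inl 0)) (e (Sum.inl 1)) = -1 / 2 := h 0
  have h1 : inner ℝ (e (Sum.inl 1)) (e (Sum.inl 2)) = -1 / 2 := h 1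
  have h2 : inner ℝ (e (Sum.inl 2)) (e (Sum.inl 3)) = -1 / 2 := h 2
  have h3 : inner ℝ (e (Sum.inl 3)) (e (Sum.inl 4)) = -1 / 2 := h 3
  have h4 : inner ℝ (e (Sum.inl 4)) (e (Sum.inl 5)) = -1 / 2 := h 4
  have h5 : inner ℝ (e (Sum.inl 5)) (e (Sum.inl 0)) = -1 / 2 := h 5
  rw [alternatingForm, h0, h1, h2, h3, h4, h5]
  norm_num

/-- At the alternating configuration the two neighbours of each inner site coincide and enter with
opposite signs, so the linear terms cancel; the constant term is an alternating sum of equal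
products. -/
theorem alternatingForm_sub (e : Config (LoopSite 6)) :
    alternatingForm (e - sixConfig vecU vecV) = alternatingForm e := by
  have h0 : sixConfig vecU vecV (Sum.inl 0) = vecU := rfl
  have h1 : sixConfig vecU vecV (Sum.inl 1) = vecV := rfl
  have h2 : sixConfig vecU vecV (Sum.inl 2) = vecU := rfl
  have h3 : sixConfig vecU vecV (Sum.inl 3) = vecV := rfl
  have h4 : sixConfig vecU vecV (Sum.inl 4) = vecU := rfl
  have h5 : sixConfig vecU vecV (Sum.inl 5) = vecV := rfl
  simp only [alternatingForm, Pi.sub_apply, h0, h1, h2, h3, h4, h5, inner_sub_left,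
    inner_sub_right]
  linear_combination real_inner_comm vecU (e (Sum.inl 1)) + real_inner_comm vecU (e (Sum.inl 3)) +
    real_inner_comm vecU (e (Sum.inl 5)) + real_inner_comm (e (Sum.inl 0)) vecV +
    real_inner_comm (e (Sum.inl 2)) vecV + real_inner_comm (e (Sum.inl 4)) vecV +
    3 * real_inner_comm vecV vecU

theorem alternatingForm_smul (r : ℝ) (e : Config (LoopSite 6)) :
    alternatingForm (r • e) = r ^ 2 * alternatingForm e := by
  simp only [alternatingForm, Pi.smul_apply, real_inner_smul_left, inner_smul_right]
  ring

theorem continuous_alternatingForm : Continuous alternatingForm := by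
  unfold alternatingForm
  fun_prop

/-- The form is homogeneous and vanishes on differences with the base point, hence on difference
quotients, and by continuity on their limit. This is a second order obstruction obtained from first
derivatives only. -/
theorem alternatingForm_velocity {c : ℝ → Config (LoopSite 6)} {ξ : Config (LoopSite 6)}
    (h0 : c 0 = sixConfig vecU vecV)
    (hc : ∀ᶠ t in nhds 0, c t ∈ minimalSet (heisenberg (triangleLoop 6)))
    (h : HasDerivAt c ξ 0) : alternatingForm ξ = 0 := by
  have h1 := (continuous_alternatingForm.tendsto ξ).comp h.tendsto_slope_zero
  refine tendsto_nhds_unique h1 (tendsto_const_nhds.congr' ?_)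
  filter_upwards [nhdsWithin_le_nhds hc] with t ht
  rw [Function.comp_apply, zero_add, h0, alternatingForm_smul, alternatingForm_sub,
    alternatingForm_eq_zero ht, mul_zero]

theorem deriv_vecA_one (t : ℝ) : deriv vecA t 1 = √3 * Real.sin t / 4 := by
  have h := hasDerivAt_coord (contDiff_vecA.differentiable (by simp) t) 1
  simp only [vecA_one] at h
  refine h.unique ?_
  refine ((((Real.hasDerivAt_cos t).const_add 1).const_mul (-√3)).div_const 4).congr_deriv ?_
  ring

/-- Each of the two vertical velocities taken alone passes the quadratic test, but their sum gives
the product of the two vertical vectors, (√3/2)² = 3/4. -/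
theorem not_isSmoothSubmanifold_six :
    ¬ IsSmoothSubmanifold (minimalSet (heisenberg (triangleLoop 6))) := by
  intro hZ
  obtain ⟨hA, hB, -⟩ := differentiable_vec
  have hA0 : vecA 0 = vecU := (vecA_eq_vecU Real.cos_zero).1
  have hB0 : vecB 0 = vecV := vecB_eq_vecV Real.cos_zero
  have hVU : inner ℝ vecV vecU = -1 / 2 := by rw [real_inner_comm, inner_vecU_vecV]
  have m₁ : ∀ t, sixConfig (vecA t) vecV ∈ minimalSet (heisenberg (triangleLoop 6)) := fun t =>
    (mem_minimalSet_six_iff _).2 ⟨sixConfig_mem_spinSpace (isGauge_vecA_vecV t).norm_left norm_vecV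
      (isGauge_vecA_vecV t).inner_left (isGauge_vecA_vecV t).inner_mid hVU,
      fun i => triSum_loopConfig _ i⟩
  have m₂ : ∀ t, sixConfig vecU (vecB t) ∈ minimalSet (heisenberg (triangleLoop 6)) := fun t =>
    (mem_minimalSet_six_iff _).2 ⟨sixConfig_mem_spinSpace norm_vecU
      (isGauge_vecU_vecB t).norm_right hVU (isGauge_vecU_vecB t).inner_mid
      (isGauge_vecU_vecB t).inner_right, fun i => triSum_loopConfig _ i⟩
  have hc : ∀ y : R3, HasDerivAt (fun _ : ℝ => y) 0 0 := fun y => hasDerivAt_const 0 y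
  have d₁ : HasDerivAt (fun t => sixConfig (vecA t) vecV)
      (loopConfig (n := 6) (![deriv vecA 0, 0, 0, 0, 0, 0] : Fin 6 → R3)) 0 := by
    refine hasDerivAt_loopConfig fun i => ?_
    change Fin 6 at i
    fin_cases i
    exacts [(hA 0).hasDerivAt, hc _, hc _, hc _, hc _, hc _]
  have d₂ : HasDerivAt (fun t => sixConfig vecU (vecB t))
      (loopConfig (n := 6) (![0, deriv vecB 0, 0, 0, 0, 0] : Fin 6 → R3)) 0 := by
    refine hasDerivAt_loopConfig fun i => ?_
    change Fin 6 at i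
    fin_cases i
    exacts [hc _, (hB 0).hasDerivAt, hc _, hc _, hc _, hc _]
  obtain ⟨c, h0, hcZ, hd⟩ := hZ.exists_curve_add m₁ m₂ (by rw [hA0]) (by rw [hB0]) d₁ d₂
  have key := alternatingForm_velocity h0 hcZ hd
  have h1 : alternatingForm
      (loopConfig (n := 6) (![deriv vecA 0, 0, 0, 0, 0, 0] : Fin 6 → R3) +
        loopConfig (n := 6) (![0, deriv vecB 0, 0, 0, 0, 0] : Fin 6 → R3)) =
      inner ℝ (deriv vecA 0 + 0) (0 + deriv vecB 0) -
        inner ℝ (0 + deriv vecB 0) ((0 : R3) + 0) + inner ℝ ((0 : R3) + 0) ((0 : R3) + 0) -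
        inner ℝ ((0 : R3) + 0) ((0 : R3) + 0) + inner ℝ ((0 : R3) + 0) ((0 : R3) + 0) -
        inner ℝ ((0 : R3) + 0) (deriv vecA 0 + 0) := rfl
  rw [h1] at key
  simp only [add_zero, zero_add, inner_zero_left, inner_zero_right, sub_zero] at key
  rw [inner_r3, deriv_vecA_zero, deriv_vecA_one, deriv_vecA_two, deriv_vecB_two, Real.sin_zero,
    Real.cos_zero] at key
  have := sqrt_three_sq
  norm_num at key

end

theorem mainTheorem8 :
    -- six triangles
    ¬ IsSmoothSubmanifold (minimalSet (heisenberg (triangleLoop 6))) ∧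
    -- four triangles: `SO(3)` times a union of three circles
    (∃ γ : Fin 3 → ℝ → Config (LoopSite 4),
      (∀ i, IsEmbeddedCircle (γ i)) ∧
      (∃ Φ : (SO3 × (⋃ i, Set.range (γ i) : Set (Config (LoopSite 4)))) ≃ₜ
          (minimalSet (heisenberg (triangleLoop 4)) : Set (Config (LoopSite 4))),
        ∀ R x, (Φ (R, x) : Config (LoopSite 4)) = rotate R x) ∧
      -- the product of `SO(3)` and each circle is immersed
      (∀ i t, deriv (γ i) t ∉ orbitTangent (γ i t)) ∧
      -- any two of the circles meet at exactly one point, transversally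
      (∀ i j, i ≠ j → ∃ s t, γ i s = γ j t ∧
        Set.range (γ i) ∩ Set.range (γ j) = {γ i s} ∧
        ∀ a b : ℝ, a • deriv (γ i) s + b • deriv (γ j) t ∈ orbitTangent (γ i s) →
          a = 0 ∧ b = 0)) ∧
    -- four triangles: planar configurations are local minima of the Melin value
    (∀ e ∈ minimalSet (heisenberg (triangleLoop 4)), IsPlanar e →
      IsLocalMinOn (melinValue (heisenberg (triangleLoop 4)))
        (minimalSet (heisenberg (triangleLoop 4))) e) :=
  ⟨not_isSmoothSubmanifold_six,
    ⟨gaugeCircle, isEmbeddedCircle_gaugeCircle, ⟨productHomeo, coe_productHomeo⟩,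
      deriv_gaugeCircle_notMem, fun _ _ h => meetTransversally_gaugeCircle h⟩,
    fun _ he hp => isLocalMinOn_melinValue he hp⟩
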